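/- Fix a smooth radial function $\varphi:\mathbb R^3\to\mathbb R$ supported in the closed unit ball with $\varphi\equiv1$ on the closed ball of radius $1/2$, and for $N>0$ let $P_{\le N}$ be the Fourier multiplier with symbol $\varphi(\xi/N)$ (that is, convolution with $x\mapsto(2\pi)^{-3}\int e^{ix\cdot\xi}\varphi(\xi/N)\,d\xi$) and $P_N=P_{\le N}-P_{\le N/2}$. Write $r=\sqrt{x_1^2+x_2^2}$ for $x\in\mathbb R^3$. A vector field is called axisymmetric if its components in cylindrical coordinates around the $x_3$-axis have vanishing derivative in the direction $(-x_2,x_1,0)$. Proposition. Let $2<q<\infty$. There is a constant $C$, depending only on $q$ (and on the choice of $\varphi$), such that the following holds for every $C_0\ge C$ and every $A\ge2$, with $A_j:=A^{C_0^j}$. Let $t_0\in\mathbb R$, $T>0$, and let $u:[t_0-T,t_0]\times\mathbb R^3\to\mathbb R^3$ be a classical solution of the Navier-Stokes equations, i.e. $u$ is smooth and, for some smooth $p:[t_0-T,t_0]\times\mathbb R^3\to\mathbb R$, $$\partial_tu+u\cdot\nabla u+\nabla p-\Delta u=0,\qquad \operatorname{div}u=0 .$$ Assume that $$\|r^{1-\frac3q}u\|_{L^\infty_tL^q_x([t_0-T,t_0]\times\mathbb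 R^3)}\le A,$$ and that either $q>3$, or $q\le3$ and $u(t)$ is axisymmetric for every $t\in[t_0-T,t_0]$. Suppose that $(t_1,x_1)\in[t_0-\frac T2,t_0]\times\mathbb R^3$ and $N_1\ge A_3T^{-1/2}$ satisfy $$|P_{N_1}u(t_1,x_1)|\ge A_1^{-1}N_1 .$$ Then there exist $(t_2,x_2)\in[t_0-T,t_1]\times\mathbb R^3$ and $N_2\in[A_2^{-1}N_1,A_2N_1]$ such that $$A_3^{-1}N_1^{-2}\le t_1-t_2\le A_3N_1^{-2},\qquad |x_2-x_1|\le A_4N_1^{-1},\qquad |P_{N_2}u(t_2,x_2)|\ge A_1^{-1}N_2 .$$ -/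

import Mathlib

open MeasureTheory Set
open scoped ContDiff FourierTransform Gradient Laplacian

/-- Euclidean three-space. -/
abbrev E3 : Type := EuclideanSpace ℝ (Fin 3)

/-- The distance `r = √(x₁² + x₂²)` to the `x₃`-axis (coordinates are numbered from `0`). -/
noncomputable def axialDist (x : E3) : ℝ := Real.sqrt (x 0 ^ 2 + x 1 ^ 2)

/-! ### The Navier-Stokes equations -/

/-- The divergence of a vector field on `ℝ³`. -/
noncomputable def divergence (v : E3 → E3) (x : E3) : ℝ :=
  ∑ i : Fin 3, fderiv ℝ v x (EuclideanSpace.single i 1) i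

/-- `u` is a classical solution of the Navier-Stokes equations (viscosity one, no forcing) on
the slab `[a, b] × ℝ³`: `u` is smooth up to the end times, and for some smooth pressure `p`
one has `∂ₜu + u·∇u + ∇p - Δu = 0` and `div u = 0` on the slab. The time derivative is
one-sided at the end times. -/
def IsClassicalNavierStokes (a b : ℝ) (u : ℝ → E3 → E3) : Prop :=
  ContDiffOn ℝ ∞ (fun z : ℝ × E3 => u z.1 z.2) (Icc a b ×ˢ univ) ∧
  (∀ t ∈ Icc a b, ∀ x : E3, divergence (u t) x = 0) ∧
  ∃ p : ℝ → E3 → ℝ,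
    ContDiffOn ℝ ∞ (fun z : ℝ × E3 => p z.1 z.2) (Icc a b ×ˢ univ) ∧
    ∀ t ∈ Icc a b, ∀ x : E3,
      derivWithin (fun s => u s x) (Icc a b) t + fderiv ℝ (u t) x (u t x)
        + ∇ (p t) x - Δ (u t) x = 0

/-! ### The weighted space-time norm -/

/-- The norm `‖r^α u‖` in `L_t^∞ L_x^q([a, b] × ℝ³)`, as an extended nonnegative number. -/
noncomputable def weightedNorm (q α a b : ℝ) (u : ℝ → E3 → E3) : ENNReal :=
  essSup (fun t => eLpNorm (fun x : E3 => axialDist x ^ α • u t x) (ENNReal.ofReal q) volume)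
    (volume.restrict (Icc a b))

/-! ### Axial symmetry -/

/-- The vector `(-x₂, x₁, 0)`. -/
noncomputable def rotDir (x : E3) : E3 := !₂[-x 1, x 0, 0]

/-- A scalar function is axisymmetric if (away from the axis, where cylindrical coordinates are
defined) its derivative in the direction `(-x₂, x₁, 0)` vanishes. -/
def IsAxisymmetricScalar (f : E3 → ℝ) : Prop :=
  ∀ x : E3, axialDist x ≠ 0 → fderiv ℝ f x (rotDir x) = 0

/-- A vector field is axisymmetric if its radial, angular and vertical components in cylindrical
coordinates are axisymmetric. -/
def IsAxisymmetric (v : E3 → E3) : Prop :=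
  IsAxisymmetricScalar (fun x => (x 0 * v x 0 + x 1 * v x 1) / axialDist x) ∧
  IsAxisymmetricScalar (fun x => (-x 1 * v x 0 + x 0 * v x 1) / axialDist x) ∧
  IsAxisymmetricScalar (fun x => v x 2)

/-! ### Littlewood-Paley projections -/

/-- `φ` is a radial smooth bump, supported in the closed unit ball and equal to one on the closed
ball of radius `1/2`. -/
structure IsLittlewoodPaleyBump (φ : E3 → ℝ) : Prop where
  smooth : ContDiff ℝ ∞ φ
  radial : ∀ ξ η : E3, ‖ξ‖ = ‖η‖ → φ ξ = φ η
  support_subset : Function.support φ ⊆ Metric.closedBall 0 1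
  eq_one : ∀ ξ ∈ Metric.closedBall (0 : E3) (1 / 2), φ ξ = 1

/-- The convolution kernel of `P_{≤ N}`, that is `(2π)⁻³ ∫ e^{i x·ξ} φ(ξ/N) dξ`. Mathlib's inverse
Fourier transform has the phase `e^{2π i x·ξ}`, whence the factor `2π` in the symbol. The kernel
is real because `φ` is real and even. -/
noncomputable def lpKernel (φ : E3 → ℝ) (N : ℝ) (x : E3) : ℝ :=
  (𝓕⁻ (fun ξ : E3 => ((φ ((2 * Real.pi / N) • ξ) : ℝ) : ℂ)) x).re

/-- `P_{≤ N} f`, the Fourier multiplier with symbol `φ(ξ/N)`, as a convolution with its (Schwartz)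
kernel. -/
noncomputable def lpLow (φ : E3 → ℝ) (N : ℝ) (f : E3 → E3) (x : E3) : E3 :=
  ∫ y : E3, lpKernel φ N (x - y) • f y

/-- The Littlewood-Paley projection `P_N = P_{≤ N} - P_{≤ N/2}`. -/
noncomputable def lpProj (φ : E3 → ℝ) (N : ℝ) (f : E3 → E3) (x : E3) : E3 :=
  lpLow φ N f x - lpLow φ (N / 2) f x

/-- The hierarchy of large constants `A_j = A^(C₀^j)`. -/
noncomputable def hierarchyConst (A C₀ : ℝ) (j : ℕ) : ℝ := A ^ (C₀ ^ j)

/-! The proof is by contradiction: a finite bootstrap shows that smallness of the pieces in the past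
forces the piece at the base point to be too small.

The weighted norm and the symmetry enter only through a scale invariant Morrey bound: for some `p`
in `(2, 3]`, the integral of `|u|^p` over any ball of radius `R` is at most `M^p R^(3-p)`, with `M`
a multiple of `A` (`exists_morreyBound`). For `q > 3` this is Hölder's inequality together with
local integrability of `r^(-b)` for `b < 2`. For `q ≤ 3`, a ball of radius `R` at distance `ρ` from
the axis has about `ρ/R` disjoint rotated copies carrying equal mass, and this gain compensates the
weight because `q > 2`.

The second ingredient is a Duhamel estimate that never bounds the pressure
(`exists_duhamel_estimate`). Let `G` be the backward heat evolution of the kernel of `(-Δ)⁻¹ P_N`.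
The field `∇∂ᵢG - ΔG eᵢ` is divergence free, so testing with it removes the pressure; at the final
time it reproduces the `i`-th component of `P_N u`. Hence `P_N u(t)` is controlled by averages of
`|u|` at time `t - σ`, exponentially damped, plus a time integral of averages of `|u|²` against `N⁴
exp(-N²(t-s)/32)`. The weighted `L²` bound that follows from the Morrey bound justifies test fields
without compact support.

Both ingredients are invariant under scaling, so the base point may be taken to be the origin and
the frequency one. Put `ε = 1/A₁` and suppose that all pieces with `N` in `[1/A₂, A₂]` are at most
`εN` for `|x| ≤ A₄` and times in `[-A₃, -1/A₃]`. Consider the energy `∫ |v|² (1+|x|)⁻⁵`, which is a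
priori `O(M²)`, and sum over dyadic frequencies. Low frequencies and spatial tails are small by the
choice of `A₂` and `A₄`. In the middle range with `N ≥ 1` the square integral is at most the
supremum `εN` times the weighted `L¹` norm, and Duhamel bounds the latter by `N⁻¹(M/σ + S)`, where
`S` bounds the earlier energy: the powers of `N` cancel. At high frequencies the `L¹` decay is
interpolated with a uniform `L^p` bound, which needs `p > 2`. The outcome is
`exists_lintegral_sq_le`: the energy improves to `m²(ε(M/σ + S) + ε²)` up to constants, with `m`
about `log₂ A₂`.

Two rounds with `σ = ε⁻²` bring the energy down to `m⁴M²ε²`. Duhamel at frequency one is quadratic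
in the energy scale, so the piece at the origin is `O(m⁴M²ε²)`, which is below `ε` since `A₁` beats
powers of `A` and of `log A₂` (`exists_norm_lpProj_one_lt`, `exists_hierarchy`). One round would
only give `m²M²ε`, which is not enough. -/

/-- The cosine transform `x ↦ ∫ cos(2π ξ·x) m(ξ) dξ`. -/
noncomputable def cosTransform (m : E3 → ℝ) (x : E3) : ℝ :=
  ∫ ξ : E3, Real.cos (2 * Real.pi * inner ℝ ξ x) * m ξ

/-! ### Cosine transforms of smooth compactly supported symbols. -/

theorem integrable_ofReal_of_compactSupport {m : E3 → ℝ} (hm : Continuous m)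
    (hs : HasCompactSupport m) : Integrable (fun ξ => (m ξ : ℂ)) := by
  exact (hm.integrable_of_hasCompactSupport hs).ofReal

/-- The kernel `lpKernel` is a real part; passing to cosine transforms keeps the later kernel
calculus real-valued. -/
theorem re_fourier_eq_cosTransform {m : E3 → ℝ} (hm : Continuous m)
    (hs : HasCompactSupport m) (x : E3) :
    (𝓕 (fun ξ : E3 => (m ξ : ℂ)) x).re = cosTransform m x := by
  have hi : Integrable (fun v : E3 => Complex.exp (↑(-2 * Real.pi * inner ℝ v x) * Complex.I) •
      (m v : ℂ)) := by
    refine (integrable_ofReal_of_compactSupport hm hs).norm.mono' ?_ ?_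
    · have : Continuous fun v : E3 => Complex.exp (↑(-2 * Real.pi * inner ℝ v x) * Complex.I) •
        (m v : ℂ) := by fun_prop
      exact this.aestronglyMeasurable
    · refine Filter.Eventually.of_forall fun v => ?_
      rw [norm_smul, Complex.norm_exp_ofReal_mul_I, one_mul]
  rw [Real.fourier_eq', cosTransform, ← RCLike.re_eq_complex_re, ← integral_re hi]
  refine integral_congr_ae (Filter.Eventually.of_forall fun v => ?_)
  simp only [smul_eq_mul, RCLike.re_eq_complex_re, Complex.re_mul_ofReal,
    Complex.exp_ofReal_mul_I_re]
  rw [show -2 * Real.pi * inner ℝ v x = -(2 * Real.pi * inner ℝ v x) by ring, Real.cos_neg]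

theorem re_fourierInv_eq_cosTransform {m : E3 → ℝ} (hm : Continuous m)
    (hs : HasCompactSupport m) (x : E3) :
    (𝓕⁻ (fun ξ : E3 => (m ξ : ℂ)) x).re = cosTransform m x := by
  rw [Real.fourierInv_eq_fourier_neg, re_fourier_eq_cosTransform hm hs]
  simp [cosTransform, inner_neg_right]

theorem iteratedFDeriv_eq_zero_of_notMem_tsupport {F : Type*} [NormedAddCommGroup F]
    [NormedSpace ℝ F] {f : E3 → F} {x : E3} (hx : x ∉ tsupport f) (n : ℕ) :
    iteratedFDeriv ℝ n f x = 0 :=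
  image_eq_zero_of_notMem_tsupport fun h => hx (tsupport_iteratedFDeriv_subset n h)

theorem norm_iteratedFDeriv_ofReal {m : E3 → ℝ} {n : ℕ} (hm : ContDiff ℝ n m) (x : E3) :
    ‖iteratedFDeriv ℝ n (fun ξ => (m ξ : ℂ)) x‖ = ‖iteratedFDeriv ℝ n m x‖ :=
  Complex.ofRealLI.norm_iteratedFDeriv_comp_left (f := m) (n := n) hm.contDiffAt le_rfl

theorem contDiff_fourier_of_compactSupport {m : E3 → ℂ} (hm : ContDiff ℝ ∞ m)
    (hs : HasCompactSupport m) : ContDiff ℝ ∞ (𝓕 m) := by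
  exact (SchwartzMap.fourierTransformCLM ℂ (hs.toSchwartzMap hm)).smooth ⊤

theorem cosTransform_eq_re_fourier {m : E3 → ℝ} (hm : Continuous m) (hs : HasCompactSupport m) :
    cosTransform m = Complex.reCLM ∘ 𝓕 (fun ξ : E3 => (m ξ : ℂ)) := by
  ext y
  exact (re_fourier_eq_cosTransform hm hs y).symm

theorem contDiff_cosTransform {m : E3 → ℝ} (hm : ContDiff ℝ ∞ m) (hs : HasCompactSupport m) :
    ContDiff ℝ ∞ (cosTransform m) := by
  rw [cosTransform_eq_re_fourier hm.continuous hs]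
  exact Complex.reCLM.contDiff.comp (contDiff_fourier_of_compactSupport
    (Complex.ofRealCLM.contDiff.comp hm) (hs.comp_left (g := fun r : ℝ => (r : ℂ)) (by simp)))

/-- Decay of the derivatives of the cosine transform, with constants that depend on the symbol
only through bounds of its derivatives. -/
theorem exists_cosTransform_decay (k n : ℕ) : ∃ C : ℝ, 0 ≤ C ∧ ∀ (m : E3 → ℝ), ContDiff ℝ ∞ m →
    tsupport m ⊆ Metric.closedBall 0 1 → ∀ B : ℝ,
    (∀ q ≤ n, ∀ v, ‖iteratedFDeriv ℝ q m v‖ ≤ B) →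
    ∀ x, (1 + ‖x‖) ^ n * ‖iteratedFDeriv ℝ k (cosTransform m) x‖ ≤ C * B := by
  set V : ℝ := (volume (Metric.closedBall (0 : E3) 1)).toReal with hV
  have hVlt : volume (Metric.closedBall (0 : E3) 1) < ⊤ := measure_closedBall_lt_top
  set D : ℕ → ℝ := fun j => (2 * Real.pi) ^ k * (2 * k + 2) ^ j *
    ∑ p ∈ Finset.range (k + 1) ×ˢ Finset.range (j + 1), V with hD
  have hDnn : ∀ j, 0 ≤ D j := fun j => by
    have := Real.pi_pos
    simp only [hD]; positivity
  refine ⟨2 ^ n * (D 0 + D n), mul_nonneg (by positivity) (add_nonneg (hDnn _) (hDnn _)), ?_⟩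
  intro m hm hsupp B hB x
  have hcs : HasCompactSupport m :=
    HasCompactSupport.of_support_subset_isCompact (isCompact_closedBall 0 1)
      ((subset_tsupport m).trans hsupp)
  set f : E3 → ℂ := fun ξ => (m ξ : ℂ) with hf
  have hfsm : ContDiff ℝ ∞ f := Complex.ofRealCLM.contDiff.comp hm
  have hfs : HasCompactSupport f := hcs.comp_left (g := fun r : ℝ => (r : ℂ)) (by simp)
  have hcd : ∀ q : ℕ, Continuous (iteratedFDeriv ℝ q f) := fun q =>
    hfsm.continuous_iteratedFDeriv (by exact_mod_cast le_top)
  have hint : ∀ p q : ℕ, Integrable (fun v => ‖v‖ ^ p * ‖iteratedFDeriv ℝ q f v‖) := by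
    intro p q
    refine Continuous.integrable_of_hasCompactSupport
      ((continuous_norm.pow p).mul (hcd q).norm) ?_
    exact (hfs.iteratedFDeriv q).norm.mul_left
  -- On the unit ball every moment factor is at most one, so only the volume `V` and the derivative
  -- bound `B` enter. This is what makes the final constant independent of the symbol.
  have hI : ∀ p q : ℕ, q ≤ n → ∫ v, ‖v‖ ^ p * ‖iteratedFDeriv ℝ q f v‖ ≤ V * B := by
    intro p q hq
    have h1 : ∀ v, ‖v‖ ^ p * ‖iteratedFDeriv ℝ q f v‖ ≤
        (Metric.closedBall (0 : E3) 1).indicator (fun _ => B) v := by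
      intro v
      rw [norm_iteratedFDeriv_ofReal (hm.of_le (by exact_mod_cast le_top))]
      by_cases hv : v ∈ Metric.closedBall (0 : E3) 1
      · rw [indicator_of_mem hv]
        have hv1 : ‖v‖ ≤ 1 := by simpa using hv
        calc ‖v‖ ^ p * ‖iteratedFDeriv ℝ q m v‖ ≤ 1 * B := by
              gcongr
              · exact pow_le_one₀ (norm_nonneg _) hv1
              · exact hB q hq v
          _ = B := one_mul B
      · rw [indicator_of_notMem hv,
          iteratedFDeriv_eq_zero_of_notMem_tsupport (fun h => hv (hsupp h))]
        simp
    calc ∫ v, ‖v‖ ^ p * ‖iteratedFDeriv ℝ q f v‖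
        ≤ ∫ v, (Metric.closedBall (0 : E3) 1).indicator (fun _ => B) v := by
          refine integral_mono (hint p q) ?_ h1
          exact (integrable_indicator_iff Metric.isClosed_closedBall.measurableSet).2
            (integrableOn_const hVlt.ne)
      _ = V * B := by
          rw [integral_indicator Metric.isClosed_closedBall.measurableSet]
          simp [hV, Measure.real]
  have hre := cosTransform_eq_re_fourier hm.continuous hcs
  have hdecay : ∀ j ≤ n, ‖x‖ ^ j * ‖iteratedFDeriv ℝ k (cosTransform m) x‖ ≤ D j * B := by
    intro j hj
    have h1 : ‖iteratedFDeriv ℝ k (cosTransform m) x‖ ≤ ‖iteratedFDeriv ℝ k (𝓕 f) x‖ := by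
      rw [hre]
      refine (Complex.reCLM.norm_iteratedFDeriv_comp_left (N := ∞)
        (contDiff_fourier_of_compactSupport hfsm hfs).contDiffAt
        (by exact_mod_cast le_top)).trans ?_
      rw [Complex.reCLM_norm, one_mul]
    have h2 := Real.pow_mul_norm_iteratedFDeriv_fourier_le (f := f) (K := ⊤) (N := ⊤) hfsm
      (fun p q _ _ => hint p q) (k := k) (n := j) le_top le_top x
    calc ‖x‖ ^ j * ‖iteratedFDeriv ℝ k (cosTransform m) x‖
        ≤ ‖x‖ ^ j * ‖iteratedFDeriv ℝ k (𝓕 f) x‖ := by gcongr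
      _ ≤ _ := h2
      _ ≤ (2 * Real.pi) ^ k * (2 * k + 2) ^ j *
          ∑ p ∈ Finset.range (k + 1) ×ˢ Finset.range (j + 1), V * B := by
          have := Real.pi_pos
          gcongr with p hp
          refine hI _ _ ?_
          simp only [Finset.mem_product, Finset.mem_range] at hp
          omega
      _ = D j * B := by rw [← Finset.sum_mul, hD]; ring
  have h0 := hdecay 0 (Nat.zero_le _)
  have hn := hdecay n le_rfl
  -- The inhomogeneous weight is controlled by the two extreme powers, so the decay estimate is
  -- needed for `j = 0` and `j = n` only.
  have hpow : (1 + ‖x‖) ^ n ≤ 2 ^ n * (1 + ‖x‖ ^ n) := by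
    rcases le_total ‖x‖ 1 with h | h
    · calc (1 + ‖x‖) ^ n ≤ 2 ^ n := by gcongr; linarith
        _ ≤ 2 ^ n * (1 + ‖x‖ ^ n) := le_mul_of_one_le_right (by positivity) (by
            linarith [pow_nonneg (norm_nonneg x) n])
    · calc (1 + ‖x‖) ^ n ≤ (2 * ‖x‖) ^ n := by gcongr; linarith
        _ = 2 ^ n * ‖x‖ ^ n := mul_pow _ _ _
        _ ≤ 2 ^ n * (1 + ‖x‖ ^ n) := by gcongr; linarith
  calc (1 + ‖x‖) ^ n * ‖iteratedFDeriv ℝ k (cosTransform m) x‖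
      ≤ 2 ^ n * (1 + ‖x‖ ^ n) * ‖iteratedFDeriv ℝ k (cosTransform m) x‖ := by gcongr
    _ = 2 ^ n * (‖x‖ ^ 0 * ‖iteratedFDeriv ℝ k (cosTransform m) x‖ +
        ‖x‖ ^ n * ‖iteratedFDeriv ℝ k (cosTransform m) x‖) := by ring
    _ ≤ 2 ^ n * (D 0 * B + D n * B) := by gcongr
    _ = 2 ^ n * (D 0 + D n) * B := by ring

/-! ### The heat potential of a Littlewood-Paley piece -/

/-- The symbol `ψ(2πξ)/|2πξ|²`, where `ψ = φ - φ(2·)`. -/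
noncomputable def potSymbol (φ : E3 → ℝ) (ξ : E3) : ℝ :=
  (φ ((2 * Real.pi) • ξ) - φ ((4 * Real.pi) • ξ)) / (2 * Real.pi * ‖ξ‖) ^ 2

/-- The symbol `exp(-s|2πξ|²) ψ(2πξ)/|2πξ|²`. -/
noncomputable def heatSymbol (φ : E3 → ℝ) (s : ℝ) (ξ : E3) : ℝ :=
  Real.exp (-s * (2 * Real.pi * ‖ξ‖) ^ 2) * potSymbol φ ξ

/-- The kernel of `e^{sΔ} (-Δ)⁻¹ P₁`. -/
noncomputable def heatPot (φ : E3 → ℝ) (s : ℝ) : E3 → ℝ := cosTransform (heatSymbol φ s)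

namespace IsLittlewoodPaleyBump

variable {φ : E3 → ℝ}

theorem eq_zero (hφ : IsLittlewoodPaleyBump φ) {ξ : E3} (h : 1 < ‖ξ‖) : φ ξ = 0 := by
  by_contra h0
  have := hφ.support_subset h0
  simp only [Metric.mem_closedBall, dist_zero_right] at this
  linarith

theorem eq_one' (hφ : IsLittlewoodPaleyBump φ) {ξ : E3} (h : ‖ξ‖ ≤ 1 / 2) : φ ξ = 1 :=
  hφ.eq_one ξ (by simpa using h)

/-- Both dilates of `φ` equal one in this region and cancel. Hence the division by `|2πξ|²` is
harmless at the origin, and the heat factor decays exponentially on the support. -/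
theorem potSymbol_eq_zero_of_lt (hφ : IsLittlewoodPaleyBump φ) {ξ : E3}
    (h : 2 * Real.pi * ‖ξ‖ ≤ 1 / 4) : potSymbol φ ξ = 0 := by
  have hp := Real.pi_pos
  rw [potSymbol, hφ.eq_one', hφ.eq_one']
  · simp
  · rw [norm_smul, Real.norm_of_nonneg (by positivity)]; linarith
  · rw [norm_smul, Real.norm_of_nonneg (by positivity)]; linarith

theorem potSymbol_eq_zero_of_gt (hφ : IsLittlewoodPaleyBump φ) {ξ : E3}
    (h : 1 < 2 * Real.pi * ‖ξ‖) : potSymbol φ ξ = 0 := by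
  have hp := Real.pi_pos
  rw [potSymbol, hφ.eq_zero, hφ.eq_zero]
  · simp
  · rw [norm_smul, Real.norm_of_nonneg (by positivity)]; linarith
  · rw [norm_smul, Real.norm_of_nonneg (by positivity)]; linarith

theorem contDiff_potSymbol (hφ : IsLittlewoodPaleyBump φ) : ContDiff ℝ ∞ (potSymbol φ) := by
  have hp := Real.pi_pos
  rw [contDiff_iff_contDiffAt]
  intro ξ
  by_cases h : ξ = 0
  · have : potSymbol φ =ᶠ[nhds ξ] fun _ => 0 := by
      have hc : Continuous fun ξ : E3 => 2 * Real.pi * ‖ξ‖ := by fun_prop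
      have h0 : 2 * Real.pi * ‖ξ‖ < 1 / 4 := by simp [h]
      filter_upwards [hc.continuousAt.eventually (gt_mem_nhds h0)] with η hη
      exact hφ.potSymbol_eq_zero_of_lt hη.le
    exact contDiffAt_const.congr_of_eventuallyEq this
  · refine ContDiffAt.div ?_ ?_ ?_
    · exact ((hφ.smooth.comp (contDiff_const_smul _)).sub
        (hφ.smooth.comp (contDiff_const_smul _))).contDiffAt
    · exact (contDiffAt_const.mul (contDiffAt_id.norm ℝ h)).pow 2
    · have := norm_pos_iff.2 h
      positivity

theorem tsupport_potSymbol (hφ : IsLittlewoodPaleyBump φ) :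
    tsupport (potSymbol φ) ⊆ {ξ | 1 / 4 ≤ 2 * Real.pi * ‖ξ‖ ∧ 2 * Real.pi * ‖ξ‖ ≤ 1} := by
  refine closure_minimal ?_ ?_
  · intro ξ hξ
    constructor
    · by_contra h
      exact hξ (hφ.potSymbol_eq_zero_of_lt (not_le.1 h).le)
    · by_contra h
      exact hξ (hφ.potSymbol_eq_zero_of_gt (not_le.1 h))
  · have hc : Continuous fun ξ : E3 => 2 * Real.pi * ‖ξ‖ := by fun_prop
    exact (isClosed_le continuous_const hc).inter (isClosed_le hc continuous_const)

theorem norm_le_one_of_mem (hφ : IsLittlewoodPaleyBump φ) {ξ : E3}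
    (h : ξ ∈ tsupport (potSymbol φ)) : ‖ξ‖ ≤ 1 := by
  have h1 := (hφ.tsupport_potSymbol h).2
  have := Real.pi_gt_three
  nlinarith [norm_nonneg ξ]

theorem tsupport_heatSymbol (φ : E3 → ℝ) (s : ℝ) :
    tsupport (heatSymbol φ s) ⊆ tsupport (potSymbol φ) :=
  closure_mono fun _ hξ => right_ne_zero_of_mul hξ

theorem hasCompactSupport_potSymbol (hφ : IsLittlewoodPaleyBump φ) :
    HasCompactSupport (potSymbol φ) :=
  HasCompactSupport.of_support_subset_isCompact (isCompact_closedBall (0 : E3) 1) fun ξ hξ => by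
    simpa using hφ.norm_le_one_of_mem (subset_tsupport _ hξ)

theorem contDiff_heatExp (s : ℝ) :
    ContDiff ℝ ∞ fun ξ : E3 => Real.exp (-s * (2 * Real.pi * ‖ξ‖) ^ 2) := by
  simp_rw [mul_pow]
  exact (contDiff_const.mul (contDiff_const.mul (contDiff_norm_sq ℝ))).exp

theorem contDiff_heatSymbol (hφ : IsLittlewoodPaleyBump φ) (s : ℝ) :
    ContDiff ℝ ∞ (heatSymbol φ s) :=
  (contDiff_heatExp s).mul hφ.contDiff_potSymbol

/-- A quadratic function has a linear first, a constant second and vanishing higher derivatives. The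
bound is put in the form `D ^ i` because the Faà di Bruno estimate for compositions asks for it. -/
theorem norm_iteratedFDeriv_normSq_le {c : ℝ} (hc : 0 ≤ c) {ξ : E3} (hξ : ‖ξ‖ ≤ 1) {i : ℕ}
    (hi : 1 ≤ i) :
    ‖iteratedFDeriv ℝ i (fun ξ : E3 => -c * ‖ξ‖ ^ 2) ξ‖ ≤ (2 * c + 1) ^ i := by
  obtain ⟨j, rfl⟩ := Nat.exists_eq_add_of_le' hi
  have hfd : fderiv ℝ (fun ξ : E3 => -c * ‖ξ‖ ^ 2) = ⇑((-c * 2) • innerSL ℝ (E := E3)) := by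
    ext x v
    have h := ((hasStrictFDerivAt_norm_sq x).hasFDerivAt.const_mul (-c)).fderiv
    rw [h]
    simp
    ring
  have hL : ‖(-c * 2) • innerSL ℝ (E := E3)‖ ≤ 2 * c + 1 := by
    refine ContinuousLinearMap.opNorm_le_bound _ (by positivity) fun x => ?_
    rw [_root_.smul_apply, norm_smul, innerSL_apply_norm]
    have : ‖-c * 2‖ = 2 * c := by rw [norm_mul, norm_neg]; simp [abs_of_nonneg hc]; ring
    rw [this]
    nlinarith [norm_nonneg x]
  have h1 : (1 : ℝ) ≤ 2 * c + 1 := by linarith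
  rw [← norm_iteratedFDeriv_fderiv, hfd]
  rcases j with _ | _ | j
  · rw [norm_iteratedFDeriv_zero]
    refine (ContinuousLinearMap.le_opNorm _ _).trans ?_
    simp only [zero_add, pow_one]
    calc _ ≤ (2 * c + 1) * 1 := by gcongr
      _ = _ := mul_one _
  · rw [zero_add, norm_iteratedFDeriv_one, ContinuousLinearMap.fderiv]
    exact hL.trans (le_self_pow₀ h1 (by norm_num))
  · rw [← norm_iteratedFDeriv_fderiv]
    have : fderiv ℝ ⇑((-c * 2) • innerSL ℝ (E := E3)) = fun _ => (-c * 2) • innerSL ℝ := by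
      ext1 x; exact ContinuousLinearMap.fderiv _
    rw [this, iteratedFDeriv_const_of_ne (by omega)]
    simp only [Pi.zero_apply, norm_zero]
    positivity

theorem norm_iteratedFDeriv_heatExp_le {s : ℝ} (hs : 0 ≤ s) {ξ : E3} (hξ : ‖ξ‖ ≤ 1)
    (h4 : 1 / 4 ≤ 2 * Real.pi * ‖ξ‖) (n : ℕ) :
    ‖iteratedFDeriv ℝ n (fun ξ : E3 => Real.exp (-s * (2 * Real.pi * ‖ξ‖) ^ 2)) ξ‖ ≤
      n.factorial * Real.exp (-s / 16) * (2 * (s * (2 * Real.pi) ^ 2) + 1) ^ n := by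
  have h := norm_iteratedFDeriv_comp_le (𝕜 := ℝ) (g := Real.exp)
    (f := fun ξ : E3 => -(s * (2 * Real.pi) ^ 2) * ‖ξ‖ ^ 2) (n := n) (N := ∞)
    Real.contDiff_exp (contDiff_const.mul (contDiff_norm_sq ℝ)) (by exact_mod_cast le_top) ξ
    (C := Real.exp (-s / 16)) (D := 2 * (s * (2 * Real.pi) ^ 2) + 1) ?_ ?_
  · have e : (fun ξ : E3 => Real.exp (-s * (2 * Real.pi * ‖ξ‖) ^ 2)) =
        Real.exp ∘ fun ξ : E3 => -(s * (2 * Real.pi) ^ 2) * ‖ξ‖ ^ 2 := by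
      ext η; simp only [Function.comp]; ring_nf
    rw [e]
    exact h
  · intro i _
    rw [norm_iteratedFDeriv_eq_norm_iteratedDeriv, iteratedDeriv_eq_iterate, Real.iter_deriv_exp,
      Real.norm_of_nonneg (Real.exp_pos _).le]
    -- The rate `1/16` is the square of the inner radius `1/4` of the frequency annulus.
    apply Real.exp_le_exp.2
    have : (1 / 4) ^ 2 ≤ (2 * Real.pi * ‖ξ‖) ^ 2 := by gcongr
    nlinarith
  · intro i hi _
    exact norm_iteratedFDeriv_normSq_le (by positivity) hξ hi

/-- Half of the exponential rate is spent on absorbing the polynomial growth in `s` produced by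
differentiating the heat factor; this turns `1/16` into `1/32`. -/
theorem exists_pow_mul_exp_le (n : ℕ) : ∃ C : ℝ, 0 ≤ C ∧ ∀ s : ℝ, 0 ≤ s →
    Real.exp (-s / 16) * (2 * (s * (2 * Real.pi) ^ 2) + 1) ^ n ≤ C * Real.exp (-s / 32) := by
  have hp := Real.pi_pos
  set a : ℝ := 2 * (2 * Real.pi) ^ 2 with ha
  have ha0 : 0 < a := by positivity
  refine ⟨(32 * a) ^ n * n.factorial * Real.exp (1 / (32 * a)), by positivity, fun s hs => ?_⟩
  have h := Real.pow_div_factorial_le_exp ((a * s + 1) / (32 * a)) (by positivity) n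
  rw [div_le_iff₀ (by positivity), div_pow, div_le_iff₀ (by positivity)] at h
  have e1 : 2 * (s * (2 * Real.pi) ^ 2) + 1 = a * s + 1 := by rw [ha]; ring
  have e2 : Real.exp ((a * s + 1) / (32 * a)) = Real.exp (s / 32) * Real.exp (1 / (32 * a)) := by
    rw [← Real.exp_add]; congr 1; field_simp
  have e3 : Real.exp (-s / 16) * Real.exp (s / 32) = Real.exp (-s / 32) := by
    rw [← Real.exp_add]; congr 1; ring
  rw [e1]
  calc Real.exp (-s / 16) * (a * s + 1) ^ n
      ≤ Real.exp (-s / 16) * (Real.exp ((a * s + 1) / (32 * a)) * n.factorial * (32 * a) ^ n) := by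
        gcongr
    _ = (32 * a) ^ n * n.factorial * Real.exp (1 / (32 * a)) *
        (Real.exp (-s / 16) * Real.exp (s / 32)) := by rw [e2]; ring
    _ = _ := by rw [e3]

/-- Exponential decay in time of the derivatives of the heat symbol. -/
theorem exists_iteratedFDeriv_heatSymbol_le (hφ : IsLittlewoodPaleyBump φ) (n : ℕ) :
    ∃ C : ℝ, 0 ≤ C ∧ ∀ s : ℝ, 0 ≤ s → ∀ q ≤ n, ∀ ξ,
      ‖iteratedFDeriv ℝ q (heatSymbol φ s) ξ‖ ≤ C * Real.exp (-s / 32) := by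
  choose D hD0 hD using exists_pow_mul_exp_le
  have hb : ∀ i : ℕ, ∃ b : ℝ, ∀ ξ, ‖iteratedFDeriv ℝ i (potSymbol φ) ξ‖ ≤ b := fun i =>
    ((hφ.contDiff_potSymbol.continuous_iteratedFDeriv (m := i)
      (by exact_mod_cast le_top))).bounded_above_of_compact_support
      (hφ.hasCompactSupport_potSymbol.iteratedFDeriv i)
  choose b hb using hb
  have hb0 : ∀ i, 0 ≤ b i := fun i => (norm_nonneg _).trans (hb i 0)
  refine ⟨∑ q ∈ Finset.range (n + 1), ∑ i ∈ Finset.range (q + 1),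
    (q.choose i : ℝ) * (i.factorial * D i) * b (q - i), ?_, ?_⟩
  · exact Finset.sum_nonneg fun q _ => Finset.sum_nonneg fun i _ =>
      mul_nonneg (mul_nonneg (by positivity) (mul_nonneg (by positivity) (hD0 i))) (hb0 _)
  intro s hs q hq ξ
  have hle : ‖iteratedFDeriv ℝ q (heatSymbol φ s) ξ‖ ≤ (∑ i ∈ Finset.range (q + 1),
      (q.choose i : ℝ) * (i.factorial * D i) * b (q - i)) * Real.exp (-s / 32) := by
    by_cases hξ : ξ ∈ tsupport (potSymbol φ)
    · have h1 := norm_iteratedFDeriv_mul_le (𝕜 := ℝ) (N := ∞) (contDiff_heatExp s)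
        hφ.contDiff_potSymbol ξ (n := q) (by exact_mod_cast le_top)
      refine h1.trans ?_
      rw [Finset.sum_mul]
      refine Finset.sum_le_sum fun i _ => ?_
      have h2 := norm_iteratedFDeriv_heatExp_le hs (hφ.norm_le_one_of_mem hξ)
        (hφ.tsupport_potSymbol hξ).1 i
      have h3 := hD i s hs
      have h4 : ‖iteratedFDeriv ℝ i (fun ξ : E3 => Real.exp (-s * (2 * Real.pi * ‖ξ‖) ^ 2)) ξ‖ ≤
          i.factorial * (D i * Real.exp (-s / 32)) := by
        refine h2.trans ?_
        rw [mul_assoc]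
        gcongr
      calc _ ≤ (q.choose i : ℝ) * (i.factorial * (D i * Real.exp (-s / 32))) * b (q - i) := by
            gcongr
            · exact mul_nonneg (by positivity)
                (mul_nonneg (by positivity) (mul_nonneg (hD0 i) (Real.exp_pos _).le))
            · exact hb _ _
        _ = _ := by ring
    · rw [iteratedFDeriv_eq_zero_of_notMem_tsupport (fun h => hξ (tsupport_heatSymbol φ s h)),
        norm_zero]
      exact mul_nonneg (Finset.sum_nonneg fun i _ =>
        mul_nonneg (mul_nonneg (by positivity) (mul_nonneg (by positivity) (hD0 i))) (hb0 _))
        (Real.exp_pos _).le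
  refine hle.trans ?_
  gcongr
  exact Finset.single_le_sum (f := fun q => ∑ i ∈ Finset.range (q + 1),
    (q.choose i : ℝ) * (i.factorial * D i) * b (q - i))
    (fun q _ => Finset.sum_nonneg fun i _ =>
      mul_nonneg (mul_nonneg (by positivity) (mul_nonneg (by positivity) (hD0 i))) (hb0 _))
    (Finset.mem_range.2 (by omega))

/-- Decay of the heat potential and its derivatives in space and time. -/
theorem exists_heatPot_decay (hφ : IsLittlewoodPaleyBump φ) (k n : ℕ) :
    ∃ C : ℝ, 0 ≤ C ∧ ∀ s : ℝ, 0 ≤ s → ∀ x,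
      (1 + ‖x‖) ^ n * ‖iteratedFDeriv ℝ k (heatPot φ s) x‖ ≤ C * Real.exp (-s / 32) := by
  obtain ⟨C₁, hC₁, h₁⟩ := exists_cosTransform_decay k n
  obtain ⟨C₂, hC₂, h₂⟩ := hφ.exists_iteratedFDeriv_heatSymbol_le n
  refine ⟨C₁ * C₂, mul_nonneg hC₁ hC₂, fun s hs x => ?_⟩
  rw [mul_assoc]
  refine h₁ _ (hφ.contDiff_heatSymbol s) ?_ _ (fun q hq v => h₂ s hs q hq v) x
  exact (tsupport_heatSymbol φ s).trans fun ξ hξ => by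
    simpa using hφ.norm_le_one_of_mem hξ

end IsLittlewoodPaleyBump

/-! ### Differentiation of trigonometric transforms. -/

/-- The `i`-th partial derivative of a scalar function. -/
noncomputable def pd (i : Fin 3) (f : E3 → ℝ) (x : E3) : ℝ :=
  fderiv ℝ f x (EuclideanSpace.single i 1)

theorem contDiff_pd {f : E3 → ℝ} (hf : ContDiff ℝ ∞ f) (i : Fin 3) : ContDiff ℝ ∞ (pd i f) :=
  (hf.fderiv_right (m := ∞) (by simp)).clm_apply contDiff_const

/-- `x ↦ ∫ c(2π ξ·x) m(ξ) dξ` for a profile `c`. -/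
noncomputable def trigTransform (c : ℝ → ℝ) (m : E3 → ℝ) (x : E3) : ℝ :=
  ∫ ξ : E3, c (2 * Real.pi * inner ℝ ξ x) * m ξ

/-- The profile is left free so that the same differentiation under the integral serves for the
cosine and then for minus the sine. A derivative bounded by one and a compactly supported symbol
provide the dominating function. -/
theorem hasDerivAt_trigTransform {c c' : ℝ → ℝ} (hc : ∀ r, HasDerivAt c (c' r) r)
    (hc' : Continuous c') (hb : ∀ r, |c' r| ≤ 1) {m : E3 → ℝ} (hm : Continuous m)
    (hs : HasCompactSupport m) (x v : E3) :
    HasDerivAt (fun r : ℝ => trigTransform c m (x + r • v))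
      (trigTransform c' (fun ξ => 2 * Real.pi * inner ℝ ξ v * m ξ) x) 0 := by
  have hcc : Continuous c := continuous_iff_continuousAt.2 fun r => (hc r).continuousAt
  have hm1 : Continuous fun ξ : E3 => 2 * Real.pi * inner ℝ ξ v * m ξ := by fun_prop
  have h := hasDerivAt_integral_of_dominated_loc_of_deriv_le (μ := (volume : Measure E3))
    (F := fun (r : ℝ) ξ => c (2 * Real.pi * inner ℝ ξ (x + r • v)) * m ξ)
    (F' := fun (r : ℝ) ξ => c' (2 * Real.pi * inner ℝ ξ (x + r • v)) *
      (2 * Real.pi * inner ℝ ξ v * m ξ)) (x₀ := 0) (s := univ)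
    (bound := fun ξ => ‖2 * Real.pi * inner ℝ ξ v * m ξ‖) Filter.univ_mem
    (Filter.Eventually.of_forall fun r => by
      have : Continuous fun ξ : E3 => c (2 * Real.pi * inner ℝ ξ (x + r • v)) * m ξ := by fun_prop
      exact this.aestronglyMeasurable)
    (Continuous.integrable_of_hasCompactSupport (by fun_prop) hs.mul_left)
    (by
      have : Continuous fun ξ : E3 => c' (2 * Real.pi * inner ℝ ξ (x + (0 : ℝ) • v)) *
        (2 * Real.pi * inner ℝ ξ v * m ξ) := by fun_prop
      exact this.aestronglyMeasurable)
    (Filter.Eventually.of_forall fun ξ r _ => by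
      rw [norm_mul]
      exact mul_le_of_le_one_left (norm_nonneg _) (hb _))
    (hm1.integrable_of_hasCompactSupport hs.mul_left).norm
    (Filter.Eventually.of_forall fun ξ r _ => by
      have h1 : HasDerivAt (fun r : ℝ => 2 * Real.pi * inner ℝ ξ (x + r • v))
          (2 * Real.pi * inner ℝ ξ v) r := by
        simp_rw [inner_add_right, inner_smul_right]
        simpa using (((hasDerivAt_id r).mul_const (inner ℝ ξ v)).const_add
          (inner ℝ ξ x)).const_mul (2 * Real.pi)
      have h2 := ((hc _).comp r h1).mul_const (m ξ)
      refine h2.congr_deriv ?_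
      ring)
  simpa [trigTransform] using h.2

theorem pd_trigTransform {c c' : ℝ → ℝ} (hc : ∀ r, HasDerivAt c (c' r) r)
    (hc' : Continuous c') (hb : ∀ r, |c' r| ≤ 1) {m : E3 → ℝ} (hm : Continuous m)
    (hs : HasCompactSupport m) (hd : ContDiff ℝ ∞ (trigTransform c m)) (i : Fin 3) :
    pd i (trigTransform c m) = trigTransform c' (fun ξ => 2 * Real.pi * ξ i * m ξ) := by
  ext x
  have h1 := hasDerivAt_trigTransform hc hc' hb hm hs x (EuclideanSpace.single i 1)
  have h2 := ((hd.differentiable (by simp)) x).hasFDerivAt.hasLineDerivAt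
    (EuclideanSpace.single i 1)
  rw [pd, h2.unique h1]
  congr 1
  ext ξ
  simp [EuclideanSpace.inner_single_right]

theorem pd_pd_cosTransform {m : E3 → ℝ} (hm : ContDiff ℝ ∞ m) (hs : HasCompactSupport m)
    (i : Fin 3) :
    pd i (pd i (cosTransform m)) = cosTransform (fun ξ => -(2 * Real.pi * ξ i) ^ 2 * m ξ) := by
  have hc : cosTransform m = trigTransform Real.cos m := rfl
  have h1 : pd i (cosTransform m) =
      trigTransform (fun r => -Real.sin r) (fun ξ => 2 * Real.pi * ξ i * m ξ) :=
    pd_trigTransform Real.hasDerivAt_cos (by fun_prop)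
      (fun r => by rw [abs_neg]; exact Real.abs_sin_le_one r) hm.continuous hs
      (contDiff_cosTransform hm hs) i
  rw [h1, pd_trigTransform (c := fun r => -Real.sin r) (c' := fun r => -Real.cos r)
      (fun r => (Real.hasDerivAt_sin r).neg) (by fun_prop)
      (fun r => by rw [abs_neg]; exact Real.abs_cos_le_one r)
      (m := fun ξ => 2 * Real.pi * ξ i * m ξ)
      (by have := hm.continuous; fun_prop) hs.mul_left
      (h1 ▸ contDiff_pd (contDiff_cosTransform hm hs) i) i]
  ext x
  simp only [trigTransform, cosTransform]
  congr 1
  ext ξ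
  ring

theorem sum_pd_pd_cosTransform {m : E3 → ℝ} (hm : ContDiff ℝ ∞ m) (hs : HasCompactSupport m)
    (x : E3) : ∑ i, pd i (pd i (cosTransform m)) x =
      cosTransform (fun ξ => -(2 * Real.pi * ‖ξ‖) ^ 2 * m ξ) x := by
  simp_rw [pd_pd_cosTransform hm hs, cosTransform]
  rw [← integral_finsetSum]
  · congr 1
    ext ξ
    rw [← Finset.mul_sum, ← Finset.sum_mul, mul_pow, EuclideanSpace.norm_sq_eq]
    congr 2
    simp only [mul_pow, Finset.sum_neg_distrib, Finset.mul_sum, Real.norm_eq_abs, sq_abs]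
  · intro i _
    refine Continuous.integrable_of_hasCompactSupport ?_ hs.mul_left.mul_left
    have := hm.continuous
    fun_prop

/-! ### Heat equation and kernel identities for the potential. -/

namespace IsLittlewoodPaleyBump

variable {φ : E3 → ℝ}

theorem hasCompactSupport_heatSymbol (hφ : IsLittlewoodPaleyBump φ) (s : ℝ) :
    HasCompactSupport (heatSymbol φ s) := hφ.hasCompactSupport_potSymbol.mul_left

/-- Joint smoothness in time and space follows from smoothness of convolutions with a parameter: the
potential is the convolution of the constant one with the integrand, evaluated at the origin, with
`(s, x)` as the parameter. The common compact support in frequency is the hypothesis that makes this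
work. -/
theorem contDiff_heatPot (hφ : IsLittlewoodPaleyBump φ) :
    ContDiff ℝ ∞ fun z : ℝ × E3 => heatPot φ z.1 z.2 := by
  set g : ℝ × E3 → E3 → ℝ := fun p y =>
    Real.cos (2 * Real.pi * inner ℝ y p.2) * heatSymbol φ p.1 y with hg
  have hgs : ContDiff ℝ ∞ (fun q : (ℝ × E3) × E3 => g q.1 q.2) := by
    have h0 := hφ.contDiff_potSymbol
    have e : (fun q : (ℝ × E3) × E3 => g q.1 q.2) = fun q =>
        Real.cos (2 * Real.pi * inner ℝ q.2 q.1.2) *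
          (Real.exp (-q.1.1 * ((2 * Real.pi) ^ 2 * ‖q.2‖ ^ 2)) * potSymbol φ q.2) := by
      ext q; simp only [hg, heatSymbol, mul_pow]
    rw [e]
    refine ContDiff.mul ?_ (ContDiff.mul ?_ ?_)
    · exact (contDiff_const.mul (contDiff_snd.inner ℝ (contDiff_snd.comp contDiff_fst))).cos
    · exact ((contDiff_fst.comp contDiff_fst).neg.mul
        (contDiff_const.mul (contDiff_snd.norm_sq ℝ))).exp
    · exact h0.comp contDiff_snd
  have h := contDiffOn_convolution_right_with_param (𝕜 := ℝ) (μ := (volume : Measure E3))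
    (f := fun _ : E3 => (1 : ℝ)) (n := ⊤) (ContinuousLinearMap.mul ℝ ℝ) (g := g) (s := univ)
    (k := tsupport (potSymbol φ)) isOpen_univ hφ.hasCompactSupport_potSymbol
    (fun p x _ hx => by
      have : potSymbol φ x = 0 := image_eq_zero_of_notMem_tsupport hx
      simp [hg, heatSymbol, this])
    (locallyIntegrable_const 1) hgs.contDiffOn
  rw [univ_prod_univ, contDiffOn_univ] at h
  have h2 := h.comp (contDiff_id.prodMk contDiff_const : ContDiff ℝ ∞ fun z : ℝ × E3 => (z, (0 : E3)))
  convert h2 using 1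
  ext z
  simp only [Function.comp, convolution, ContinuousLinearMap.mul_apply', one_mul, zero_sub, id]
  rw [integral_neg_eq_self (fun t => g z t) volume]
  rfl

/-- The time derivative of the heat factor and the Laplacian of the cosine are the same Fourier
multiplier. No sign of `s` is needed, since the symbol is compactly supported; the dominating
function covers a unit neighbourhood of `s`. -/
theorem hasDerivAt_heatPot (hφ : IsLittlewoodPaleyBump φ) (s : ℝ) (x : E3) :
    HasDerivAt (fun s => heatPot φ s x) (∑ i, pd i (pd i (heatPot φ s)) x) s := by
  rw [heatPot, sum_pd_pd_cosTransform (hφ.contDiff_heatSymbol s) (hφ.hasCompactSupport_heatSymbol s)]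
  have hcp := hφ.contDiff_potSymbol.continuous
  have h := hasDerivAt_integral_of_dominated_loc_of_deriv_le (μ := (volume : Measure E3))
    (F := fun (s : ℝ) ξ => Real.cos (2 * Real.pi * inner ℝ ξ x) * heatSymbol φ s ξ)
    (F' := fun (s : ℝ) ξ => Real.cos (2 * Real.pi * inner ℝ ξ x) *
      (-(2 * Real.pi * ‖ξ‖) ^ 2 * heatSymbol φ s ξ)) (x₀ := s) (s := Metric.ball s 1)
    (bound := fun ξ => (2 * Real.pi * ‖ξ‖) ^ 2 *
      (Real.exp ((|s| + 1) * (2 * Real.pi * ‖ξ‖) ^ 2) * |potSymbol φ ξ|))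
    (Metric.ball_mem_nhds s one_pos)
    (Filter.Eventually.of_forall fun r => by
      have : Continuous fun ξ : E3 => Real.cos (2 * Real.pi * inner ℝ ξ x) * heatSymbol φ r ξ := by
        have := (hφ.contDiff_heatSymbol r).continuous
        fun_prop
      exact this.aestronglyMeasurable)
    (by
      have := (hφ.contDiff_heatSymbol s).continuous
      exact Continuous.integrable_of_hasCompactSupport (by fun_prop)
        (hφ.hasCompactSupport_heatSymbol s).mul_left)
    (by
      have := (hφ.contDiff_heatSymbol s).continuous
      have h2 : Continuous fun ξ : E3 => Real.cos (2 * Real.pi * inner ℝ ξ x) *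
        (-(2 * Real.pi * ‖ξ‖) ^ 2 * heatSymbol φ s ξ) := by fun_prop
      exact h2.aestronglyMeasurable)
    (Filter.Eventually.of_forall fun ξ r hr => by
      rw [norm_mul, norm_mul, heatSymbol, norm_mul, Real.norm_eq_abs, Real.norm_eq_abs,
        Real.norm_eq_abs, Real.norm_eq_abs, abs_neg, abs_of_nonneg (sq_nonneg (2 * Real.pi * ‖ξ‖)), Real.abs_exp]
      refine (mul_le_of_le_one_left (by positivity) (Real.abs_cos_le_one _)).trans ?_
      gcongr
      rw [Metric.mem_ball, Real.dist_eq] at hr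
      have := neg_abs_le s
      linarith [(abs_lt.1 hr).1])
    (Continuous.integrable_of_hasCompactSupport (by fun_prop)
      (hφ.hasCompactSupport_potSymbol.mono fun ξ hξ h0 => hξ (by simp [h0])))
    (Filter.Eventually.of_forall fun ξ r _ => by
      have h1 : HasDerivAt (fun r : ℝ => -r * (2 * Real.pi * ‖ξ‖) ^ 2)
          (-(2 * Real.pi * ‖ξ‖) ^ 2) r := by
        simpa using ((hasDerivAt_id r).neg.mul_const ((2 * Real.pi * ‖ξ‖) ^ 2))
      have h2 := ((h1.exp).mul_const (potSymbol φ ξ)).const_mul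
        (Real.cos (2 * Real.pi * inner ℝ ξ x))
      refine h2.congr_deriv ?_
      simp only [heatSymbol]
      ring)
  simpa only [heatPot, cosTransform] using h.2

theorem contDiff_smul (hφ : IsLittlewoodPaleyBump φ) (c : ℝ) :
    ContDiff ℝ ∞ fun ξ => φ (c • ξ) := hφ.smooth.comp (contDiff_const_smul c)

theorem tsupport_smul (hφ : IsLittlewoodPaleyBump φ) {c : ℝ} (hc : 1 ≤ c) :
    tsupport (fun ξ => φ (c • ξ)) ⊆ Metric.closedBall 0 1 := by
  refine closure_minimal (fun ξ hξ => ?_) Metric.isClosed_closedBall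
  by_contra h
  refine hξ (hφ.eq_zero ?_)
  rw [norm_smul, Real.norm_of_nonneg (by linarith)]
  simp only [Metric.mem_closedBall, dist_zero_right, not_le] at h
  nlinarith

theorem hasCompactSupport_smul (hφ : IsLittlewoodPaleyBump φ) {c : ℝ} (hc : 0 < c) :
    HasCompactSupport fun ξ => φ (c • ξ) := by
  have h : HasCompactSupport φ := HasCompactSupport.of_support_subset_isCompact
    (isCompact_closedBall (0 : E3) 1) hφ.support_subset
  exact h.comp_homeomorph (Homeomorph.smulOfNeZero c hc.ne')

theorem lpKernel_eq (hφ : IsLittlewoodPaleyBump φ) {N : ℝ} (hN : 0 < N) :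
    lpKernel φ N = cosTransform (fun ξ => φ ((2 * Real.pi / N) • ξ)) := by
  ext x
  exact re_fourierInv_eq_cosTransform (hφ.contDiff_smul _).continuous
    (hφ.hasCompactSupport_smul (by have := Real.pi_pos; positivity)) x

/-- Change of variables in frequency. It reduces every kernel estimate to frequency one. -/
theorem lpKernel_smul (hφ : IsLittlewoodPaleyBump φ) {N : ℝ} (hN : 0 < N) (x : E3) :
    lpKernel φ N x = N ^ 3 * lpKernel φ 1 (N • x) := by
  rw [hφ.lpKernel_eq hN, hφ.lpKernel_eq one_pos]
  have h := Measure.integral_comp_smul (volume : Measure E3)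
    (fun ξ => Real.cos (2 * Real.pi * inner ℝ ξ (N • x)) * φ ((2 * Real.pi / 1) • ξ)) N⁻¹
  simp only [finrank_euclideanSpace, Fintype.card_fin, smul_eq_mul] at h
  rw [inv_pow, inv_inv, abs_of_pos (by positivity)] at h
  rw [cosTransform, cosTransform, ← h]
  congr 1
  ext ξ
  rw [real_inner_smul_left, real_inner_smul_right, inv_mul_cancel_left₀ hN.ne', smul_smul]
  simp [div_eq_mul_inv]

/-- `-Δ` of the potential is the kernel of the Littlewood-Paley projection. -/
theorem neg_sum_pd_pd_heatPot (hφ : IsLittlewoodPaleyBump φ) (x : E3) :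
    -∑ i, pd i (pd i (heatPot φ 0)) x = lpKernel φ 1 x - lpKernel φ (1 / 2) x := by
  have hp := Real.pi_pos
  rw [heatPot, sum_pd_pd_cosTransform (hφ.contDiff_heatSymbol 0) (hφ.hasCompactSupport_heatSymbol 0),
    hφ.lpKernel_eq one_pos, hφ.lpKernel_eq (by norm_num), cosTransform, cosTransform, cosTransform,
    ← integral_neg, ← integral_sub]
  · congr 1
    ext ξ
    have e : 2 * Real.pi / (1 / 2) = 4 * Real.pi := by ring
    rw [e, div_one]
    by_cases h : ξ = 0
    · simp [h]
    · have := norm_pos_iff.2 h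
      rw [heatSymbol, potSymbol]
      field_simp
      simp
  all_goals
    refine Continuous.integrable_of_hasCompactSupport ?_
      (hφ.hasCompactSupport_smul (by positivity)).mul_left
    have := hφ.smooth.continuous
    fun_prop

theorem exists_lpKernel_decay (hφ : IsLittlewoodPaleyBump φ) (n : ℕ) : ∃ C : ℝ, 0 ≤ C ∧
    ∀ N : ℝ, 0 < N → ∀ x, (1 + N * ‖x‖) ^ n * |lpKernel φ N x| ≤ C * N ^ 3 := by
  have hp := Real.pi_gt_three
  obtain ⟨C, hC, h⟩ := exists_cosTransform_decay 0 n
  have hb : ∀ i : ℕ, ∃ b : ℝ, ∀ ξ, ‖iteratedFDeriv ℝ i (fun ξ => φ ((2 * Real.pi) • ξ)) ξ‖ ≤ b :=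
    fun i => ((hφ.contDiff_smul _).continuous_iteratedFDeriv (m := i)
      (by exact_mod_cast le_top)).bounded_above_of_compact_support
      ((hφ.hasCompactSupport_smul (by positivity)).iteratedFDeriv i)
  choose b hb using hb
  have hb0 : ∀ i, 0 ≤ b i := fun i => (norm_nonneg _).trans (hb i 0)
  refine ⟨C * ∑ i ∈ Finset.range (n + 1), b i,
    mul_nonneg hC (Finset.sum_nonneg fun i _ => hb0 i), fun N hN x => ?_⟩
  have h1 := h _ (hφ.contDiff_smul (2 * Real.pi)) (hφ.tsupport_smul (by linarith))
    (∑ i ∈ Finset.range (n + 1), b i) (fun q hq v => (hb q v).trans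
      (Finset.single_le_sum (fun i _ => hb0 i) (Finset.mem_range.2 (by omega)))) (N • x)
  rw [norm_iteratedFDeriv_zero, norm_smul, Real.norm_of_nonneg hN.le, Real.norm_eq_abs] at h1
  rw [hφ.lpKernel_smul hN, hφ.lpKernel_eq one_pos, div_one, abs_mul, abs_of_pos (by positivity)]
  calc _ = (1 + N * ‖x‖) ^ n * |cosTransform (fun ξ => φ ((2 * Real.pi) • ξ)) (N • x)| * N ^ 3 := by
        ring
    _ ≤ _ := by gcongr

theorem continuous_lpKernel (hφ : IsLittlewoodPaleyBump φ) {N : ℝ} (hN : 0 < N) :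
    Continuous (lpKernel φ N) := by
  have hp := Real.pi_pos
  rw [hφ.lpKernel_eq hN]
  exact (contDiff_cosTransform (hφ.contDiff_smul _)
    (hφ.hasCompactSupport_smul (by positivity))).continuous

/-- Fourier inversion at the origin, where the symbol has the value one. -/
theorem integral_lpKernel (hφ : IsLittlewoodPaleyBump φ) : ∫ x, lpKernel φ 1 x = 1 := by
  have hp := Real.pi_pos
  set f : E3 → ℂ := fun ξ => (φ ((2 * Real.pi) • ξ) : ℂ) with hf
  have hfs : HasCompactSupport f := (hφ.hasCompactSupport_smul (c := 2 * Real.pi)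
    (by positivity)).comp_left (g := fun r : ℝ => (r : ℂ)) (by simp)
  have hfd : ContDiff ℝ ∞ f := Complex.ofRealCLM.contDiff.comp (hφ.contDiff_smul _)
  set S := hfs.toSchwartzMap hfd with hS
  have hi : Integrable (𝓕 f) := (SchwartzMap.fourierTransformCLM ℂ S).integrable
  have h1 := MeasureTheory.Integrable.fourierInv_fourier_eq S.integrable hi (v := 0)
    hfd.continuous.continuousAt
  rw [Real.fourierInv_eq'] at h1
  simp only [inner_zero_right, mul_zero, Complex.ofReal_zero, zero_mul, Complex.exp_zero,
    one_smul] at h1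
  have h2 : (∫ v, 𝓕 f v).re = f 0 := by
    have : ∫ v, 𝓕 f v = f 0 := h1
    rw [this]; simp [hf]
  rw [← RCLike.re_eq_complex_re, ← integral_re hi] at h2
  have h3 : f 0 = 1 := by simp [hf, hφ.eq_one']
  rw [h3] at h2
  rw [hφ.lpKernel_eq one_pos, div_one, cosTransform_eq_re_fourier (hφ.contDiff_smul _).continuous
    (hφ.hasCompactSupport_smul (by positivity))]
  exact_mod_cast h2

end IsLittlewoodPaleyBump

/-! ### Partial derivatives and integration by parts -/

theorem two_le_infty : (2 : WithTop ℕ∞) ≤ ∞ :=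
  WithTop.coe_le_coe.2 (le_top : (2 : ℕ∞) ≤ ⊤)

theorem pd_sub {f g : E3 → ℝ} (hf : ContDiff ℝ ∞ f) (hg : ContDiff ℝ ∞ g) (i : Fin 3) (x : E3) :
    pd i (fun x => f x - g x) x = pd i f x - pd i g x := by
  simp only [pd]
  rw [fderiv_fun_sub (hf.differentiable (by simp) x) (hg.differentiable (by simp) x)]
  rfl

theorem pd_mul {f g : E3 → ℝ} (hf : ContDiff ℝ ∞ f) (hg : ContDiff ℝ ∞ g) (i : Fin 3) (x : E3) :
    pd i (fun x => f x * g x) x = pd i f x * g x + f x * pd i g x := by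
  simp only [pd]
  rw [fderiv_fun_mul (hf.differentiable (by simp) x) (hg.differentiable (by simp) x)]
  simp
  ring

theorem pd_sum {f : Fin 3 → E3 → ℝ} (hf : ∀ j, ContDiff ℝ ∞ (f j)) (i : Fin 3) (x : E3) :
    pd i (fun x => ∑ j, f j x) x = ∑ j, pd i (f j) x := by
  simp only [pd]
  rw [fderiv_fun_sum fun j _ => (hf j).differentiable (by simp) x]
  simp

theorem pd_comm {f : E3 → ℝ} (hf : ContDiff ℝ ∞ f) (i j : Fin 3) (x : E3) :
    pd i (pd j f) x = pd j (pd i f) x := by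
  have h := (hf.contDiffAt (x := x)).isSymmSndFDerivAt (by simpa using two_le_infty)
  have hd : DifferentiableAt ℝ (fderiv ℝ f) x :=
    (hf.fderiv_right (m := ∞) (by simp)).differentiable (by simp) x
  have e : ∀ i j : Fin 3, pd i (pd j f) x =
      fderiv ℝ (fderiv ℝ f) x (EuclideanSpace.single i 1) (EuclideanSpace.single j 1) := by
    intro i j
    have : pd j f = fun y => fderiv ℝ f y (EuclideanSpace.single j 1) := rfl
    rw [pd, this, fderiv_clm_apply hd (differentiableAt_const _)]
    simp
  rw [e, e]
  exact h.eq _ _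

theorem hasCompactSupport_pd {f : E3 → ℝ} (hs : HasCompactSupport f) (i : Fin 3) :
    HasCompactSupport (pd i f) := hs.fderiv_apply ℝ _

theorem integral_pd_eq_zero {f : E3 → ℝ} (hf : ContDiff ℝ ∞ f) (hs : HasCompactSupport f)
    (i : Fin 3) : ∫ x, pd i f x = 0 := by
  have h1 : Integrable (fun x => fderiv ℝ f x (EuclideanSpace.single i 1)) :=
    (contDiff_pd hf i).continuous.integrable_of_hasCompactSupport (hasCompactSupport_pd hs i)
  have h := integral_mul_fderiv_eq_neg_fderiv_mul_of_integrable (μ := (volume : Measure E3))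
    (f := fun _ : E3 => (1 : ℝ)) (g := f) (v := EuclideanSpace.single i 1) (by simp)
    (by simpa using h1) (by simpa using hf.continuous.integrable_of_hasCompactSupport hs)
    (fun x _ => differentiableAt_const _) (fun x _ => hf.differentiable (by simp) x)
  simpa [pd] using h

/-! ### Components of vector fields -/

theorem contDiff_component {v : E3 → E3} (hv : ContDiff ℝ ∞ v) (j : Fin 3) :
    ContDiff ℝ ∞ fun x => v x j :=
  (EuclideanSpace.proj j : E3 →L[ℝ] ℝ).contDiff.comp hv

theorem pd_component {v : E3 → E3} (hv : ContDiff ℝ ∞ v) (i j : Fin 3) (x : E3) :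
    pd i (fun x => v x j) x = fderiv ℝ v x (EuclideanSpace.single i 1) j := by
  have h := ((EuclideanSpace.proj j : E3 →L[ℝ] ℝ).hasFDerivAt.comp x
    (hv.differentiable (by simp) x).hasFDerivAt).fderiv
  have e : (fun x => v x j) = ⇑(EuclideanSpace.proj j : E3 →L[ℝ] ℝ) ∘ v := rfl
  rw [pd, e, h]
  rfl

theorem fderiv_apply_component {v : E3 → E3} (hv : ContDiff ℝ ∞ v) (j : Fin 3) (x w : E3) :
    fderiv ℝ v x w j = ∑ k, w k * pd k (fun x => v x j) x := by
  have hw : w = ∑ k, w k • EuclideanSpace.single k (1 : ℝ) := by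
    ext l; simp [Finset.sum_apply, Pi.single_apply]
  conv_lhs => rw [hw]
  simp_rw [pd_component hv]
  simp

theorem laplacian_component {v : E3 → E3} (hv : ContDiff ℝ ∞ v) (j : Fin 3) (x : E3) :
    (Δ v) x j = ∑ k, pd k (pd k (fun x => v x j)) x := by
  rw [InnerProductSpace.laplacian_eq_iteratedFDeriv_orthonormalBasis v
    (EuclideanSpace.basisFun (Fin 3) ℝ)]
  simp only [WithLp.ofLp_sum, Finset.sum_apply]
  refine Finset.sum_congr rfl fun k _ => ?_
  rw [iteratedFDeriv_two_apply]
  have hd : DifferentiableAt ℝ (fderiv ℝ v) x :=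
    (hv.fderiv_right (m := ∞) (by simp)).differentiable (by simp) x
  have e : pd k (fun x => v x j) = fun y => (fderiv ℝ v y (EuclideanSpace.single k 1)) j := by
    ext y; exact pd_component hv k j y
  have hs : ContDiff ℝ ∞ fun y => fderiv ℝ v y (EuclideanSpace.single k 1) :=
    (hv.fderiv_right (m := ∞) (by simp)).clm_apply contDiff_const
  rw [e, pd_component hs, fderiv_clm_apply hd (differentiableAt_const _)]
  simp

theorem gradient_component (f : E3 → ℝ) (j : Fin 3) (x : E3) :
    (∇ f x) j = pd j f x := by
  have h : inner ℝ (∇ f x) (EuclideanSpace.single j 1) = fderiv ℝ f x (EuclideanSpace.single j 1) := by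
    rw [gradient, InnerProductSpace.toDual_symm_apply]
  rw [pd, ← h, EuclideanSpace.inner_single_right]
  simp

/-- Testing the Navier-Stokes equations at a fixed time with a compactly supported
divergence-free field. -/
theorem integral_navierStokes_slice {v w : E3 → E3} {p : E3 → ℝ} (hv : ContDiff ℝ ∞ v)
    (hp : ContDiff ℝ ∞ p) (hdiv : ∀ x, divergence v x = 0) (hw : Continuous w)
    (heq : ∀ x, w x + fderiv ℝ v x (v x) + ∇ p x - (Δ v) x = 0) {Ψ : Fin 3 → E3 → ℝ}
    (hΨ : ∀ j, ContDiff ℝ ∞ (Ψ j)) (hs : ∀ j, HasCompactSupport (Ψ j))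
    (hΨdiv : ∀ x, ∑ j, pd j (Ψ j) x = 0) :
    ∫ x, ∑ j, w x j * Ψ j x =
      ∫ x, (∑ j, v x j * ∑ k, pd k (pd k (Ψ j)) x + ∑ j, ∑ k, v x j * v x k * pd k (Ψ j) x) := by
  have hvj := contDiff_component hv
  have hvk : ∀ j k, ContDiff ℝ ∞ (pd k fun x => v x j) := fun j k => contDiff_pd (hvj j) k
  have hΨk : ∀ j k, ContDiff ℝ ∞ (pd k (Ψ j)) := fun j k => contDiff_pd (hΨ j) k
  have hΨkk : ∀ j k, ContDiff ℝ ∞ (pd k (pd k (Ψ j))) := fun j k => contDiff_pd (hΨk j k) k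
  -- `X` is the flux whose divergence is the difference of the two integrands: the viscous part from
  -- Green's identity, the transport part `vₖ v·Ψ` and the pressure part `pΨₖ`. It is compactly
  -- supported because `Ψ` is, so its divergence has zero integral and no decay of `v` or `p` is
  -- used.
  set X : Fin 3 → E3 → ℝ := fun k x =>
    (∑ j, (pd k (fun x => v x j) x * Ψ j x - v x j * pd k (Ψ j) x - v x k * v x j * Ψ j x)) -
      p x * Ψ k x with hX
  have hX1 : ∀ j k, ContDiff ℝ ∞ fun x => pd k (fun x => v x j) x * Ψ j x := fun j k =>
    (hvk j k).mul (hΨ j)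
  have hX2 : ∀ j k, ContDiff ℝ ∞ fun x => v x j * pd k (Ψ j) x := fun j k =>
    (hvj j).mul (hΨk j k)
  have hX30 : ∀ j k, ContDiff ℝ ∞ fun x => v x k * v x j := fun j k => (hvj k).mul (hvj j)
  have hX3 : ∀ j k, ContDiff ℝ ∞ fun x => v x k * v x j * Ψ j x := fun j k =>
    (hX30 j k).mul (hΨ j)
  have hX4 : ∀ k, ContDiff ℝ ∞ fun x => p x * Ψ k x := fun k => hp.mul (hΨ k)
  have hXs : ∀ k, ContDiff ℝ ∞ (X k) := fun k =>
    (ContDiff.sum fun j _ => ((hX1 j k).sub (hX2 j k)).sub (hX3 j k)).sub (hX4 k)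
  have hXc : ∀ k, HasCompactSupport (X k) := by
    intro k
    have hcpt : IsCompact (⋃ j, tsupport (Ψ j)) := isCompact_iUnion fun j => hs j
    refine HasCompactSupport.of_support_subset_isCompact hcpt fun x hx => ?_
    by_contra hn
    simp only [mem_iUnion, not_exists] at hn
    refine hx ?_
    have h0 : ∀ j, Ψ j x = 0 := fun j => image_eq_zero_of_notMem_tsupport (hn j)
    have h1 : ∀ j, pd k (Ψ j) x = 0 := fun j => by
      have : x ∉ tsupport (fderiv ℝ (Ψ j)) := fun h => hn j (tsupport_fderiv_subset ℝ h)
      rw [pd, image_eq_zero_of_notMem_tsupport this]; rfl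
    simp [hX, h0, h1]
  have hdX : ∀ k x, pd k (X k) x =
      (∑ j, (pd k (pd k fun x => v x j) x * Ψ j x - v x j * pd k (pd k (Ψ j)) x
        - (pd k (fun x => v x k) x * v x j + v x k * pd k (fun x => v x j) x) * Ψ j x
        - v x k * v x j * pd k (Ψ j) x)) - (pd k p x * Ψ k x + p x * pd k (Ψ k) x) := by
    intro k x
    rw [hX]
    rw [pd_sub (ContDiff.sum fun j _ => ((hX1 j k).sub (hX2 j k)).sub (hX3 j k)) (hX4 k),
      pd_sum (fun j => ((hX1 j k).sub (hX2 j k)).sub (hX3 j k)), pd_mul hp (hΨ k)]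
    congr 1
    refine Finset.sum_congr rfl fun j _ => ?_
    rw [pd_sub ((hX1 j k).sub (hX2 j k)) (hX3 j k), pd_sub (hX1 j k) (hX2 j k),
      pd_mul (hvk j k) (hΨ j), pd_mul (hvj j) (hΨk j k), pd_mul (hX30 j k) (hΨ j),
      pd_mul (hvj k) (hvj j)]
    ring
  have hkey : ∀ x, ∑ k, pd k (X k) x = ∑ j, w x j * Ψ j x -
      (∑ j, v x j * ∑ k, pd k (pd k (Ψ j)) x + ∑ j, ∑ k, v x j * v x k * pd k (Ψ j) x) := by
    intro x
    have hwj : ∀ j, w x j = ∑ k, pd k (pd k (fun x => v x j)) x -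
        ∑ k, v x k * pd k (fun x => v x j) x - pd j p x := by
      intro j
      have h := congrArg (fun z : E3 => z j) (heq x)
      simp only [PiLp.sub_apply, PiLp.add_apply, PiLp.zero_apply] at h
      rw [fderiv_apply_component hv, gradient_component, laplacian_component hv] at h
      linarith
    have hd := hdiv x
    simp only [divergence, ← pd_component hv] at hd
    have hd2 := hΨdiv x
    simp_rw [hdX, hwj]
    simp only [Fin.sum_univ_three] at hd hd2 ⊢
    -- The two leftover terms are `(div v)(v·Ψ)` and `p div Ψ`; the two divergence conditions remove
    -- them.
    linear_combination (-(v x 0 * Ψ 0 x + v x 1 * Ψ 1 x + v x 2 * Ψ 2 x)) * hd - p x * hd2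
  have hcv := hv.continuous
  have hint1 : Integrable fun x => ∑ j, w x j * Ψ j x := by
    refine integrable_finsetSum _ fun j _ => Continuous.integrable_of_hasCompactSupport ?_
      (hs j).mul_left
    have := (hΨ j).continuous
    fun_prop
  have hint2 : Integrable fun x => (∑ j, v x j * ∑ k, pd k (pd k (Ψ j)) x +
      ∑ j, ∑ k, v x j * v x k * pd k (Ψ j) x) := by
    refine Integrable.add (integrable_finsetSum _ fun j _ => ?_)
      (integrable_finsetSum _ fun j _ => integrable_finsetSum _ fun k _ => ?_)
    · simp_rw [Finset.mul_sum]
      refine integrable_finsetSum _ fun k _ => Continuous.integrable_of_hasCompactSupport ?_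
        (hasCompactSupport_pd (hasCompactSupport_pd (hs j) k) k).mul_left
      have := (hΨkk j k).continuous
      fun_prop
    · refine Continuous.integrable_of_hasCompactSupport ?_
        (hasCompactSupport_pd (hs j) k).mul_left
      have := (hΨk j k).continuous
      fun_prop
  have h0 : ∫ x, ∑ k, pd k (X k) x = 0 := by
    rw [integral_finsetSum _ fun k _ => (contDiff_pd (hXs k) k).continuous.integrable_of_hasCompactSupport
      (hasCompactSupport_pd (hXc k) k)]
    exact Finset.sum_eq_zero fun k _ => integral_pd_eq_zero (hXs k) (hXc k) k
  simp_rw [hkey] at h0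
  rw [integral_sub hint1 hint2] at h0
  linarith

/-! ### Space-time test functions -/

/-- The `i`-th spatial derivative of a function on space-time. -/
noncomputable def sd (i : Fin 3) (F : ℝ × E3 → ℝ) (z : ℝ × E3) : ℝ :=
  fderiv ℝ F z (0, EuclideanSpace.single i 1)

/-- The time derivative of a function on space-time. -/
noncomputable def td (F : ℝ × E3 → ℝ) (z : ℝ × E3) : ℝ := fderiv ℝ F z (1, 0)

theorem contDiff_sd {F : ℝ × E3 → ℝ} (hF : ContDiff ℝ ∞ F) (i : Fin 3) : ContDiff ℝ ∞ (sd i F) :=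
  (hF.fderiv_right (m := ∞) (by simp)).clm_apply contDiff_const

theorem contDiff_td {F : ℝ × E3 → ℝ} (hF : ContDiff ℝ ∞ F) : ContDiff ℝ ∞ (td F) :=
  (hF.fderiv_right (m := ∞) (by simp)).clm_apply contDiff_const

theorem contDiff_slice {F : ℝ × E3 → ℝ} (hF : ContDiff ℝ ∞ F) (s : ℝ) :
    ContDiff ℝ ∞ fun y => F (s, y) := hF.comp (contDiff_const.prodMk contDiff_id)

theorem pd_slice {F : ℝ × E3 → ℝ} (hF : ContDiff ℝ ∞ F) (i : Fin 3) (s : ℝ) :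
    pd i (fun y => F (s, y)) = fun y => sd i F (s, y) := by
  ext y
  have h := (hF.differentiable (by simp) (s, y)).hasFDerivAt.comp y
    ((hasFDerivAt_const s y).prodMk (hasFDerivAt_id y))
  have h' : HasFDerivAt (fun y => F (s, y)) _ y := h
  rw [pd, h'.fderiv]
  simp [sd]

theorem hasDerivAt_td {F : ℝ × E3 → ℝ} (hF : ContDiff ℝ ∞ F) (s : ℝ) (y : E3) :
    HasDerivAt (fun s => F (s, y)) (td F (s, y)) s := by
  have h := (hF.differentiable (by simp) (s, y)).hasFDerivAt.comp_hasDerivAt s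
    ((hasDerivAt_id s).prodMk (hasDerivAt_const s y))
  simpa [td, Function.comp_def] using h

theorem td_sd_comm {F : ℝ × E3 → ℝ} (hF : ContDiff ℝ ∞ F) (i : Fin 3) (z : ℝ × E3) :
    td (sd i F) z = sd i (td F) z := by
  have h := (hF.contDiffAt (x := z)).isSymmSndFDerivAt (by simpa using two_le_infty)
  have hd : DifferentiableAt ℝ (fderiv ℝ F) z :=
    (hF.fderiv_right (m := ∞) (by simp)).differentiable (by simp) z
  have e : ∀ v w : ℝ × E3, fderiv ℝ (fun y => fderiv ℝ F y w) z v =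
      fderiv ℝ (fderiv ℝ F) z v w := by
    intro v w
    rw [fderiv_clm_apply hd (differentiableAt_const _)]
    simp
  have e1 : sd i F = fun y => fderiv ℝ F y (0, EuclideanSpace.single i 1) := rfl
  have e2 : td F = fun y => fderiv ℝ F y (1, 0) := rfl
  rw [e1, e2, td, sd, e, e]
  exact h.eq _ _

theorem sd_eq_zero {F : ℝ × E3 → ℝ} {K : Set E3} (hK : IsClosed K)
    (h : ∀ s, ∀ y ∉ K, F (s, y) = 0) (i : Fin 3) (s : ℝ) (y : E3) (hy : y ∉ K) :
    sd i F (s, y) = 0 := by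
  have : F =ᶠ[nhds (s, y)] fun _ => 0 := by
    filter_upwards [(hK.isOpen_compl.preimage continuous_snd).mem_nhds
      (show (s, y) ∈ Prod.snd ⁻¹' Kᶜ from hy)] with z hz
    exact h z.1 z.2 hz
  rw [sd, this.fderiv_eq]
  simp

theorem td_eq_zero {F : ℝ × E3 → ℝ} {K : Set E3} 
    (h : ∀ s, ∀ y ∉ K, F (s, y) = 0) (s : ℝ) (y : E3) (hF : ContDiff ℝ ∞ F) (hy : y ∉ K) :
    td F (s, y) = 0 := by
  have h1 := hasDerivAt_td hF s y
  have h2 : (fun s => F (s, y)) = fun _ => 0 := by ext s; exact h s y hy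
  rw [h2] at h1
  exact h1.unique (hasDerivAt_const _ _)

namespace IsClassicalNavierStokes

variable {a b : ℝ} {u : ℝ → E3 → E3}

theorem contDiff_slice (hu : IsClassicalNavierStokes a b u) {t : ℝ} (ht : t ∈ Icc a b) :
    ContDiff ℝ ∞ (u t) := by
  rw [← contDiffOn_univ]
  exact hu.1.comp (contDiff_const.prodMk contDiff_id).contDiffOn fun x _ => ⟨ht, mem_univ _⟩

theorem continuousOn (hu : IsClassicalNavierStokes a b u) :
    ContinuousOn (fun z : ℝ × E3 => u z.1 z.2) (Icc a b ×ˢ univ) := hu.1.continuousOn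

theorem hasDerivWithinAt (hu : IsClassicalNavierStokes a b u) {t : ℝ}
    (ht : t ∈ Icc a b) (x : E3) :
    HasDerivWithinAt (fun s => u s x)
      (fderivWithin ℝ (fun z : ℝ × E3 => u z.1 z.2) (Icc a b ×ˢ univ) (t, x) (1, 0)) (Icc a b) t := by
  have h := ((hu.1.differentiableOn (by simp)) (t, x) ⟨ht, mem_univ _⟩).hasFDerivWithinAt
  have hm : MapsTo (fun s : ℝ => (s, x)) (Icc a b) (Icc a b ×ˢ univ) := fun s hs => ⟨hs, mem_univ _⟩
  exact h.comp_hasDerivWithinAt t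
    ((hasDerivWithinAt_id t _).prodMk (hasDerivWithinAt_const t _ x)) hm

theorem continuousOn_timeDeriv (hu : IsClassicalNavierStokes a b u) (hab : a < b) :
    ContinuousOn (fun z : ℝ × E3 => derivWithin (fun s => u s z.2) (Icc a b) z.1)
      (Icc a b ×ˢ univ) := by
  have h := (hu.1.continuousOn_fderivWithin
    ((uniqueDiffOn_Icc hab).prod uniqueDiffOn_univ) (by simp)).clm_apply
    (continuousOn_const (c := ((1 : ℝ), (0 : E3))))
  refine h.congr fun z hz => ?_
  exact (hu.hasDerivWithinAt hz.1 z.2).derivWithin (uniqueDiffOn_Icc hab z.1 hz.1)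

/-- The weak form of the Navier-Stokes equations for divergence-free test fields. -/
theorem weak_form (hu : IsClassicalNavierStokes a b u) {a' b' : ℝ} (ha : a ≤ a') (hab : a' < b')
    (hb : b' ≤ b) {Φ : Fin 3 → ℝ × E3 → ℝ} (hΦ : ∀ j, ContDiff ℝ ∞ (Φ j)) {K : Set E3}
    (hK : IsCompact K) (hΦK : ∀ j s, ∀ y ∉ K, Φ j (s, y) = 0)
    (hdiv : ∀ z, ∑ j, sd j (Φ j) z = 0) :
    (∫ y, ∑ j, u b' y j * Φ j (b', y)) - ∫ y, ∑ j, u a' y j * Φ j (a', y) =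
      ∫ s in a'..b', ∫ y, (∑ j, u s y j * (td (Φ j) (s, y) + ∑ k, sd k (sd k (Φ j)) (s, y)) +
        ∑ j, ∑ k, u s y j * u s y k * sd k (Φ j) (s, y)) := by
  have hab0 : a < b := by linarith
  have hsub : Icc a' b' ⊆ Icc a b := Icc_subset_Icc ha hb
  obtain ⟨-, hudiv, p, hp, heq⟩ := id hu
  set w : ℝ → E3 → E3 := fun s y => derivWithin (fun s => u s y) (Icc a b) s with hw
  have hwc := hu.continuousOn_timeDeriv hab0
  have hΦs : ∀ j s, HasCompactSupport fun y => Φ j (s, y) := fun j s =>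
    HasCompactSupport.of_support_subset_isCompact hK fun y hy => by
      by_contra h; exact hy (hΦK j s y h)
  have hsl : ∀ s ∈ Icc a b, Continuous (w s) := fun s hs => by
    have := hwc.comp (f := fun y : E3 => (s, y)) (s := univ) (by fun_prop)
      (fun y _ => ⟨hs, mem_univ _⟩)
    rwa [continuousOn_univ] at this
  set g : ℝ → E3 → ℝ := fun s y => ∑ j, (w s y j * Φ j (s, y) + u s y j * td (Φ j) (s, y)) with hg
  have hgc : ContinuousOn (Function.uncurry g) (Icc a b ×ˢ univ) := by
    have h1 : ∀ j, ContinuousOn (fun z : ℝ × E3 => w z.1 z.2 j) (Icc a b ×ˢ univ) := fun j =>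
      (EuclideanSpace.proj j : E3 →L[ℝ] ℝ).continuous.comp_continuousOn hwc
    have h2 : ∀ j, ContinuousOn (fun z : ℝ × E3 => u z.1 z.2 j) (Icc a b ×ˢ univ) := fun j =>
      (EuclideanSpace.proj j : E3 →L[ℝ] ℝ).continuous.comp_continuousOn hu.continuousOn
    exact continuousOn_finsetSum _ fun j _ => ((h1 j).mul (hΦ j).continuous.continuousOn).add
      ((h2 j).mul (contDiff_td (hΦ j)).continuous.continuousOn)
  have hgK : ∀ s, ∀ y ∉ K, g s y = 0 := fun s y hy => by
    simp [hg, hΦK _ _ _ hy, td_eq_zero (hΦK _) _ _ (hΦ _) hy]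
  have hgint : Integrable (Function.uncurry g) ((volume.restrict (Ioc a' b')).prod volume) := by
    have h1 : IntegrableOn (Function.uncurry g) (Icc a' b' ×ˢ K) (volume.prod volume) :=
      (hgc.mono (prod_mono hsub (subset_univ _))).integrableOn_compact (isCompact_Icc.prod hK)
    have h2 : IntegrableOn (Function.uncurry g) (Ioc a' b' ×ˢ univ) (volume.prod volume) := by
      -- Outside `K` the integrand vanishes, so integrability over the compact piece `[a', b'] × K`
      -- extends to the whole slab.
      refine (h1.mono_set (prod_mono Ioc_subset_Icc_self subset_rfl)).of_forall_sdiff_eq_zero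
        (measurableSet_Ioc.prod MeasurableSet.univ) fun z hz => ?_
      refine hgK z.1 z.2 fun hzK => hz.2 ⟨hz.1.1, hzK⟩
    rwa [IntegrableOn, ← Measure.prod_restrict, Measure.restrict_univ] at h2
  have hder : ∀ y, ∀ s ∈ Icc a b, HasDerivWithinAt (fun s => ∑ j, u s y j * Φ j (s, y)) (g s y)
      (Icc a b) s := by
    intro y s hs
    have h1 : HasDerivWithinAt (fun s => u s y) (w s y) (Icc a b) s :=
      (hu.hasDerivWithinAt hs y).differentiableWithinAt.hasDerivWithinAt
    refine HasDerivWithinAt.fun_sum fun j _ => ?_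
    have h2 : HasDerivWithinAt (fun s => u s y j) (w s y j) (Icc a b) s :=
      (EuclideanSpace.proj j : E3 →L[ℝ] ℝ).hasFDerivAt.comp_hasDerivWithinAt s h1
    exact h2.mul (hasDerivAt_td (hΦ j) s y).hasDerivWithinAt
  -- The fundamental theorem of calculus is applied at each fixed point `y`, needing a two-sided
  -- derivative only inside the interval. Fubini then leaves an identity at each fixed time, to
  -- which the slice identity applies.
  have hftc : ∀ y, ∫ s in a'..b', g s y =
      ∑ j, u b' y j * Φ j (b', y) - ∑ j, u a' y j * Φ j (a', y) := by
    intro y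
    refine intervalIntegral.integral_eq_sub_of_hasDerivAt_of_le
      (f := fun s => ∑ j, u s y j * Φ j (s, y)) hab.le ?_ ?_ ?_
    · exact fun s hs => ((hder y s (hsub hs)).continuousWithinAt).mono hsub
    · intro s hs
      exact (hder y s (hsub (Ioo_subset_Icc_self hs))).hasDerivAt
        (Icc_mem_nhds (by linarith [hs.1]) (by linarith [hs.2]))
    · refine ContinuousOn.intervalIntegrable ?_
      rw [uIcc_of_le hab.le]
      exact hgc.comp (f := fun s : ℝ => (s, y)) (by fun_prop) fun s hs => ⟨hsub hs, mem_univ _⟩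
  have hends : ∀ s ∈ Icc a b, Integrable fun y => ∑ j, u s y j * Φ j (s, y) := fun s hs => by
    have h1 := (hu.contDiff_slice hs).continuous
    refine integrable_finsetSum _ fun j _ => Continuous.integrable_of_hasCompactSupport ?_
      (hΦs j s).mul_left
    have := (hΦ j).continuous
    fun_prop
  rw [← integral_sub (hends b' (hsub ⟨hab.le, le_rfl⟩)) (hends a' (hsub ⟨le_rfl, hab.le⟩))]
  simp_rw [← hftc, intervalIntegral.integral_of_le hab.le]
  rw [← integral_integral_swap hgint]
  refine setIntegral_congr_fun measurableSet_Ioc fun s hs => ?_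
  have hs' : s ∈ Icc a b := hsub (Ioc_subset_Icc_self hs)
  have hus := hu.contDiff_slice hs'
  have hps : ContDiff ℝ ∞ (p s) := by
    rw [← contDiffOn_univ]
    exact hp.comp (contDiff_const.prodMk contDiff_id).contDiffOn fun x _ => ⟨hs', mem_univ _⟩
  have hΨ : ∀ j, ContDiff ℝ ∞ fun y => Φ j (s, y) := fun j => _root_.contDiff_slice (hΦ j) s
  have hkey := integral_navierStokes_slice hus hps (hudiv s hs') (hsl s hs') (heq s hs') hΨ
    (fun j => hΦs j s) (fun x => by
      have := hdiv (s, x)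
      simp_rw [pd_slice (hΦ _)]
      exact this)
  simp_rw [pd_slice (hΦ _), pd_slice (contDiff_sd (hΦ _) _)] at hkey
  have hKc := hK.isClosed
  have hu2 := hus.continuous
  have i0 : Integrable fun y => ∑ j, w s y j * Φ j (s, y) :=
    integrable_finsetSum _ fun j _ => Continuous.integrable_of_hasCompactSupport (by
      have := (hΦ j).continuous
      have := hsl s hs'
      fun_prop) (hΦs j s).mul_left
  have i1 : Integrable fun y => ∑ j, u s y j * td (Φ j) (s, y) :=
    integrable_finsetSum _ fun j _ => Continuous.integrable_of_hasCompactSupport (by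
      have := (contDiff_td (hΦ j)).continuous
      fun_prop) (HasCompactSupport.mul_left
        (HasCompactSupport.of_support_subset_isCompact hK fun y hy => by
          by_contra h; exact hy (td_eq_zero (hΦK j) s y (hΦ j) h)))
  have i2 : Integrable fun y => (∑ j, u s y j * ∑ k, sd k (sd k (Φ j)) (s, y) +
      ∑ j, ∑ k, u s y j * u s y k * sd k (Φ j) (s, y)) := by
    refine Continuous.integrable_of_hasCompactSupport ?_ ?_
    · have h1 := fun j k => (contDiff_sd (hΦ j) k).continuous
      have h2 := fun j k => (contDiff_sd (contDiff_sd (hΦ j) k) k).continuous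
      fun_prop
    · refine HasCompactSupport.of_support_subset_isCompact hK fun y hy => ?_
      by_contra h
      have h1 : ∀ j k, sd k (Φ j) (s, y) = 0 := fun j k => sd_eq_zero hKc (hΦK j) k s y h
      have h2 : ∀ j k, sd k (sd k (Φ j)) (s, y) = 0 := fun j k =>
        sd_eq_zero hKc (fun s y hy => sd_eq_zero hKc (hΦK j) k s y hy) k s y h
      exact hy (by simp [h1, h2])
  have e1 : ∫ y, g s y = (∫ y, ∑ j, w s y j * Φ j (s, y)) + ∫ y, ∑ j, u s y j * td (Φ j) (s, y) := by
    rw [← integral_add i0 i1]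
    simp only [hg, Finset.sum_add_distrib]
  show ∫ y, g s y = _
  rw [e1, hkey, ← integral_add i2 i1]
  congr 1
  ext y
  simp only [mul_add, Finset.sum_add_distrib]
  ring

end IsClassicalNavierStokes

/-! ### Bounds of derivatives -/

/-- All derivatives of `f` up to order `m` are bounded by `B`. -/
def DerivBound (m : ℕ) (f : E3 → ℝ) (B : E3 → ℝ) : Prop :=
  ContDiff ℝ ∞ f ∧ ∀ n ≤ m, ∀ x, ‖iteratedFDeriv ℝ n f x‖ ≤ B x

theorem norm_iteratedFDeriv_pd_le {f : E3 → ℝ} (hf : ContDiff ℝ ∞ f) (i : Fin 3) (n : ℕ) (x : E3) :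
    ‖iteratedFDeriv ℝ n (pd i f) x‖ ≤ ‖iteratedFDeriv ℝ (n + 1) f x‖ := by
  have h := norm_iteratedFDeriv_clm_apply_const (𝕜 := ℝ) (f := fderiv ℝ f)
    (c := EuclideanSpace.single i (1 : ℝ)) (x := x) (N := ∞) (n := n)
    (hf.fderiv_right (m := ∞) (by simp)).contDiffAt (by exact_mod_cast le_top)
  rw [norm_iteratedFDeriv_fderiv] at h
  refine h.trans (le_of_eq ?_)
  simp

namespace DerivBound

variable {m : ℕ} {f g : E3 → ℝ} {A B : E3 → ℝ}

theorem abs_le (h : DerivBound m f B) (x : E3) : |f x| ≤ B x := by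
  have := h.2 0 (Nat.zero_le _) x
  rwa [norm_iteratedFDeriv_zero] at this

theorem nonneg (h : DerivBound m f B) (x : E3) : 0 ≤ B x := (abs_nonneg _).trans (h.abs_le x)

theorem mono {k : ℕ} (h : DerivBound m f B) (hk : k ≤ m) : DerivBound k f B :=
  ⟨h.1, fun n hn => h.2 n (hn.trans hk)⟩

theorem pd (h : DerivBound (m + 1) f B) (i : Fin 3) : DerivBound m (pd i f) B :=
  ⟨contDiff_pd h.1 i, fun n hn x => (norm_iteratedFDeriv_pd_le h.1 i n x).trans
    (h.2 (n + 1) (by omega) x)⟩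

theorem zero (hB : ∀ x, 0 ≤ B x) : DerivBound m (fun _ => 0) B :=
  ⟨contDiff_const, fun n _ x => by
    rw [show (fun _ : E3 => (0 : ℝ)) = 0 from rfl, iteratedFDeriv_zero]; simpa using hB x⟩

theorem add (hf : DerivBound m f A) (hg : DerivBound m g B) :
    DerivBound m (fun x => f x + g x) (fun x => A x + B x) :=
  ⟨hf.1.add hg.1, fun n hn x => by
    have := iteratedFDeriv_add_apply (𝕜 := ℝ) (i := n) (x := x)
      (hf.1.of_le (by exact_mod_cast le_top)).contDiffAt
      (hg.1.of_le (by exact_mod_cast le_top)).contDiffAt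
    rw [show (fun x => f x + g x) = f + g from rfl, this]
    exact (norm_add_le _ _).trans (add_le_add (hf.2 n hn x) (hg.2 n hn x))⟩

theorem neg (hf : DerivBound m f A) : DerivBound m (fun x => -f x) A :=
  ⟨hf.1.neg, fun n hn x => by
    rw [show (fun x => -f x) = -f from rfl, iteratedFDeriv_neg_apply, norm_neg]
    exact hf.2 n hn x⟩

theorem sub (hf : DerivBound m f A) (hg : DerivBound m g B) :
    DerivBound m (fun x => f x - g x) (fun x => A x + B x) := by
  simpa [sub_eq_add_neg] using hf.add hg.neg

theorem sum {f : Fin 3 → E3 → ℝ} (hf : ∀ k, DerivBound m (f k) A) :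
    DerivBound m (fun x => ∑ k, f k x) (fun x => A x + A x + A x) := by
  simpa [Fin.sum_univ_three] using ((hf 0).add (hf 1)).add (hf 2)

/-- Leibniz's rule, with `2 ^ m` from the sum of the binomial coefficients. The first bound is a
constant because the first factor will be a cutoff; the decay is carried by the second factor. -/
theorem mul {c : ℝ} (hf : DerivBound m f (fun _ => c)) (hg : DerivBound m g B) :
    DerivBound m (fun x => f x * g x) (fun x => 2 ^ m * c * B x) :=
  ⟨hf.1.mul hg.1, fun n hn x => by
    have hc : 0 ≤ c := hf.nonneg 0
    have hB := hg.nonneg x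
    refine (norm_iteratedFDeriv_mul_le (𝕜 := ℝ) (N := ∞) hf.1 hg.1 x
      (by exact_mod_cast le_top)).trans ?_
    calc _ ≤ ∑ i ∈ Finset.range (n + 1), (n.choose i : ℝ) * c * B x := by
          refine Finset.sum_le_sum fun i hi => ?_
          have := Finset.mem_range.1 hi
          gcongr
          · exact hf.2 i (by omega) x
          · exact hg.2 _ (by omega) x
      _ = 2 ^ n * c * B x := by
          rw [← Finset.sum_mul, ← Finset.sum_mul]
          congr 2
          exact_mod_cast Nat.sum_range_choose n
      _ ≤ 2 ^ m * c * B x := by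
          gcongr
          norm_num⟩

end DerivBound

/-- The Laplacian of a scalar function. -/
noncomputable def lap (f : E3 → ℝ) (x : E3) : ℝ := ∑ k, pd k (pd k f) x

/-- The `j`-th component of the divergence-free field `∇∂ᵢf - Δf eᵢ`. -/
noncomputable def solField (i j : Fin 3) (f : E3 → ℝ) (x : E3) : ℝ :=
  pd j (pd i f) x - if i = j then lap f x else 0

theorem DerivBound.lap {m : ℕ} {f B : E3 → ℝ} (h : DerivBound (m + 2) f B) :
    DerivBound m (lap f) (fun x => 3 * B x) := by
  have := DerivBound.sum fun k => (h.pd k).pd k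
  refine ⟨this.1, fun n hn x => (this.2 n hn x).trans (by linarith)⟩

theorem DerivBound.solField {m : ℕ} {f B : E3 → ℝ} (h : DerivBound (m + 2) f B) (i j : Fin 3) :
    DerivBound m (solField i j f) (fun x => 4 * B x) := by
  have h1 := (h.pd i).pd j
  have h2 : DerivBound m (fun x => if i = j then _root_.lap f x else 0) (fun x => 3 * B x) := by
    split_ifs
    · exact h.lap
    · exact .zero fun x => by have := h.nonneg x; positivity
  have := h1.sub h2
  refine ⟨this.1, fun n hn x => (this.2 n hn x).trans (by linarith)⟩

/-! ### The same operators on space-time -/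

/-- The spatial Laplacian of a function on space-time. -/
noncomputable def slap (F : ℝ × E3 → ℝ) (z : ℝ × E3) : ℝ := ∑ k, sd k (sd k F) z

/-- The space-time version of `solField`. -/
noncomputable def ssol (i j : Fin 3) (F : ℝ × E3 → ℝ) (z : ℝ × E3) : ℝ :=
  sd j (sd i F) z - if i = j then slap F z else 0

section SpaceTime

variable {F G : ℝ × E3 → ℝ}

theorem contDiff_slap (hF : ContDiff ℝ ∞ F) : ContDiff ℝ ∞ (slap F) :=
  ContDiff.sum fun k _ => contDiff_sd (contDiff_sd hF k) k

theorem contDiff_ssol (hF : ContDiff ℝ ∞ F) (i j : Fin 3) : ContDiff ℝ ∞ (ssol i j F) := by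
  refine (contDiff_sd (contDiff_sd hF i) j).sub ?_
  split_ifs
  · exact contDiff_slap hF
  · exact contDiff_const

theorem lap_slice (hF : ContDiff ℝ ∞ F) (s : ℝ) :
    lap (fun y => F (s, y)) = fun y => slap F (s, y) := by
  ext y
  simp only [lap, slap, pd_slice hF, pd_slice (contDiff_sd hF _)]

theorem solField_slice (hF : ContDiff ℝ ∞ F) (i j : Fin 3) (s : ℝ) :
    solField i j (fun y => F (s, y)) = fun y => ssol i j F (s, y) := by
  ext y
  simp only [solField, ssol, pd_slice hF, pd_slice (contDiff_sd hF _), lap_slice hF]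

theorem sd_sub (hF : ContDiff ℝ ∞ F) (hG : ContDiff ℝ ∞ G) (i : Fin 3) :
    sd i (fun z => F z - G z) = fun z => sd i F z - sd i G z := by
  ext z
  simp only [sd]
  rw [fderiv_fun_sub (hF.differentiable (by simp) z) (hG.differentiable (by simp) z)]
  rfl

theorem td_sub (hF : ContDiff ℝ ∞ F) (hG : ContDiff ℝ ∞ G) :
    td (fun z => F z - G z) = fun z => td F z - td G z := by
  ext z
  simp only [td]
  rw [fderiv_fun_sub (hF.differentiable (by simp) z) (hG.differentiable (by simp) z)]
  rfl

theorem sd_sum {F : Fin 3 → ℝ × E3 → ℝ} (hF : ∀ k, ContDiff ℝ ∞ (F k)) (i : Fin 3) :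
    sd i (fun z => ∑ k, F k z) = fun z => ∑ k, sd i (F k) z := by
  ext z
  simp only [sd]
  rw [fderiv_fun_sum fun k _ => (hF k).differentiable (by simp) z]
  simp

theorem td_sum {F : Fin 3 → ℝ × E3 → ℝ} (hF : ∀ k, ContDiff ℝ ∞ (F k)) :
    td (fun z => ∑ k, F k z) = fun z => ∑ k, td (F k) z := by
  ext z
  simp only [td]
  rw [fderiv_fun_sum fun k _ => (hF k).differentiable (by simp) z]
  simp

theorem sd_comm (hF : ContDiff ℝ ∞ F) (i j : Fin 3) : sd i (sd j F) = sd j (sd i F) := by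
  ext ⟨s, y⟩
  have h := pd_comm (contDiff_slice hF s) i j y
  simpa only [pd_slice hF, pd_slice (contDiff_sd hF _)] using h

theorem td_sd (hF : ContDiff ℝ ∞ F) (i : Fin 3) : td (sd i F) = sd i (td F) :=
  funext fun z => td_sd_comm hF i z

theorem slap_sd (hF : ContDiff ℝ ∞ F) (i : Fin 3) : slap (sd i F) = sd i (slap F) := by
  have h : slap F = fun z => ∑ k, sd k (sd k F) z := rfl
  rw [h, sd_sum fun k => contDiff_sd (contDiff_sd hF k) k]
  ext z
  refine Finset.sum_congr rfl fun k _ => ?_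
  rw [sd_comm hF k i, sd_comm (contDiff_sd hF k) k i]

theorem td_slap (hF : ContDiff ℝ ∞ F) : td (slap F) = slap (td F) := by
  have h : slap F = fun z => ∑ k, sd k (sd k F) z := rfl
  rw [h, td_sum fun k => contDiff_sd (contDiff_sd hF k) k]
  ext z
  refine Finset.sum_congr rfl fun k _ => ?_
  rw [td_sd (contDiff_sd hF k), td_sd hF]

theorem td_ssol (hF : ContDiff ℝ ∞ F) (i j : Fin 3) : td (ssol i j F) = ssol i j (td F) := by
  by_cases h : i = j
  · have e : ∀ F, ssol i j F = fun z => sd j (sd i F) z - slap F z := fun F => by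
      ext z; simp [ssol, h]
    rw [e, e, td_sub (contDiff_sd (contDiff_sd hF i) j) (contDiff_slap hF),
      td_sd (contDiff_sd hF i), td_sd hF, td_slap hF]
  · have e : ∀ F, ssol i j F = sd j (sd i F) := fun F => by ext z; simp [ssol, h]
    rw [e, e, td_sd (contDiff_sd hF i), td_sd hF]

theorem slap_sub (hF : ContDiff ℝ ∞ F) (hG : ContDiff ℝ ∞ G) :
    slap (fun z => F z - G z) = fun z => slap F z - slap G z := by
  ext z
  simp only [slap, ← Finset.sum_sub_distrib]
  refine Finset.sum_congr rfl fun k _ => ?_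
  rw [sd_sub hF hG, sd_sub (contDiff_sd hF k) (contDiff_sd hG k)]

theorem slap_ssol (hF : ContDiff ℝ ∞ F) (i j : Fin 3) : slap (ssol i j F) = ssol i j (slap F) := by
  by_cases h : i = j
  · have e : ∀ F, ssol i j F = fun z => sd j (sd i F) z - slap F z := fun F => by
      ext z; simp [ssol, h]
    rw [e, e, slap_sub (contDiff_sd (contDiff_sd hF i) j) (contDiff_slap hF),
      slap_sd (contDiff_sd hF i), slap_sd hF]
  · have e : ∀ F, ssol i j F = sd j (sd i F) := fun F => by ext z; simp [ssol, h]
    rw [e, e, slap_sd (contDiff_sd hF i), slap_sd hF]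

/-- Since derivatives commute, both contributions to the divergence are the `i`-th derivative of the
Laplacian. Test fields of this form do not see the pressure. -/
theorem sum_sd_ssol (hF : ContDiff ℝ ∞ F) (i : Fin 3) (z : ℝ × E3) :
    ∑ j, sd j (ssol i j F) z = 0 := by
  have h1 : ∀ j, sd j (ssol i j F) z = sd j (sd j (sd i F)) z -
      if i = j then sd j (slap F) z else 0 := by
    intro j
    by_cases h : i = j
    · have e : ssol i j F = fun z => sd j (sd i F) z - slap F z := by ext z; simp [ssol, h]
      rw [e, sd_sub (contDiff_sd (contDiff_sd hF i) j) (contDiff_slap hF)]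
      simp [h]
    · have e : ssol i j F = sd j (sd i F) := by ext z; simp [ssol, h]
      simp [e, h]
  simp_rw [h1, Finset.sum_sub_distrib]
  rw [Finset.sum_ite_eq Finset.univ i, if_pos (Finset.mem_univ i)]
  have := congrFun (slap_sd hF i) z
  simp only [slap] at this
  rw [this]
  exact sub_self _

theorem ssol_neg (F : ℝ × E3 → ℝ) (i j : Fin 3) (z : ℝ × E3) :
    ssol i j (fun z => -F z) z = -ssol i j F z := by
  have h : ∀ (F : ℝ × E3 → ℝ) i, sd i (fun z => -F z) = fun z => -sd i F z := fun F i => by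
    ext z
    simp only [sd]
    rw [fderiv_fun_neg]
    rfl
  simp only [ssol, slap, h, Finset.sum_neg_distrib]
  split_ifs <;> ring

/-- Differential operators depend on germs only. This and the next lemmas identify, near a fixed
point, a cut off function with the original one once the cutoff equals one there. -/
theorem sd_congr {z : ℝ × E3} (h : F =ᶠ[nhds z] G) (i : Fin 3) : sd i F =ᶠ[nhds z] sd i G := by
  filter_upwards [h.fderiv (𝕜 := ℝ)] with w hw
  simp only [sd, hw]

theorem td_congr {z : ℝ × E3} (h : F =ᶠ[nhds z] G) : td F =ᶠ[nhds z] td G := by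
  filter_upwards [h.fderiv (𝕜 := ℝ)] with w hw
  simp only [td, hw]

theorem slap_congr {z : ℝ × E3} (h : F =ᶠ[nhds z] G) : slap F =ᶠ[nhds z] slap G := by
  have := fun k => sd_congr (sd_congr h k) k
  filter_upwards [this 0, this 1, this 2] with w h0 h1 h2
  simp only [slap, Fin.sum_univ_three, h0, h1, h2]

theorem ssol_congr {z : ℝ × E3} (h : F =ᶠ[nhds z] G) (i j : Fin 3) :
    ssol i j F =ᶠ[nhds z] ssol i j G := by
  filter_upwards [sd_congr (sd_congr h i) j, slap_congr h] with w h0 h1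
  simp only [ssol, h0, h1]

end SpaceTime

/-! ### Cutoffs -/

/-- The weight `(1 + |y|)⁻ⁿ`. -/
noncomputable def wt (n : ℕ) (y : E3) : ℝ := ((1 + ‖y‖) ^ n)⁻¹

theorem wt_pos (n : ℕ) (y : E3) : 0 < wt n y := by unfold wt; positivity

theorem continuous_wt (n : ℕ) : Continuous (wt n) := by
  unfold wt
  exact Continuous.inv₀ (by fun_prop) fun y => by positivity

theorem integrable_wt {n : ℕ} (hn : 4 ≤ n) : Integrable (wt n) := by
  have h := integrable_one_add_norm (E := E3) (μ := volume) (r := n) (by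
    simp only [finrank_euclideanSpace, Fintype.card_fin]
    exact_mod_cast (by omega : 3 < n))
  refine h.congr (Filter.Eventually.of_forall fun y => ?_)
  simp only [wt]
  rw [Real.rpow_neg (by positivity), Real.rpow_natCast]

/-- There are cutoffs to large balls with uniformly bounded derivatives. -/
theorem exists_cutoff (m : ℕ) : ∃ (χ : ℕ → E3 → ℝ) (c : ℝ),
    (∀ n, DerivBound m (χ n) fun _ => c) ∧ (∀ n, HasCompactSupport (χ n)) ∧
    ∀ y : E3, ∀ᶠ n in Filter.atTop, χ n =ᶠ[nhds y] fun _ => 1 := by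
  let b : ContDiffBump (0 : E3) := ⟨1, 2, one_pos, one_lt_two⟩
  have hbc : ContDiff ℝ ∞ b := b.contDiff
  have hb : ∀ i : ℕ, ∃ c : ℝ, ∀ ξ, ‖iteratedFDeriv ℝ i b ξ‖ ≤ c := fun i =>
    (hbc.continuous_iteratedFDeriv (m := i)
      (by exact_mod_cast le_top)).bounded_above_of_compact_support (b.hasCompactSupport.iteratedFDeriv i)
  choose c hc using hb
  have hc0 : ∀ i, 0 ≤ c i := fun i => (norm_nonneg _).trans (hc i 0)
  refine ⟨fun n y => b (((n : ℝ) + 1)⁻¹ • y), ∑ i ∈ Finset.range (m + 1), c i, fun n => ?_,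
    fun n => ?_, fun y => ?_⟩
  · refine ⟨hbc.comp (contDiff_const_smul _), fun k hk x => ?_⟩
    -- Composition with a dilation of norm at most one does not increase derivatives, whence bounds
    -- uniform in `n`.
    set L : E3 →L[ℝ] E3 := ((n : ℝ) + 1)⁻¹ • ContinuousLinearMap.id ℝ E3 with hL
    have hLn : ‖L‖ ≤ 1 := by
      rw [hL, norm_smul]
      have h1 : ‖((n : ℝ) + 1)⁻¹‖ ≤ 1 := by
        rw [norm_inv, Real.norm_of_nonneg (by positivity)]
        exact inv_le_one_of_one_le₀ (by linarith [Nat.cast_nonneg (α := ℝ) n])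
      calc _ ≤ 1 * 1 := mul_le_mul h1 ContinuousLinearMap.norm_id_le (norm_nonneg _) zero_le_one
        _ = 1 := one_mul 1
    have h := L.iteratedFDeriv_comp_right hbc x (i := k) (by exact_mod_cast le_top)
    have e : (fun y : E3 => b (((n : ℝ) + 1)⁻¹ • y)) = b ∘ L := by ext y; simp [hL]
    show ‖iteratedFDeriv ℝ k (fun y : E3 => b (((n : ℝ) + 1)⁻¹ • y)) x‖ ≤ _
    rw [e, h]
    refine (ContinuousMultilinearMap.norm_compContinuousLinearMap_le _ _).trans ?_
    calc _ ≤ c k * 1 := by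
          gcongr
          · exact hc0 k
          · exact hc k _
          · exact Finset.prod_le_one (fun _ _ => norm_nonneg _) fun _ _ => hLn
      _ = c k := mul_one _
      _ ≤ _ := Finset.single_le_sum (fun i _ => hc0 i) (Finset.mem_range.2 (by omega))
  · exact b.hasCompactSupport.comp_homeomorph
      (Homeomorph.smulOfNeZero (((n : ℝ) + 1)⁻¹) (by positivity))
  · filter_upwards [Filter.eventually_gt_atTop ⌈‖y‖⌉₊] with n hn
    have hn' : ‖y‖ < n := Nat.lt_of_ceil_lt hn
    have hopen : {z : E3 | ‖z‖ < n} ∈ nhds y :=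
      (isOpen_lt continuous_norm continuous_const).mem_nhds hn'
    filter_upwards [hopen] with z hz
    refine b.one_of_mem_closedBall ?_
    simp only [Metric.mem_closedBall, dist_zero_right, norm_smul, norm_inv]
    rw [Real.norm_of_nonneg (by positivity), inv_mul_le_iff₀ (by positivity)]
    have hz' : ‖z‖ < n := hz
    show ‖z‖ ≤ ((n : ℝ) + 1) * 1
    linarith

/-- `u` is bounded in a weighted `L²` space on the slab. -/
def WeightedL2 (a b M : ℝ) (u : ℝ → E3 → E3) : Prop :=
  ∀ s ∈ Icc a b, Integrable (fun y => ‖u s y‖ ^ 2 * wt 5 y) ∧ ∫ y, ‖u s y‖ ^ 2 * wt 5 y ≤ M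

theorem norm_mul_wt_le (v : E3) (y : E3) : ‖v‖ * wt 5 y ≤ ‖v‖ ^ 2 * wt 5 y + wt 5 y := by
  have := (wt_pos 5 y).le
  nlinarith [sq_nonneg (‖v‖ - 1), norm_nonneg v]

theorem integrable_norm_mul_wt {v : E3 → E3} (hv : Continuous v)
    (h : Integrable fun y => ‖v y‖ ^ 2 * wt 5 y) : Integrable fun y => ‖v y‖ * wt 5 y := by
  refine (h.add (integrable_wt (n := 5) (by norm_num))).mono'
    (hv.norm.mul (continuous_wt 5)).aestronglyMeasurable (Filter.Eventually.of_forall fun y => ?_)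
  rw [Real.norm_of_nonneg (mul_nonneg (norm_nonneg _) (wt_pos 5 y).le)]
  exact norm_mul_wt_le _ _

theorem abs_component_le (v : E3) (j : Fin 3) : |v j| ≤ ‖v‖ := by
  simpa using PiLp.norm_apply_le v j

theorem abs_sum_component_mul_le (v : E3) {f : Fin 3 → ℝ} {B : ℝ} (hf : ∀ j, |f j| ≤ B) :
    |∑ j, v j * f j| ≤ 3 * (‖v‖ * B) := by
  refine (Finset.abs_sum_le_sum_abs _ _).trans ?_
  calc ∑ j, |v j * f j| ≤ ∑ _j : Fin 3, ‖v‖ * B := by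
        refine Finset.sum_le_sum fun j _ => ?_
        rw [abs_mul]
        exact mul_le_mul (abs_component_le v j) (hf j) (abs_nonneg _) (norm_nonneg _)
    _ = 3 * (‖v‖ * B) := by simp

theorem abs_sum_sum_component_mul_le (v : E3) {f : Fin 3 → Fin 3 → ℝ} {B : ℝ}
    (hf : ∀ j k, |f j k| ≤ B) : |∑ j, ∑ k, v j * v k * f j k| ≤ 9 * (‖v‖ ^ 2 * B) := by
  have h : ∀ j, |∑ k, v k * f j k| ≤ 3 * (‖v‖ * B) := fun j => abs_sum_component_mul_le v (hf j)
  have := abs_sum_component_mul_le v h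
  simp_rw [mul_assoc, ← Finset.mul_sum]
  refine this.trans (le_of_eq ?_)
  ring

/-! ### Test functions with decay in place of compact support. -/

/-- A divergence-free field is orthogonal to gradients of decaying functions. -/
theorem integral_sum_mul_pd_eq_zero {v : E3 → E3} (hv : ContDiff ℝ ∞ v)
    (hdiv : ∀ x, divergence v x = 0) (hL : Integrable fun y => ‖v y‖ ^ 2 * wt 5 y) {f : E3 → ℝ}
    {C : ℝ} (hf : DerivBound 1 f fun y => C * wt 5 y) : ∫ x, ∑ j, v x j * pd j f x = 0 := by
  obtain ⟨χ, c, hχ, hχs, hχ1⟩ := exists_cutoff 1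
  have hvj := contDiff_component hv
  have h0 : ∀ n, ∫ x, ∑ j, v x j * pd j (fun y => χ n y * f y) x = 0 := by
    intro n
    set g : E3 → ℝ := fun y => χ n y * f y with hg
    have hgs : ContDiff ℝ ∞ g := (hχ n).1.mul hf.1
    have hgc : HasCompactSupport g := (hχs n).mul_right
    have hX : ∀ j, ContDiff ℝ ∞ fun x => v x j * g x := fun j => (hvj j).mul hgs
    have e : ∀ x, ∑ j, v x j * pd j g x = ∑ j, pd j (fun x => v x j * g x) x := by
      intro x
      have h1 := hdiv x
      simp only [divergence, ← pd_component hv] at h1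
      simp_rw [pd_mul (hvj _) hgs, Finset.sum_add_distrib, ← Finset.sum_mul, h1]
      ring
    simp_rw [e]
    rw [integral_finsetSum _ fun j _ =>
      (contDiff_pd (hX j) j).continuous.integrable_of_hasCompactSupport
      (hasCompactSupport_pd hgc.mul_left j)]
    exact Finset.sum_eq_zero fun j _ => integral_pd_eq_zero (hX j) hgc.mul_left j
  have hb := fun n => (hχ n).mul hf
  have hlim := tendsto_integral_of_dominated_convergence
    (μ := (volume : Measure E3)) (F := fun n x => ∑ j, v x j * pd j (fun y => χ n y * f y) x)
    (f := fun x => ∑ j, v x j * pd j f x)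
    (fun y => 3 * (‖v y‖ * wt 5 y) * (2 ^ 1 * c * C)) (fun n => by
      have := hv.continuous
      have h2 := fun j => (contDiff_pd (hb n).1 j).continuous
      have : Continuous fun x => ∑ j, v x j * pd j (fun y => χ n y * f y) x := by fun_prop
      exact this.aestronglyMeasurable)
    (((integrable_norm_mul_wt hv.continuous hL).const_mul 3).mul_const _)
    (fun n => Filter.Eventually.of_forall fun x => by
      refine (abs_sum_component_mul_le (v x) fun j => ((hb n).pd j).abs_le x).trans (le_of_eq ?_)
      ring)
    (Filter.Eventually.of_forall fun x => by
      refine tendsto_const_nhds.congr' ?_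
      filter_upwards [hχ1 x] with n hn
      refine Finset.sum_congr rfl fun j _ => ?_
      have : (fun y => χ n y * f y) =ᶠ[nhds x] f := by
        filter_upwards [hn] with y hy; rw [hy, one_mul]
      rw [pd, pd, this.fderiv_eq])
  simp only [h0] at hlim
  exact tendsto_nhds_unique hlim tendsto_const_nhds

/-- The projection to divergence-free fields can be dropped when testing against a
divergence-free field. -/
theorem integral_sum_mul_solField {v : E3 → E3} (hv : ContDiff ℝ ∞ v)
    (hdiv : ∀ x, divergence v x = 0) (hL : Integrable fun y => ‖v y‖ ^ 2 * wt 5 y) {f : E3 → ℝ}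
    {C : ℝ} (hf : DerivBound 2 f fun y => C * wt 5 y) (i : Fin 3) :
    ∫ x, ∑ j, v x j * solField i j f x = ∫ x, v x i * -lap f x := by
  have h := integral_sum_mul_pd_eq_zero hv hdiv hL (hf.pd i)
  have e : ∀ x, ∑ j, v x j * solField i j f x = ∑ j, v x j * pd j (pd i f) x + v x i * -lap f x := by
    intro x
    simp only [solField, mul_sub, Finset.sum_sub_distrib, mul_ite, mul_zero]
    rw [Finset.sum_ite_eq Finset.univ i, if_pos (Finset.mem_univ i)]
    ring
  have hI := integrable_norm_mul_wt hv.continuous hL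
  simp_rw [e]
  rw [integral_add, h, zero_add]
  · refine ((hI.const_mul 3).mul_const C).mono' ?_ (Filter.Eventually.of_forall fun x => ?_)
    · have := hv.continuous
      have h2 := fun j => (contDiff_pd (contDiff_pd hf.1 i) j).continuous
      have : Continuous fun x => ∑ j, v x j * pd j (pd i f) x := by fun_prop
      exact this.aestronglyMeasurable
    · refine (abs_sum_component_mul_le (v x) fun j => ((hf.pd i).pd j).abs_le x).trans (le_of_eq ?_)
      ring
  · refine ((hI.const_mul 3).mul_const C).mono' ?_ (Filter.Eventually.of_forall fun x => ?_)
    · have := hv.continuous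
      have h2 := hf.lap.1.continuous
      have : Continuous fun x => v x i * -lap f x := by fun_prop
      exact this.aestronglyMeasurable
    · rw [Real.norm_eq_abs, abs_mul, abs_neg]
      calc |v x i| * |lap f x| ≤ ‖v x‖ * (3 * (C * wt 5 x)) :=
            mul_le_mul (abs_component_le _ _) (hf.lap.abs_le x) (abs_nonneg _) (norm_nonneg _)
        _ = _ := by ring

namespace IsClassicalNavierStokes

variable {a b : ℝ} {u : ℝ → E3 → E3}

/-- The weak form for test functions that solve the backward heat equation. -/
theorem weak_form_heat (hu : IsClassicalNavierStokes a b u) {M : ℝ} (hM : WeightedL2 a b M u)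
    {a' b' : ℝ} (ha : a ≤ a')
    (hab : a' < b') (hb : b' ≤ b) {G : ℝ × E3 → ℝ} (hG : ContDiff ℝ ∞ G)
    (hheat : ∀ z, td G z = -slap G z) {C : ℝ}
    (hC : ∀ s ∈ Icc a' b', DerivBound 4 (fun y => G (s, y)) fun y => C * wt 5 y) (i : Fin 3) :
    (∫ y, ∑ j, u b' y j * ssol i j G (b', y)) - ∫ y, ∑ j, u a' y j * ssol i j G (a', y) =
      ∫ s in a'..b', ∫ y, ∑ j, ∑ k, u s y j * u s y k * sd k (ssol i j G) (s, y) := by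
  obtain ⟨χ, c, hχ, hχs, hχ1⟩ := exists_cutoff 4
  have hsub : Icc a' b' ⊆ Icc a b := Icc_subset_Icc ha hb
  have hc : 0 ≤ c := (hχ 0).nonneg 0
  -- The cutoff is applied to the potential `G` before the operator `ssol`. The resulting test
  -- fields are then both compactly supported and exactly divergence free; cutting off afterwards
  -- would lose the second property.
  set H : ℕ → ℝ × E3 → ℝ := fun n z => χ n z.2 * G z with hH
  have hHs : ∀ n, ContDiff ℝ ∞ (H n) := fun n => ((hχ n).1.comp contDiff_snd).mul hG
  have hHb : ∀ n, ∀ s ∈ Icc a' b', DerivBound 4 (fun y => H n (s, y))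
      fun y => 2 ^ 4 * c * (C * wt 5 y) := fun n s hs => (hχ n).mul (hC s hs)
  have hgerm : ∀ z : ℝ × E3, ∀ᶠ n in Filter.atTop, H n =ᶠ[nhds z] G := by
    intro z
    filter_upwards [hχ1 z.2] with n hn
    filter_upwards [continuous_snd.continuousAt.eventually hn] with w hw
    simp only [hH]
    rw [hw, one_mul]
  have htdH : ∀ n, td (H n) = fun z => -(χ n z.2 * slap G z) := by
    intro n
    ext ⟨s, y⟩
    have h1 := hasDerivAt_td (hHs n) s y
    have h2 := (hasDerivAt_td hG s y).const_mul (χ n y)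
    rw [h1.unique h2, hheat]
    ring
  set D : ℝ := 16 * (2 ^ 4 * c * C) with hD
  -- bounds on the three kinds of terms
  have hb1 : ∀ n, ∀ s ∈ Icc a' b', ∀ j y, |ssol i j (H n) (s, y)| ≤ D * wt 5 y := by
    intro n s hs j y
    have h := ((hHb n s hs).mono (k := 2) (by norm_num)).solField i j |>.mono (k := 0) (by norm_num)
    rw [solField_slice (hHs n)] at h
    have h0 := (hHb n s hs).nonneg y
    refine (h.abs_le y).trans ?_
    rw [hD]; nlinarith
  have hb2 : ∀ n, ∀ s ∈ Icc a' b', ∀ j k y, |sd k (ssol i j (H n)) (s, y)| ≤ D * wt 5 y := by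
    intro n s hs j k y
    have h := (((hHb n s hs).mono (k := 3) (by norm_num)).solField i j).pd k
    rw [solField_slice (hHs n), pd_slice (contDiff_ssol (hHs n) i j)] at h
    have h0 := (hHb n s hs).nonneg y
    refine (h.abs_le y).trans ?_
    rw [hD]; nlinarith
  -- The cut off potential no longer solves the backward heat equation, so this term is only
  -- bounded, not zero. Its time derivative is `-χ ΔG`, which turns it into a spatial derivative
  -- covered by the order-four hypothesis.
  have hb3 : ∀ n, ∀ s ∈ Icc a' b', ∀ j y,
      |td (ssol i j (H n)) (s, y) + slap (ssol i j (H n)) (s, y)| ≤ 2 * D * wt 5 y := by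
    intro n s hs j y
    have h0 := (hHb n s hs).nonneg y
    have h1 : |slap (ssol i j (H n)) (s, y)| ≤ D * wt 5 y := by
      have h := ((hHb n s hs).solField i j).lap
      rw [solField_slice (hHs n), lap_slice (contDiff_ssol (hHs n) i j)] at h
      refine (h.abs_le y).trans ?_
      rw [hD]; nlinarith
    have h2 : |td (ssol i j (H n)) (s, y)| ≤ D * wt 5 y := by
      rw [td_ssol (hHs n)]
      have h := ((hχ n).mono (k := 2) (by norm_num)).mul (hC s hs).lap |>.neg.solField i j
      rw [lap_slice hG] at h
      have e : (fun y => -(χ n y * slap G (s, y))) = fun y => td (H n) (s, y) := by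
        rw [htdH]
      rw [e, solField_slice (contDiff_td (hHs n))] at h
      refine (h.abs_le y).trans ?_
      rw [hD]
      nlinarith
    refine (abs_add_le _ _).trans ?_
    linarith
  have hMi := fun s hs => (hM s (hsub hs)).1
  have hus := fun s (hs : s ∈ Icc a' b') => (hu.contDiff_slice (hsub hs)).continuous
  have hI1 := fun s hs => integrable_norm_mul_wt (hus s hs) (hMi s hs)
  -- the weak form with cutoffs
  have hw : ∀ n, _ := fun n => hu.weak_form ha hab hb (Φ := fun j => ssol i j (H n))
    (fun j => contDiff_ssol (hHs n) i j) (hχs n)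
    (fun j s y hy => by
      have h0 : ∀ s, ∀ y ∉ tsupport (χ n), H n (s, y) = 0 := fun s y hy => by
        simp [hH, image_eq_zero_of_notMem_tsupport hy]
      have hcl := isClosed_tsupport (χ n)
      have h1 : ∀ k l, sd k (sd l (H n)) (s, y) = 0 := fun k l =>
        sd_eq_zero hcl (fun s y hy => sd_eq_zero hcl h0 l s y hy) k s y hy
      simp [ssol, slap, h1])
    (fun z => sum_sd_ssol (hHs n) i z)
  -- limits of the end terms
  have hend : ∀ s ∈ Icc a' b', Filter.Tendsto (fun n => ∫ y, ∑ j, u s y j * ssol i j (H n) (s, y))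
      Filter.atTop (nhds (∫ y, ∑ j, u s y j * ssol i j G (s, y))) := by
    intro s hs
    refine tendsto_integral_of_dominated_convergence
      (fun y => 3 * (‖u s y‖ * wt 5 y) * D) (fun n => ?_)
      (((hI1 s hs).const_mul 3).mul_const D)
      (fun n => Filter.Eventually.of_forall fun y => ?_) (Filter.Eventually.of_forall fun y => ?_)
    · have h1 := fun j => (contDiff_ssol (hHs n) i j).continuous
      have h2 := hus s hs
      have : Continuous fun y => ∑ j, u s y j * ssol i j (H n) (s, y) := by fun_prop
      exact this.aestronglyMeasurable
    · refine (abs_sum_component_mul_le _ fun j => hb1 n s hs j y).trans (le_of_eq ?_)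
      ring
    · refine tendsto_const_nhds.congr' ?_
      filter_upwards [hgerm (s, y)] with n hn
      exact Finset.sum_congr rfl fun j _ => by rw [(ssol_congr hn i j).eq_of_nhds]
  -- limit of the inner integral
  have hLG : ∀ j z, td (ssol i j G) z + slap (ssol i j G) z = 0 := by
    intro j z
    rw [td_ssol hG, slap_ssol hG, show td G = fun z => -slap G z from funext hheat, ssol_neg]
    ring
  set B : ℝ → E3 → ℝ := fun s y => 6 * D * (‖u s y‖ * wt 5 y) + 9 * D * (‖u s y‖ ^ 2 * wt 5 y) with hB
  have hBi : ∀ s ∈ Icc a' b', Integrable (B s) := fun s hs =>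
    ((hI1 s hs).const_mul _).add ((hMi s hs).const_mul _)
  have hbound : ∀ n, ∀ s ∈ Icc a' b', ∀ y,
      ‖∑ j, u s y j * (td (ssol i j (H n)) (s, y) + ∑ k, sd k (sd k (ssol i j (H n))) (s, y)) +
        ∑ j, ∑ k, u s y j * u s y k * sd k (ssol i j (H n)) (s, y)‖ ≤ B s y := by
    intro n s hs y
    refine (norm_add_le _ _).trans ?_
    have h1 := abs_sum_component_mul_le (u s y) fun j => hb3 n s hs j y
    have h2 := abs_sum_sum_component_mul_le (u s y) fun j k => hb2 n s hs j k y
    simp only [hB]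
    refine (add_le_add h1 h2).trans (le_of_eq ?_)
    ring
  have hinner : ∀ s ∈ Icc a' b', Filter.Tendsto (fun n => ∫ y, (∑ j, u s y j *
      (td (ssol i j (H n)) (s, y) + ∑ k, sd k (sd k (ssol i j (H n))) (s, y)) +
        ∑ j, ∑ k, u s y j * u s y k * sd k (ssol i j (H n)) (s, y))) Filter.atTop
      (nhds (∫ y, ∑ j, ∑ k, u s y j * u s y k * sd k (ssol i j G) (s, y))) := by
    intro s hs
    refine tendsto_integral_of_dominated_convergence (B s) (fun n => ?_) (hBi s hs)
      (fun n => Filter.Eventually.of_forall fun y => hbound n s hs y)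
      (Filter.Eventually.of_forall fun y => ?_)
    · have h1 := fun j => (contDiff_td (contDiff_ssol (hHs n) i j)).continuous
      have h2 := hus s hs
      have h3 := fun j k => (contDiff_sd (contDiff_ssol (hHs n) i j) k).continuous
      have h4 := fun j k => (contDiff_sd (contDiff_sd (contDiff_ssol (hHs n) i j) k) k).continuous
      refine Continuous.aestronglyMeasurable ?_
      fun_prop
    · refine tendsto_const_nhds.congr' ?_
      filter_upwards [hgerm (s, y)] with n hn
      have h1 := fun j => ssol_congr hn i j
      have e1 : ∀ j, td (ssol i j (H n)) (s, y) + ∑ k, sd k (sd k (ssol i j (H n))) (s, y) = 0 := by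
        intro j
        have e := hLG j (s, y)
        rw [← (td_congr (h1 j)).eq_of_nhds, ← (slap_congr (h1 j)).eq_of_nhds] at e
        exact e
      simp only [e1, mul_zero, Finset.sum_const_zero, zero_add]
      exact Finset.sum_congr rfl fun j _ => Finset.sum_congr rfl fun k _ => by
        rw [(sd_congr (h1 j) k).eq_of_nhds]
  -- A bound uniform in time, for the second application of dominated convergence, this time in `s`.
  have hBM : ∀ s ∈ Icc a' b', ∫ y, B s y ≤ 6 * D * (M + ∫ y, wt 5 y) + 9 * D * M := by
    intro s hs
    have hD0 : 0 ≤ D := by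
      have h := (abs_nonneg _).trans (hb1 0 s hs 0 0)
      exact nonneg_of_mul_nonneg_left h (wt_pos 5 0)
    rw [integral_add ((hI1 s hs).const_mul _) ((hMi s hs).const_mul _), integral_const_mul,
      integral_const_mul]
    have h1 : ∫ y, ‖u s y‖ * wt 5 y ≤ M + ∫ y, wt 5 y := by
      refine (integral_mono (hI1 s hs) ((hMi s hs).add (integrable_wt (by norm_num)))
        fun y => norm_mul_wt_le _ _).trans ?_
      rw [integral_add' (hMi s hs) (integrable_wt (by norm_num))]
      have := (hM s (hsub hs)).2
      linarith
    have h2 := (hM s (hsub hs)).2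
    gcongr
  have hout : Filter.Tendsto (fun n => ∫ s in a'..b', ∫ y, (∑ j, u s y j *
      (td (ssol i j (H n)) (s, y) + ∑ k, sd k (sd k (ssol i j (H n))) (s, y)) +
        ∑ j, ∑ k, u s y j * u s y k * sd k (ssol i j (H n)) (s, y))) Filter.atTop
      (nhds (∫ s in a'..b', ∫ y, ∑ j, ∑ k, u s y j * u s y k * sd k (ssol i j G) (s, y))) := by
    refine intervalIntegral.tendsto_integral_filter_of_dominated_convergence
      (fun _ => 6 * D * (M + ∫ y, wt 5 y) + 9 * D * M) (Filter.Eventually.of_forall fun n => ?_)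
      (Filter.Eventually.of_forall fun n => Filter.Eventually.of_forall fun s hs => ?_)
      intervalIntegrable_const (Filter.Eventually.of_forall fun s hs => ?_)
    · rw [uIoc_of_le hab.le]
      have hcont : ContinuousOn (fun z : ℝ × E3 => (∑ j, u z.1 z.2 j *
          (td (ssol i j (H n)) z + ∑ k, sd k (sd k (ssol i j (H n))) z) +
          ∑ j, ∑ k, u z.1 z.2 j * u z.1 z.2 k * sd k (ssol i j (H n)) z)) (Ioc a' b' ×ˢ univ) := by
        have h0 : ∀ j, ContinuousOn (fun z : ℝ × E3 => u z.1 z.2 j) (Ioc a' b' ×ˢ univ) := fun j =>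
          (EuclideanSpace.proj j : E3 →L[ℝ] ℝ).continuous.comp_continuousOn
            (hu.continuousOn.mono (prod_mono (Ioc_subset_Icc_self.trans hsub) subset_rfl))
        have h1 := fun j => (contDiff_td (contDiff_ssol (hHs n) i j)).continuous.continuousOn
          (s := Ioc a' b' ×ˢ univ)
        have h3 := fun j k => (contDiff_sd (contDiff_ssol (hHs n) i j) k).continuous.continuousOn
          (s := Ioc a' b' ×ˢ univ)
        have h4 := fun j k => (contDiff_sd (contDiff_sd (contDiff_ssol (hHs n) i j) k)
          k).continuous.continuousOn (s := Ioc a' b' ×ˢ univ)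
        exact (continuousOn_finsetSum _ fun j _ => (h0 j).mul ((h1 j).add
          (continuousOn_finsetSum _ fun k _ => h4 j k))).add
          (continuousOn_finsetSum _ fun j _ => continuousOn_finsetSum _ fun k _ =>
            ((h0 j).mul (h0 k)).mul (h3 j k))
      have hmeas := hcont.aestronglyMeasurable (μ := volume.prod volume)
        (measurableSet_Ioc.prod MeasurableSet.univ)
      rw [← Measure.prod_restrict, Measure.restrict_univ] at hmeas
      exact hmeas.integral_prod_right'
    · rw [uIoc_of_le hab.le] at hs
      have hs' := Ioc_subset_Icc_self hs
      refine (norm_integral_le_of_norm_le (hBi s hs') (Filter.Eventually.of_forall fun y =>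
        hbound n s hs' y)).trans (hBM s hs')
    · rw [uIoc_of_le hab.le] at hs
      exact hinner s (Ioc_subset_Icc_self hs)
  have hl := (hend b' ⟨hab.le, le_rfl⟩).sub (hend a' ⟨le_rfl, hab.le⟩)
  simp only [hw] at hl
  exact tendsto_nhds_unique hl hout

end IsClassicalNavierStokes

/-! ### Backward heat test functions and the Duhamel estimate. -/

/-- From `1 + |y| ≤ (1 + |x|)(1 + N⁻¹)(1 + N|x - y|)`. The constant depends on the base point and
the scale, so this serves only for integrability and for justifying limits; the quantitative
estimates keep the weight at scale `N⁻¹` around `x`. -/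
theorem wt_smul_sub_le (n : ℕ) {N : ℝ} (hN : 0 < N) (x y : E3) :
    wt n (N • (x - y)) ≤ ((1 + ‖x‖) * (1 + N⁻¹)) ^ n * wt n y := by
  unfold wt
  rw [norm_smul, Real.norm_of_nonneg hN.le, ← div_eq_mul_inv, inv_le_comm₀ (by positivity)
    (by positivity), inv_div, div_le_iff₀ (by positivity), ← mul_pow]
  gcongr
  have h1 : ‖y‖ ≤ ‖x‖ + ‖x - y‖ := by
    have := norm_sub_le x (x - y)
    rwa [sub_sub_cancel] at this
  have h2 : 0 ≤ N * ‖x - y‖ := by positivity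
  have h3 : N⁻¹ * (N * ‖x - y‖) = ‖x - y‖ := inv_mul_cancel_left₀ hN.ne' _
  have h4 : 0 < N⁻¹ := by positivity
  nlinarith [norm_nonneg x, norm_nonneg (x - y), mul_nonneg (norm_nonneg x) (norm_nonneg (x - y)),
    mul_nonneg (norm_nonneg x) h2, mul_nonneg (norm_nonneg x) h4.le,
    mul_nonneg h2 h4.le]

theorem pd_comp_affine {f : E3 → ℝ} (hf : ContDiff ℝ ∞ f) (c N : ℝ) (x : E3) (k : Fin 3) :
    pd k (fun y => c * f (N • (x - y))) = fun y => -(c * N) * pd k f (N • (x - y)) := by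
  ext y
  have h1 : HasFDerivAt (fun y => N • (x - y)) (N • -ContinuousLinearMap.id ℝ E3) y :=
    ((hasFDerivAt_id y).const_sub x).const_smul N
  have h2 := (((hf.differentiable (by simp) (N • (x - y))).hasFDerivAt.comp y h1).const_mul c)
  have h3 : HasFDerivAt (fun y => c * f (N • (x - y))) _ y := h2
  rw [pd, h3.fderiv, pd]
  simp
  ring

theorem norm_iteratedFDeriv_comp_affine_le {f : E3 → ℝ} (hf : ContDiff ℝ ∞ f) {c N : ℝ}
    (hc : 0 ≤ c) (hN : 0 ≤ N)
    (x y : E3) (n : ℕ) : ‖iteratedFDeriv ℝ n (fun y => c * f (N • (x - y))) y‖ ≤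
      c * N ^ n * ‖iteratedFDeriv ℝ n f (N • (x - y))‖ := by
  set L : E3 →L[ℝ] E3 := -N • ContinuousLinearMap.id ℝ E3 with hL
  have hLn : ‖L‖ ≤ N := by
    rw [hL, norm_smul, norm_neg, Real.norm_of_nonneg hN]
    exact mul_le_of_le_one_right hN ContinuousLinearMap.norm_id_le
  set g : E3 → ℝ := fun z => c * f (N • x + z) with hg
  have hgs : ContDiff ℝ ∞ g := contDiff_const.mul (hf.comp (contDiff_const.add contDiff_id))
  have e : (fun y => c * f (N • (x - y))) = g ∘ L := by
    ext z
    simp [hg, hL, sub_eq_add_neg]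
  have e2 : ‖iteratedFDeriv ℝ n g (L y)‖ = c * ‖iteratedFDeriv ℝ n f (N • (x - y))‖ := by
    have h1 : g = c • fun z => f (N • x + z) := by ext z; simp [hg]
    have h2 : ContDiff ℝ n fun z => f (N • x + z) :=
      (hf.comp (contDiff_const.add contDiff_id)).of_le (by exact_mod_cast le_top)
    rw [h1, iteratedFDeriv_const_smul_apply h2.contDiffAt, norm_smul, Real.norm_of_nonneg hc,
      iteratedFDeriv_comp_add_left]
    simp [hL, sub_eq_add_neg]
  rw [e, L.iteratedFDeriv_comp_right hgs y (by exact_mod_cast le_top)]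
  refine (ContinuousMultilinearMap.norm_compContinuousLinearMap_le _ _).trans ?_
  rw [e2, Finset.prod_const, Finset.card_univ, Fintype.card_fin]
  calc _ ≤ c * ‖iteratedFDeriv ℝ n f (N • (x - y))‖ * N ^ n := by gcongr
    _ = _ := by ring

/-- The backward heat test function of the Littlewood-Paley piece at frequency `N`, based
at `(t, x)`. -/
noncomputable def heatTest (φ : E3 → ℝ) (N t : ℝ) (x : E3) (z : ℝ × E3) : ℝ :=
  N * heatPot φ (N ^ 2 * (t - z.1)) (N • (x - z.2))

theorem abs_pd3_le {f : E3 → ℝ} (hf : ContDiff ℝ ∞ f) (i j k : Fin 3) (x : E3) :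
    |pd k (pd j (pd i f)) x| ≤ ‖iteratedFDeriv ℝ 3 f x‖ := by
  have h1 := norm_iteratedFDeriv_pd_le (contDiff_pd (contDiff_pd hf i) j) k 0 x
  rw [norm_iteratedFDeriv_zero] at h1
  exact h1.trans ((norm_iteratedFDeriv_pd_le (contDiff_pd hf i) j 1 x).trans
    (norm_iteratedFDeriv_pd_le hf i 2 x))

theorem abs_pd2_le {f : E3 → ℝ} (hf : ContDiff ℝ ∞ f) (i j : Fin 3) (x : E3) :
    |pd j (pd i f) x| ≤ ‖iteratedFDeriv ℝ 2 f x‖ := by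
  have h1 := norm_iteratedFDeriv_pd_le (contDiff_pd hf i) j 0 x
  rw [norm_iteratedFDeriv_zero] at h1
  exact h1.trans (norm_iteratedFDeriv_pd_le hf i 1 x)

theorem abs_solField_le {f : E3 → ℝ} (hf : ContDiff ℝ ∞ f) (i j : Fin 3) (x : E3) :
    |solField i j f x| ≤ 4 * ‖iteratedFDeriv ℝ 2 f x‖ := by
  have h0 := norm_nonneg (iteratedFDeriv ℝ 2 f x)
  have h1 : |if i = j then lap f x else 0| ≤ 3 * ‖iteratedFDeriv ℝ 2 f x‖ := by
    split_ifs
    · refine (Finset.abs_sum_le_sum_abs _ _).trans ((Finset.sum_le_sum fun k _ =>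
        abs_pd2_le hf k k x).trans (le_of_eq (by simp)))
    · simp
  have := abs_sub (pd j (pd i f) x) (if i = j then lap f x else 0)
  have := abs_pd2_le hf i j x
  rw [solField]
  linarith

theorem abs_pd_solField_le {f : E3 → ℝ} (hf : ContDiff ℝ ∞ f) (i j k : Fin 3) (x : E3) :
    |pd k (solField i j f) x| ≤ 4 * ‖iteratedFDeriv ℝ 3 f x‖ := by
  have h0 := norm_nonneg (iteratedFDeriv ℝ 3 f x)
  have hl : ContDiff ℝ ∞ (fun x => if i = j then lap f x else 0) := by
    split_ifs
    · exact ContDiff.sum fun k _ => contDiff_pd (contDiff_pd hf k) k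
    · exact contDiff_const
  have e : solField i j f = fun x => pd j (pd i f) x - (fun x => if i = j then lap f x else 0) x :=
    rfl
  have h1 : |pd k (fun x => if i = j then lap f x else 0) x| ≤ 3 * ‖iteratedFDeriv ℝ 3 f x‖ := by
    split_ifs
    · have : lap f = fun x => ∑ l, pd l (pd l f) x := rfl
      show |pd k (lap f) x| ≤ _
      rw [this, pd_sum fun l => contDiff_pd (contDiff_pd hf l) l]
      refine (Finset.abs_sum_le_sum_abs _ _).trans ((Finset.sum_le_sum fun l _ =>
        abs_pd3_le hf l l k x).trans (le_of_eq (by simp)))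
    · simp only [pd, fderiv_fun_const, Pi.zero_apply, _root_.zero_apply, abs_zero]
      positivity
  rw [e, pd_sub (contDiff_pd (contDiff_pd hf i) j) hl]
  have := abs_sub (pd k (pd j (pd i f)) x) (pd k (fun x => if i = j then lap f x else 0) x)
  have := abs_pd3_le hf i j k x
  linarith

namespace IsLittlewoodPaleyBump

variable {φ : E3 → ℝ}

theorem contDiff_heatPot_slice (hφ : IsLittlewoodPaleyBump φ) (s : ℝ) :
    ContDiff ℝ ∞ (heatPot φ s) := contDiff_slice hφ.contDiff_heatPot s

theorem contDiff_heatTest (hφ : IsLittlewoodPaleyBump φ) (N t : ℝ) (x : E3) :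
    ContDiff ℝ ∞ (heatTest φ N t x) := by
  have h1 : ContDiff ℝ ∞ fun z : ℝ × E3 => N ^ 2 * (t - z.1) := by fun_prop
  have h2 : ContDiff ℝ ∞ fun z : ℝ × E3 => N • (x - z.2) := by fun_prop
  have h3 : ContDiff ℝ ∞ ((fun z : ℝ × E3 => heatPot φ z.1 z.2) ∘
    fun z : ℝ × E3 => (N ^ 2 * (t - z.1), N • (x - z.2))) :=
    hφ.contDiff_heatPot.comp (h1.prodMk h2)
  have h4 : heatTest φ N t x = fun z => N * ((fun z : ℝ × E3 => heatPot φ z.1 z.2) ∘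
    fun z : ℝ × E3 => (N ^ 2 * (t - z.1), N • (x - z.2))) z := by
    ext z; simp only [heatTest, Function.comp]
  rw [h4]
  exact contDiff_const.mul h3

theorem lap_heatTest (hφ : IsLittlewoodPaleyBump φ) (N t : ℝ) (x : E3) (s : ℝ) (y : E3) :
    lap (fun y => heatTest φ N t x (s, y)) y =
      N ^ 3 * lap (heatPot φ (N ^ 2 * (t - s))) (N • (x - y)) := by
  have h := hφ.contDiff_heatPot_slice (N ^ 2 * (t - s))
  simp only [lap, heatTest]
  rw [Finset.mul_sum]
  refine Finset.sum_congr rfl fun k _ => ?_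
  rw [pd_comp_affine h, pd_comp_affine (contDiff_pd h k)]
  ring

/-- Parabolic scaling: the factor `N²` from the time variable matches the two spatial derivatives,
and time runs backwards because the heat potential is evaluated at `N²(t - s)`. -/
theorem td_heatTest (hφ : IsLittlewoodPaleyBump φ) (N t : ℝ) (x : E3) (z : ℝ × E3) :
    td (heatTest φ N t x) z = -slap (heatTest φ N t x) z := by
  obtain ⟨s, y⟩ := z
  have h1 := hasDerivAt_td (hφ.contDiff_heatTest N t x) s y
  have h2 : HasDerivAt (fun s => N ^ 2 * (t - s)) (-N ^ 2) s := by
    simpa using ((hasDerivAt_id s).const_sub t).const_mul (N ^ 2)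
  have h3 := ((hφ.hasDerivAt_heatPot (N ^ 2 * (t - s)) (N • (x - y))).comp s h2).const_mul N
  have e := congrFun (lap_slice (hφ.contDiff_heatTest N t x) s) y
  rw [hφ.lap_heatTest] at e
  rw [h1.unique h3, ← e, lap]
  ring

/-- Decay of the test functions, uniformly in all parameters. -/
theorem exists_heatTest_decay (hφ : IsLittlewoodPaleyBump φ) (k n : ℕ) : ∃ C : ℝ, 0 ≤ C ∧
    ∀ N : ℝ, 0 < N → ∀ t s, s ≤ t → ∀ x y,
      ‖iteratedFDeriv ℝ k (fun y => heatTest φ N t x (s, y)) y‖ ≤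
        C * N ^ (k + 1) * Real.exp (-(N ^ 2 * (t - s)) / 32) * wt n (N • (x - y)) := by
  obtain ⟨C, hC, h⟩ := hφ.exists_heatPot_decay k n
  refine ⟨C, hC, fun N hN t s hst x y => ?_⟩
  have h1 := norm_iteratedFDeriv_comp_affine_le (hφ.contDiff_heatPot_slice (N ^ 2 * (t - s)))
    hN.le hN.le x y k
  have h2 := h (N ^ 2 * (t - s)) (mul_nonneg (by positivity) (by linarith)) (N • (x - y))
  have h3 : ‖iteratedFDeriv ℝ k (heatPot φ (N ^ 2 * (t - s))) (N • (x - y))‖ ≤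
      C * Real.exp (-(N ^ 2 * (t - s)) / 32) * wt n (N • (x - y)) := by
    rw [wt, ← div_eq_mul_inv, le_div_iff₀ (by positivity)]
    linarith
  calc _ ≤ _ := h1
    _ ≤ N * N ^ k * (C * Real.exp (-(N ^ 2 * (t - s)) / 32) * wt n (N • (x - y))) := by gcongr
    _ = _ := by ring

theorem exists_derivBound_heatTest (hφ : IsLittlewoodPaleyBump φ) {N : ℝ} (hN : 0 < N) (t : ℝ)
    (x : E3) (m : ℕ) : ∃ C : ℝ, ∀ s ≤ t,
      DerivBound m (fun y => heatTest φ N t x (s, y)) fun y => C * wt 5 y := by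
  choose D hD0 hD using fun k => hφ.exists_heatTest_decay k 5
  set K : ℝ := ((1 + ‖x‖) * (1 + N⁻¹)) ^ 5 with hK
  have hK0 : 0 ≤ K := by positivity
  refine ⟨∑ k ∈ Finset.range (m + 1), D k * N ^ (k + 1) * K, fun s hs =>
    ⟨contDiff_slice (hφ.contDiff_heatTest N t x) s, fun n hn y => ?_⟩⟩
  have h1 := hD n N hN t s hs x y
  have h2 : Real.exp (-(N ^ 2 * (t - s)) / 32) ≤ 1 := by
    apply Real.exp_le_one_iff.2
    have : 0 ≤ N ^ 2 * (t - s) := mul_nonneg (by positivity) (by linarith)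
    linarith
  have h3 := wt_smul_sub_le 5 hN x y
  have h4 := (wt_pos 5 y).le
  have h5 := hD0 n
  calc _ ≤ _ := h1
    _ ≤ D n * N ^ (n + 1) * 1 * (K * wt 5 y) := by
        gcongr
        exact (wt_pos _ _).le
    _ = D n * N ^ (n + 1) * K * wt 5 y := by ring
    _ ≤ _ := by
        refine mul_le_mul_of_nonneg_right ?_ h4
        exact Finset.single_le_sum (f := fun k => D k * N ^ (k + 1) * K)
          (fun k _ => by have := hD0 k; positivity) (Finset.mem_range.2 (by omega))

/-- At the final time the test function is the Newtonian potential of the kernel of `P_N`. Pairing a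
field with its negative Laplacian therefore reproduces the Littlewood-Paley piece. -/
theorem neg_lap_heatTest (hφ : IsLittlewoodPaleyBump φ) {N : ℝ} (hN : 0 < N) (t : ℝ) (x y : E3) :
    -lap (fun y => heatTest φ N t x (t, y)) y = lpKernel φ N (x - y) - lpKernel φ (N / 2) (x - y) := by
  rw [hφ.lap_heatTest, sub_self, mul_zero]
  have h := hφ.neg_sum_pd_pd_heatPot (N • (x - y))
  rw [hφ.lpKernel_smul hN, hφ.lpKernel_smul (half_pos hN), lap]
  rw [hφ.lpKernel_smul (by norm_num : (0 : ℝ) < 1 / 2)] at h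
  have e : (1 / 2 : ℝ) • N • (x - y) = (N / 2) • (x - y) := by rw [smul_smul]; ring_nf
  rw [e] at h
  linear_combination N ^ 3 * h

theorem integrable_lpKernel_smul (hφ : IsLittlewoodPaleyBump φ) {N : ℝ} (hN : 0 < N) (x : E3)
    {v : E3 → E3} (hv : Continuous v) (hL : Integrable fun y => ‖v y‖ ^ 2 * wt 5 y) :
    Integrable fun y => lpKernel φ N (x - y) • v y := by
  obtain ⟨C, hC, h⟩ := hφ.exists_lpKernel_decay 5
  refine ((integrable_norm_mul_wt hv hL).const_mul
    (C * N ^ 3 * ((1 + ‖x‖) * (1 + N⁻¹)) ^ 5)).mono' ?_ (Filter.Eventually.of_forall fun y => ?_)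
  · have := hφ.continuous_lpKernel hN
    have : Continuous fun y => lpKernel φ N (x - y) • v y := by fun_prop
    exact this.aestronglyMeasurable
  · have h1 := h N hN (x - y)
    have h2 := wt_smul_sub_le 5 hN x y
    have h3 : |lpKernel φ N (x - y)| ≤ C * N ^ 3 * wt 5 (N • (x - y)) := by
      rw [wt, ← div_eq_mul_inv, le_div_iff₀ (by positivity), norm_smul, Real.norm_of_nonneg hN.le]
      linarith
    rw [norm_smul, Real.norm_eq_abs]
    calc |lpKernel φ N (x - y)| * ‖v y‖ ≤ C * N ^ 3 * wt 5 (N • (x - y)) * ‖v y‖ := by gcongr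
      _ ≤ C * N ^ 3 * (((1 + ‖x‖) * (1 + N⁻¹)) ^ 5 * wt 5 y) * ‖v y‖ := by gcongr
      _ = _ := by ring

theorem lpProj_component (hφ : IsLittlewoodPaleyBump φ) {N : ℝ} (hN : 0 < N) (t : ℝ) (x : E3)
    {v : E3 → E3} (hv : Continuous v) (hL : Integrable fun y => ‖v y‖ ^ 2 * wt 5 y) (i : Fin 3) :
    lpProj φ N v x i = ∫ y, v y i * -lap (fun y => heatTest φ N t x (t, y)) y := by
  have h1 := hφ.integrable_lpKernel_smul hN x hv hL
  have h2 := hφ.integrable_lpKernel_smul (half_pos hN) x hv hL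
  rw [lpProj, lpLow, lpLow, ← integral_sub h1 h2]
  have h3 : ∫ y, (lpKernel φ N (x - y) • v y - lpKernel φ (N / 2) (x - y) • v y) i =
      (∫ y, (lpKernel φ N (x - y) • v y - lpKernel φ (N / 2) (x - y) • v y)) i :=
    (EuclideanSpace.proj i : E3 →L[ℝ] ℝ).integral_comp_comm (h1.sub h2)
  rw [← h3]
  congr 1
  ext y
  rw [hφ.neg_lap_heatTest hN]
  simp
  ring

end IsLittlewoodPaleyBump

theorem enorm_le_sum_component (v : E3) : ‖v‖ₑ ≤ ∑ i, ‖v i‖ₑ := by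
  have hv : v = ∑ k, v k • EuclideanSpace.single k (1 : ℝ) := by
    ext l; simp [Finset.sum_apply, Pi.single_apply]
  conv_lhs => rw [hv]
  refine (enorm_sum_le _ _).trans (Finset.sum_le_sum fun i _ => ?_)
  rw [enorm_smul, ← ofReal_norm (EuclideanSpace.single i (1 : ℝ)), PiLp.norm_single]
  simp

/-- The Duhamel estimate for Littlewood-Paley projections of classical solutions. -/
theorem exists_duhamel_estimate {φ : E3 → ℝ} (hφ : IsLittlewoodPaleyBump φ) (n : ℕ) :
    ∃ C : ℝ, 0 ≤ C ∧ ∀ (a b M : ℝ) (u : ℝ → E3 → E3), IsClassicalNavierStokes a b u →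
      WeightedL2 a b M u → ∀ N : ℝ, 0 < N → ∀ t σ : ℝ, 0 < σ → a ≤ t - σ → t ≤ b → ∀ x : E3,
      ‖lpProj φ N (u t) x‖ₑ ≤ ENNReal.ofReal (C * N ^ 3 * Real.exp (-(N ^ 2 * σ) / 32)) *
          (∫⁻ y, ENNReal.ofReal (wt n (N • (x - y))) * ‖u (t - σ) y‖ₑ) +
        ∫⁻ s in Ioc (t - σ) t, ENNReal.ofReal (C * N ^ 4 * Real.exp (-(N ^ 2 * (t - s)) / 32)) *
          ∫⁻ y, ENNReal.ofReal (wt n (N • (x - y))) * ‖u s y‖ₑ ^ 2 := by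
  obtain ⟨C₂, hC₂, h₂⟩ := hφ.exists_heatTest_decay 2 n
  obtain ⟨C₃, hC₃, h₃⟩ := hφ.exists_heatTest_decay 3 n
  -- Each component costs `12 C₂ = 3·4 C₂` in the linear term (three components of `u`, four second
  -- derivatives) and `36 C₃ = 9·4 C₃` in the quadratic term. Summing over three components triples
  -- both, and one constant dominates the two.
  set C : ℝ := 36 * C₂ + 108 * C₃ with hC
  have hC0 : 0 ≤ C := by positivity
  refine ⟨C, hC0, fun a b M u hu hM N hN t σ hσ ha hb x => ?_⟩
  set G := heatTest φ N t x with hG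
  have hGs : ContDiff ℝ ∞ G := hφ.contDiff_heatTest N t x
  obtain ⟨D, hD⟩ := hφ.exists_derivBound_heatTest hN t x 4
  have ht : t ∈ Icc a b := ⟨by linarith, hb⟩
  have ht' : t - σ ∈ Icc a b := ⟨ha, by linarith⟩
  have hcomp : ∀ i, ‖lpProj φ N (u t) x i‖ₑ ≤
      ENNReal.ofReal (12 * C₂ * N ^ 3 * Real.exp (-(N ^ 2 * σ) / 32)) *
          (∫⁻ y, ENNReal.ofReal (wt n (N • (x - y))) * ‖u (t - σ) y‖ₑ) +
        ∫⁻ s in Ioc (t - σ) t, ENNReal.ofReal (36 * C₃ * N ^ 4 * Real.exp (-(N ^ 2 * (t - s)) / 32)) *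
          ∫⁻ y, ENNReal.ofReal (wt n (N • (x - y))) * ‖u s y‖ₑ ^ 2 := by
    intro i
    have hw := hu.weak_form_heat hM ha (by linarith : t - σ < t) hb hGs
      (hφ.td_heatTest N t x) (fun s hs => hD s hs.2) i
    -- Since `u(t)` is divergence free, the gradient part of the test field drops out at the final
    -- time, leaving the pairing with `-ΔG`, that is, the piece `P_N u(t)`.
    have hsol := integral_sum_mul_solField (f := fun y => G (t, y)) (hu.contDiff_slice ht)
      (hu.2.1 t ht) (hM t ht).1 ((hD t le_rfl).mono (by norm_num)) i
    have hl : lpProj φ N (u t) x i = ∫ y, u t y i * -lap (fun y => G (t, y)) y :=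
      hφ.lpProj_component hN t x (hu.contDiff_slice ht).continuous (hM t ht).1 i
    rw [← hl] at hsol
    simp_rw [solField_slice hGs] at hsol
    rw [hsol, sub_eq_iff_eq_add'] at hw
    rw [hw]
    refine (enorm_add_le _ _).trans (add_le_add ?_ ?_)
    · refine (enorm_integral_le_lintegral_enorm _).trans ?_
      rw [← lintegral_const_mul' _ _ ENNReal.ofReal_ne_top]
      refine lintegral_mono fun y => ?_
      have hb1 : ∀ j, |ssol i j G (t - σ, y)| ≤
          4 * (C₂ * N ^ 3 * Real.exp (-(N ^ 2 * σ) / 32) * wt n (N • (x - y))) := by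
        intro j
        have h := abs_solField_le (contDiff_slice hGs (t - σ)) i j y
        rw [solField_slice hGs] at h
        refine h.trans ?_
        have := h₂ N hN t (t - σ) (by linarith) x y
        rw [sub_sub_cancel] at this
        linarith
      have h := abs_sum_component_mul_le (u (t - σ) y) hb1
      rw [← ofReal_norm, ← ofReal_norm, ← ENNReal.ofReal_mul (wt_pos _ _).le,
        ← ENNReal.ofReal_mul (by positivity)]
      refine ENNReal.ofReal_le_ofReal (h.trans (le_of_eq ?_))
      ring
    · rw [intervalIntegral.integral_of_le (by linarith)]
      refine (enorm_integral_le_lintegral_enorm _).trans ?_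
      refine setLIntegral_mono' measurableSet_Ioc fun s hs => ?_
      refine (enorm_integral_le_lintegral_enorm _).trans ?_
      rw [← lintegral_const_mul' _ _ ENNReal.ofReal_ne_top]
      refine lintegral_mono fun y => ?_
      have hb2 : ∀ j k, |sd k (ssol i j G) (s, y)| ≤
          4 * (C₃ * N ^ 4 * Real.exp (-(N ^ 2 * (t - s)) / 32) * wt n (N • (x - y))) := by
        intro j k
        have h := abs_pd_solField_le (contDiff_slice hGs s) i j k y
        rw [solField_slice hGs, pd_slice (contDiff_ssol hGs i j)] at h
        refine h.trans ?_
        have := h₃ N hN t s hs.2 x y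
        linarith
      have h := abs_sum_sum_component_mul_le (u s y) hb2
      rw [← ofReal_norm, ← ofReal_norm, ← ENNReal.ofReal_pow (norm_nonneg _),
        ← ENNReal.ofReal_mul (wt_pos _ _).le, ← ENNReal.ofReal_mul (by positivity)]
      refine ENNReal.ofReal_le_ofReal (h.trans (le_of_eq ?_))
      ring
  refine (enorm_le_sum_component _).trans ((Finset.sum_le_sum fun i _ => hcomp i).trans ?_)
  rw [Finset.sum_const, Finset.card_univ, Fintype.card_fin, nsmul_add]
  refine add_le_add ?_ ?_
  · rw [nsmul_eq_mul, ← mul_assoc]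
    refine mul_le_mul_left ?_ _
    rw [← ENNReal.ofReal_natCast, ← ENNReal.ofReal_mul (by positivity)]
    refine ENNReal.ofReal_le_ofReal ?_
    have : 0 ≤ 108 * C₃ * N ^ 3 * Real.exp (-(N ^ 2 * σ) / 32) := by positivity
    rw [hC]
    push_cast
    nlinarith
  · rw [nsmul_eq_mul, ← lintegral_const_mul' _ _ (by simp)]
    refine lintegral_mono fun s => ?_
    rw [← mul_assoc]
    refine mul_le_mul_left ?_ _
    rw [← ENNReal.ofReal_natCast, ← ENNReal.ofReal_mul (by positivity)]
    refine ENNReal.ofReal_le_ofReal ?_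
    have : 0 ≤ 36 * C₂ * N ^ 4 * Real.exp (-(N ^ 2 * (t - s)) / 32) := by positivity
    rw [hC]
    push_cast
    nlinarith

/-! ### The weighted norm at every time -/

theorem continuous_axialDist : Continuous axialDist := by
  unfold axialDist; fun_prop

theorem axialDist_nonneg (x : E3) : 0 ≤ axialDist x := Real.sqrt_nonneg _

/-- The axis lies in the hyperplane where the first coordinate vanishes. It may be ignored in all
integrals, so the singular or degenerate weight there is immaterial. -/
theorem volume_axis : volume {x : E3 | axialDist x = 0} = 0 := by
  have h : {x : E3 | axialDist x = 0} ⊆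
      ((EuclideanSpace.proj 0 : E3 →L[ℝ] ℝ).toLinearMap.ker : Set E3) := by
    intro x hx
    have hx' : x 0 ^ 2 + x 1 ^ 2 = 0 := by
      have : Real.sqrt (x 0 ^ 2 + x 1 ^ 2) = 0 := hx
      rwa [Real.sqrt_eq_zero (by positivity)] at this
    have h0 : x 0 = 0 := by nlinarith [sq_nonneg (x 0), sq_nonneg (x 1)]
    exact h0
  refine measure_mono_null h (Measure.addHaar_submodule volume _ fun htop => ?_)
  have h1 : EuclideanSpace.single (0 : Fin 3) (1 : ℝ) ∈
      (EuclideanSpace.proj 0 : E3 →L[ℝ] ℝ).toLinearMap.ker := by rw [htop]; trivial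
  have h2 : (EuclideanSpace.single (0 : Fin 3) (1 : ℝ) : E3) 0 = 0 := h1
  simp at h2

theorem ae_axialDist_pos : ∀ᵐ x : E3, 0 < axialDist x := by
  have : ∀ᵐ x : E3, ¬ axialDist x = 0 := by
    rw [ae_iff]
    simpa using volume_axis
  filter_upwards [this] with x hx
  exact lt_of_le_of_ne (axialDist_nonneg x) (Ne.symm hx)

theorem aestronglyMeasurable_weighted (α : ℝ) {v : E3 → E3} (hv : Continuous v) :
    AEStronglyMeasurable (fun x : E3 => axialDist x ^ α • v x) volume :=
  ((continuous_axialDist.measurable.pow_const α).smul hv.measurable).aestronglyMeasurable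

/-- The weighted norm controls the field at every time of the slab. -/
theorem IsClassicalNavierStokes.eLpNorm_le {a b q α : ℝ} {u : ℝ → E3 → E3} (hab : a < b)
    (hu : IsClassicalNavierStokes a b u) {A : ENNReal} (h : weightedNorm q α a b u ≤ A)
    {t : ℝ} (ht : t ∈ Icc a b) :
    eLpNorm (fun x : E3 => axialDist x ^ α • u t x) (ENNReal.ofReal q) volume ≤ A := by
  have hae : ∀ᵐ s ∂volume.restrict (Icc a b),
      eLpNorm (fun x : E3 => axialDist x ^ α • u s x) (ENNReal.ofReal q) volume ≤ A := by
    filter_upwards [ENNReal.ae_le_essSup (μ := volume.restrict (Icc a b)) fun s =>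
      eLpNorm (fun x : E3 => axialDist x ^ α • u s x) (ENNReal.ofReal q) volume] with s hs
    exact hs.trans h
  rw [ae_restrict_iff' measurableSet_Icc] at hae
  -- Times with the bound have full measure in the slab, hence are dense. The maximum and minimum
  -- make the window one-sided when `t` is an end time.
  have hex : ∀ n : ℕ, ∃ s ∈ Icc a b, |s - t| < 1 / ((n : ℝ) + 1) ∧
      eLpNorm (fun x : E3 => axialDist x ^ α • u s x) (ENNReal.ofReal q) volume ≤ A := by
    intro n
    set ε : ℝ := 1 / ((n : ℝ) + 1) with hε
    have hε0 : 0 < ε := by positivity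
    have hlt : max a (t - ε) < min b (t + ε) := by
      simp only [max_lt_iff, lt_min_iff]
      exact ⟨⟨hab, by linarith [ht.1, ht.2]⟩, by linarith [ht.1, ht.2], by linarith⟩
    have hpos : 0 < volume (Ioo (max a (t - ε)) (min b (t + ε))) := by
      rw [Real.volume_Ioo]
      exact ENNReal.ofReal_pos.2 (by linarith)
    by_contra hcon
    push Not at hcon
    refine hpos.ne' (measure_mono_null ?_ (ae_iff.1 hae))
    intro s hs
    have h1 := lt_of_le_of_lt (le_max_left _ _) hs.1
    have h2 := lt_of_le_of_lt (le_max_right _ _) hs.1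
    have h3 := lt_of_lt_of_le hs.2 (min_le_left _ _)
    have h4 := lt_of_lt_of_le hs.2 (min_le_right _ _)
    have h5 := hcon s ⟨h1.le, h3.le⟩ (abs_lt.2 ⟨by linarith, by linarith⟩)
    exact fun hh => absurd (hh ⟨h1.le, h3.le⟩) (not_le.2 h5)
  choose s hs hst hsA using hex
  have hlim : Filter.Tendsto s Filter.atTop (nhds t) := by
    rw [tendsto_iff_norm_sub_tendsto_zero]
    exact squeeze_zero (fun n => norm_nonneg _) (fun n => (hst n).le)
      tendsto_one_div_add_atTop_nhds_zero_nat
  have hlim' : Filter.Tendsto s Filter.atTop (nhdsWithin t (Icc a b)) :=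
    tendsto_nhdsWithin_iff.2 ⟨hlim, Filter.Eventually.of_forall hs⟩
  -- Continuity in time gives pointwise convergence along these times, and Fatou's lemma passes the
  -- bound to `t`.
  have h1 := Lp.eLpNorm_lim_le_liminf_eLpNorm (p := ENNReal.ofReal q) (μ := (volume : Measure E3))
    (f := fun n x => axialDist x ^ α • u (s n) x)
    (fun n => aestronglyMeasurable_weighted α (hu.contDiff_slice (hs n)).continuous)
    (fun x => axialDist x ^ α • u t x) (Filter.Eventually.of_forall fun x => by
      refine Filter.Tendsto.const_smul ?_ _
      exact (hu.hasDerivWithinAt ht x).continuousWithinAt.tendsto.comp hlim')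
  refine h1.trans (Filter.liminf_le_of_frequently_le'
    (Filter.Frequently.of_forall hsA))

theorem lintegral_weighted_le {q α A : ℝ} (hq : 0 < q) {v : E3 → E3}
    (h : eLpNorm (fun x : E3 => axialDist x ^ α • v x) (ENNReal.ofReal q) volume ≤
      ENNReal.ofReal A) :
    ∫⁻ x, ‖axialDist x ^ α • v x‖ₑ ^ q ≤ ENNReal.ofReal A ^ q := by
  rw [eLpNorm_eq_lintegral_rpow_enorm_toReal (by simpa using hq) ENNReal.ofReal_ne_top,
    ENNReal.toReal_ofReal hq.le, one_div] at h
  exact (ENNReal.rpow_inv_le_iff hq).1 h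

theorem enorm_eq_weighted {α : ℝ} {v : E3 → E3} {x : E3} (hx : 0 < axialDist x) :
    ‖v x‖ₑ = ENNReal.ofReal (axialDist x ^ (-α)) * ‖axialDist x ^ α • v x‖ₑ := by
  rw [enorm_smul, ← mul_assoc, Real.enorm_eq_ofReal (by positivity),
    ← ENNReal.ofReal_mul (by positivity), ← Real.rpow_add hx]
  simp

/-! ### Integrability of negative powers of the distance to the axis -/

theorem abs_coord_le_axialDist (y : E3) : |y 0| ≤ axialDist y ∧ |y 1| ≤ axialDist y := by
  constructor
  · exact Real.abs_le_sqrt (by nlinarith [sq_nonneg (y 1)])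
  · exact Real.abs_le_sqrt (by nlinarith [sq_nonneg (y 0)])

/-- The set lies in a box with sides `2ρ`, `2ρ`, `2R`, wherever the centre of the ball is. -/
theorem volume_ball_inter_tube_le (x : E3) {R ρ : ℝ} (hR : 0 < R) (hρ : 0 < ρ) :
    volume (Metric.ball x R ∩ {y | axialDist y < ρ}) ≤ ENNReal.ofReal (8 * ρ ^ 2 * R) := by
  set I : Fin 3 → Set ℝ := ![Icc (-ρ) ρ, Icc (-ρ) ρ, Icc (x 2 - R) (x 2 + R)] with hI
  have hsub : Metric.ball x R ∩ {y | axialDist y < ρ} ⊆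
      (MeasurableEquiv.toLp 2 (Fin 3 → ℝ)).symm ⁻¹' univ.pi I := by
    rintro y ⟨hy, hr⟩
    have hr' : axialDist y < ρ := hr
    have h0 := abs_le.1 ((abs_coord_le_axialDist y).1.trans hr'.le)
    have h1 := abs_le.1 ((abs_coord_le_axialDist y).2.trans hr'.le)
    have h2 : |y 2 - x 2| ≤ R := by
      have := abs_component_le (y - x) 2
      rw [Metric.mem_ball, dist_eq_norm] at hy
      simpa using this.trans hy.le
    have h2' := abs_le.1 h2
    intro i _
    fin_cases i
    · exact h0
    · exact h1
    · have h3 : y 2 ∈ Icc (x 2 - R) (x 2 + R) := ⟨by linarith [h2'.1], by linarith [h2'.2]⟩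
      exact h3
  refine (measure_mono hsub).trans ?_
  have hIm : ∀ i, MeasurableSet (I i) := by
    intro i; fin_cases i <;> exact measurableSet_Icc
  rw [(EuclideanSpace.volume_preserving_symm_measurableEquiv_toLp (Fin 3)).measure_preimage
    (MeasurableSet.univ_pi hIm).nullMeasurableSet, volume_pi_pi, Fin.prod_univ_three]
  simp only [hI, Matrix.cons_val_zero, Matrix.cons_val_one, Matrix.cons_val, Real.volume_Icc]
  rw [← ENNReal.ofReal_mul (by linarith), ← ENNReal.ofReal_mul (by nlinarith)]
  refine ENNReal.ofReal_le_ofReal (le_of_eq ?_)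
  ring

/-- Negative powers of the distance to the axis are integrable on balls, with the scaling
bound. -/
theorem exists_lintegral_axialDist_le {b : ℝ} (hb : 0 < b) (hb2 : b < 2) : ∃ C : ℝ, 0 ≤ C ∧
    ∀ (x : E3) (R : ℝ), 0 < R →
      ∫⁻ y in Metric.ball x R, ENNReal.ofReal (axialDist y ^ (-b)) ≤
        ENNReal.ofReal (C * R ^ (3 - b)) := by
  -- The ratio of the dyadic series over tubes of radius `2⁻ᵏR`: the volume shrinks by `4` while the
  -- integrand grows by `2 ^ b`. Convergence is exactly the condition `b < 2`.
  have hθ0 : (0 : ℝ) < 2 ^ b / 4 := by positivity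
  have hθ1 : (2 : ℝ) ^ b / 4 < 1 := by
    rw [div_lt_one (by norm_num)]
    calc (2 : ℝ) ^ b < 2 ^ (2 : ℝ) := Real.rpow_lt_rpow_of_exponent_lt (by norm_num) hb2
      _ = 4 := by norm_num
  set V : ℝ := (volume (Metric.ball (0 : E3) 1)).toReal with hV
  have hVt : volume (Metric.ball (0 : E3) 1) = ENNReal.ofReal V :=
    (ENNReal.ofReal_toReal measure_ball_lt_top.ne).symm
  have hV0 : 0 ≤ V := ENNReal.toReal_nonneg
  refine ⟨V + 8 * 2 ^ b * (1 - 2 ^ b / 4)⁻¹, ?_, fun x R hR => ?_⟩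
  · have : 0 < 1 - (2 : ℝ) ^ b / 4 := by linarith
    positivity
  have hpt : ∀ y : E3, ENNReal.ofReal (axialDist y ^ (-b)) ≤ ENNReal.ofReal (R ^ (-b)) +
      ∑' k : ℕ, {y | axialDist y < (1 / 2) ^ k * R}.indicator
        (fun _ => ENNReal.ofReal (((1 / 2) ^ (k + 1) * R) ^ (-b))) y := by
    intro y
    rcases eq_or_lt_of_le (axialDist_nonneg y) with h0 | h0
    -- On the axis the negative power has the default value zero, so the bound is trivial there.
    · rw [← h0, Real.zero_rpow (by linarith)]; simp
    rcases le_or_gt R (axialDist y) with h1 | h1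
    · refine le_add_right (ENNReal.ofReal_le_ofReal ?_)
      exact Real.rpow_le_rpow_of_nonpos hR h1 (by linarith)
    · obtain ⟨k, hk1, hk2⟩ := exists_nat_pow_near_of_lt_one (x := axialDist y / R)
        (y := (1 / 2 : ℝ)) (by positivity) (by rw [div_le_one hR]; exact h1.le) (by norm_num)
        (by norm_num)
      rw [lt_div_iff₀ hR] at hk1
      -- The tubes are open, so a point at distance exactly `2⁻ᵏR` is assigned to the next larger
      -- tube. For `k = 0` this would mean distance `R`, which has been excluded.
      rcases eq_or_lt_of_le hk2 with hk3 | hk3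
      · rcases k with _ | k
        · rw [pow_zero, div_eq_one_iff_eq hR.ne'] at hk3; linarith
        · rw [div_eq_iff hR.ne'] at hk3
          refine le_add_left (le_trans ?_ (ENNReal.le_tsum k))
          rw [indicator_of_mem]
          · rw [hk3]
          · show axialDist y < _
            rw [hk3, pow_succ]
            have : (0 : ℝ) < (1 / 2) ^ k * R := by positivity
            linarith
      · rw [div_lt_iff₀ hR] at hk3
        refine le_add_left (le_trans ?_ (ENNReal.le_tsum k))
        rw [indicator_of_mem (show y ∈ {y | axialDist y < (1 / 2) ^ k * R} from hk3)]
        exact ENNReal.ofReal_le_ofReal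
          (Real.rpow_le_rpow_of_nonpos (by positivity) hk1.le (by linarith))
  have hmeas : ∀ ρ : ℝ, MeasurableSet {y : E3 | axialDist y < ρ} := fun ρ =>
    measurableSet_lt continuous_axialDist.measurable measurable_const
  have hterm : ∀ k : ℕ, ∫⁻ y in Metric.ball x R, {y | axialDist y < (1 / 2) ^ k * R}.indicator
      (fun _ => ENNReal.ofReal (((1 / 2) ^ (k + 1) * R) ^ (-b))) y ≤
      ENNReal.ofReal (8 * 2 ^ b * R ^ (3 - b)) * ENNReal.ofReal (2 ^ b / 4) ^ k := by
    intro k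
    rw [lintegral_indicator (hmeas _), Measure.restrict_restrict (hmeas _), setLIntegral_const,
      inter_comm]
    refine (mul_le_mul_right (volume_ball_inter_tube_le x hR
      (by positivity : 0 < (1 / 2 : ℝ) ^ k * R)) _).trans ?_
    rw [← ENNReal.ofReal_pow hθ0.le, ← ENNReal.ofReal_mul (by positivity),
      ← ENNReal.ofReal_mul (by positivity)]
    refine ENNReal.ofReal_le_ofReal (le_of_eq ?_)
    rw [Real.mul_rpow (by positivity) hR.le, Real.rpow_sub hR, Real.rpow_neg hR.le,
      ← Real.rpow_natCast_mul (by norm_num)]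
    have e1 : ((1 : ℝ) / 2) ^ (((k + 1 : ℕ) : ℝ) * -b) = (2 ^ b) ^ (k + 1) := by
      rw [one_div, Real.inv_rpow (by norm_num), ← Real.rpow_neg (by norm_num),
        ← Real.rpow_natCast, ← Real.rpow_mul (by norm_num)]
      congr 1; ring
    rw [e1, pow_succ, div_pow, div_pow, one_pow]
    have e2 : (4 : ℝ) ^ k = (2 ^ k) ^ 2 := by rw [← pow_mul, mul_comm, pow_mul]; norm_num
    have e3 : R ^ (3 : ℝ) = R ^ 3 := by exact_mod_cast Real.rpow_natCast R 3
    have e4 : 0 < R ^ b := by positivity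
    rw [e2, e3]
    field_simp
  have hball : volume (Metric.ball x R) = ENNReal.ofReal (R ^ 3) * ENNReal.ofReal V := by
    rw [Measure.addHaar_ball _ _ hR.le, finrank_euclideanSpace, Fintype.card_fin, hVt]
  calc ∫⁻ y in Metric.ball x R, ENNReal.ofReal (axialDist y ^ (-b))
      ≤ ∫⁻ y in Metric.ball x R, (ENNReal.ofReal (R ^ (-b)) +
        ∑' k : ℕ, {y | axialDist y < (1 / 2) ^ k * R}.indicator
          (fun _ => ENNReal.ofReal (((1 / 2) ^ (k + 1) * R) ^ (-b))) y) := lintegral_mono hpt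
    _ = ENNReal.ofReal (R ^ (-b)) * volume (Metric.ball x R) +
        ∑' k : ℕ, ∫⁻ y in Metric.ball x R, {y | axialDist y < (1 / 2) ^ k * R}.indicator
          (fun _ => ENNReal.ofReal (((1 / 2) ^ (k + 1) * R) ^ (-b))) y := by
        rw [lintegral_add_left measurable_const, setLIntegral_const, lintegral_tsum]
        exact fun k => (measurable_const.indicator (hmeas _)).aemeasurable
    _ ≤ ENNReal.ofReal (V * R ^ (3 - b)) +
        ∑' k : ℕ, ENNReal.ofReal (8 * 2 ^ b * R ^ (3 - b)) * ENNReal.ofReal (2 ^ b / 4) ^ k := by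
        refine add_le_add (le_of_eq ?_) (ENNReal.tsum_le_tsum hterm)
        rw [hball, ← ENNReal.ofReal_mul (by positivity), ← ENNReal.ofReal_mul (by positivity)]
        congr 1
        have e3 : R ^ (3 : ℝ) = R ^ 3 := by exact_mod_cast Real.rpow_natCast R 3
        rw [Real.rpow_sub hR, Real.rpow_neg hR.le, e3]
        ring
    _ = ENNReal.ofReal ((V + 8 * 2 ^ b * (1 - 2 ^ b / 4)⁻¹) * R ^ (3 - b)) := by
        have : 0 < 1 - (2 : ℝ) ^ b / 4 := by linarith
        rw [ENNReal.tsum_mul_left, ENNReal.tsum_geometric, ← ENNReal.ofReal_one,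
          ← ENNReal.ofReal_sub _ hθ0.le, ← ENNReal.ofReal_inv_of_pos this,
          ← ENNReal.ofReal_mul (by positivity), ← ENNReal.ofReal_add (by positivity) (by positivity)]
        congr 1
        ring

/-! ### Axisymmetric fields and rotations -/

/-- The rotation by the angle `θ` about the `x₃`-axis. -/
noncomputable def axialRotation (θ : ℝ) : E3 ≃ₗᵢ[ℝ] E3 :=
  LinearIsometry.toLinearIsometryEquiv
    { toFun := fun y => !₂[Real.cos θ * y 0 - Real.sin θ * y 1,
        Real.sin θ * y 0 + Real.cos θ * y 1, y 2]
      map_add' := fun x y => by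
        ext i; fin_cases i <;> simp <;> ring
      map_smul' := fun c y => by
        ext i; fin_cases i <;> simp <;> ring
      norm_map' := fun y => by
        rw [EuclideanSpace.norm_eq, EuclideanSpace.norm_eq]
        congr 1
        simp only [Fin.sum_univ_three, Real.norm_eq_abs, sq_abs]
        simp
        linear_combination (y 0 ^ 2 + y 1 ^ 2) * Real.sin_sq_add_cos_sq θ } rfl

@[simp] theorem axialRotation_zero_coord (θ : ℝ) (y : E3) :
    axialRotation θ y 0 = Real.cos θ * y 0 - Real.sin θ * y 1 := rfl

@[simp] theorem axialRotation_one_coord (θ : ℝ) (y : E3) :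
    axialRotation θ y 1 = Real.sin θ * y 0 + Real.cos θ * y 1 := rfl

@[simp] theorem axialRotation_two_coord (θ : ℝ) (y : E3) : axialRotation θ y 2 = y 2 := rfl

theorem axialRotation_zero (y : E3) : axialRotation 0 y = y := by
  ext i; fin_cases i <;> simp

theorem axialDist_axialRotation (θ : ℝ) (y : E3) :
    axialDist (axialRotation θ y) = axialDist y := by
  unfold axialDist
  congr 1
  simp only [axialRotation_zero_coord, axialRotation_one_coord]
  linear_combination (y 0 ^ 2 + y 1 ^ 2) * Real.sin_sq_add_cos_sq θ

theorem hasDerivAt_axialRotation (θ : ℝ) (y : E3) :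
    HasDerivAt (fun θ => axialRotation θ y) (rotDir (axialRotation θ y)) θ := by
  rw [hasDerivAt_iff_hasFDerivAt, ← hasFDerivWithinAt_univ, hasFDerivWithinAt_euclidean]
  have hc := (Real.hasDerivAt_cos θ)
  have hs := (Real.hasDerivAt_sin θ)
  intro i
  rw [hasFDerivWithinAt_univ, hasFDerivAt_iff_hasDerivAt]
  fin_cases i
  · refine ((hc.mul_const (y 0)).sub (hs.mul_const (y 1))).congr_deriv ?_
    simp [rotDir]; ring
  · refine ((hs.mul_const (y 0)).add (hc.mul_const (y 1))).congr_deriv ?_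
    simp [rotDir]; ring
  · refine (hasDerivAt_const θ (y 2)).congr_deriv ?_
    simp [rotDir]

/-- Orbits of the rotation group are integral curves of `rotDir` and stay away from the axis, so the
derivative along them vanishes throughout. -/
theorem IsAxisymmetricScalar.comp_axialRotation {f : E3 → ℝ} (hf : IsAxisymmetricScalar f)
    (hd : ∀ x, axialDist x ≠ 0 → DifferentiableAt ℝ f x) {y : E3} (hy : axialDist y ≠ 0) (θ : ℝ) :
    f (axialRotation θ y) = f y := by
  have h1 : ∀ θ, HasDerivAt (fun θ => f (axialRotation θ y)) 0 θ := by
    intro θ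
    have h2 : axialDist (axialRotation θ y) ≠ 0 := by rwa [axialDist_axialRotation]
    have h3 := (hd _ h2).hasFDerivAt.comp_hasDerivAt θ (hasDerivAt_axialRotation θ y)
    rwa [hf _ h2] at h3
  have := is_const_of_deriv_eq_zero (fun θ => (h1 θ).differentiableAt) (fun θ => (h1 θ).deriv) θ 0
  simpa only [axialRotation_zero] using this

theorem differentiableAt_axialDist {x : E3} (hx : axialDist x ≠ 0) :
    DifferentiableAt ℝ axialDist x := by
  have h : x 0 ^ 2 + x 1 ^ 2 ≠ 0 := fun h => hx (by rw [axialDist, h, Real.sqrt_zero])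
  unfold axialDist
  exact DifferentiableAt.sqrt (by fun_prop) h

/-- Off the axis the cylindrical frame is orthonormal, so `|v|²` is the sum of the squares of the
three invariant components. Only the norm is needed for the Morrey bound. -/
theorem IsAxisymmetric.norm_axialRotation {v : E3 → E3} (hv : IsAxisymmetric v)
    (hd : Differentiable ℝ v) {y : E3} (hy : axialDist y ≠ 0) (θ : ℝ) :
    ‖v (axialRotation θ y)‖ = ‖v y‖ := by
  have hc : ∀ (i : Fin 3) x, DifferentiableAt ℝ (fun x => v x i) x := fun i x =>
    ((EuclideanSpace.proj i : E3 →L[ℝ] ℝ).differentiableAt).comp x (hd x)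
  have hp : ∀ (i : Fin 3) x, DifferentiableAt ℝ (fun x : E3 => x i) x := fun i x =>
    (EuclideanSpace.proj i : E3 →L[ℝ] ℝ).differentiableAt
  obtain ⟨h1, h2, h3⟩ := hv
  have e1 := h1.comp_axialRotation (fun x hx => by
    simp only [div_eq_mul_inv]
    exact (((hp 0 x).fun_mul (hc 0 x)).fun_add ((hp 1 x).fun_mul (hc 1 x))).fun_mul
      ((differentiableAt_axialDist hx).fun_inv hx)) hy θ
  have e2 := h2.comp_axialRotation (fun x hx => by
    simp only [div_eq_mul_inv]
    exact (((hp 1 x).fun_neg.fun_mul (hc 0 x)).fun_add ((hp 0 x).fun_mul (hc 1 x))).fun_mul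
      ((differentiableAt_axialDist hx).fun_inv hx)) hy θ
  have e3 := h3.comp_axialRotation (fun x hx => hc 2 x) hy θ
  have key : ∀ z : E3, axialDist z ≠ 0 → ‖v z‖ ^ 2 =
      ((z 0 * v z 0 + z 1 * v z 1) / axialDist z) ^ 2 +
      ((-z 1 * v z 0 + z 0 * v z 1) / axialDist z) ^ 2 + v z 2 ^ 2 := by
    intro z hz
    have hz2 : axialDist z ^ 2 = z 0 ^ 2 + z 1 ^ 2 := Real.sq_sqrt (by positivity)
    have hz3 : z 0 ^ 2 + z 1 ^ 2 ≠ 0 := by rw [← hz2]; exact pow_ne_zero _ hz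
    rw [EuclideanSpace.norm_sq_eq, Fin.sum_univ_three, div_pow, div_pow, hz2]
    simp only [Real.norm_eq_abs, sq_abs]
    field_simp
    ring
  have h4 : ‖v (axialRotation θ y)‖ ^ 2 = ‖v y‖ ^ 2 := by
    rw [key _ hy, key _ (by rwa [axialDist_axialRotation]), e1, e2, e3]
  exact (sq_eq_sq₀ (norm_nonneg _) (norm_nonneg _)).1 h4

/-- The chord has length `2r sin((θ₂ - θ₁)/2)`, and Jordan's inequality bounds the sine from below
by a linear function. -/
theorem le_dist_axialRotation {θ₁ θ₂ : ℝ} (h0 : θ₁ ≤ θ₂) (h1 : θ₂ - θ₁ ≤ Real.pi) (x : E3) :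
    2 / Real.pi * axialDist x * (θ₂ - θ₁) ≤ dist (axialRotation θ₁ x) (axialRotation θ₂ x) := by
  have hr : axialDist x ^ 2 = x 0 ^ 2 + x 1 ^ 2 := Real.sq_sqrt (by positivity)
  have hs := Real.mul_le_sin (x := (θ₂ - θ₁) / 2) (by linarith) (by linarith)
  have h2 : dist (axialRotation θ₁ x) (axialRotation θ₂ x) =
      2 * axialDist x * Real.sin ((θ₂ - θ₁) / 2) := by
    have hs0 : 0 ≤ Real.sin ((θ₂ - θ₁) / 2) := le_trans (by
      have := Real.pi_pos
      have h3 : 0 ≤ (θ₂ - θ₁) / 2 := by linarith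
      positivity) hs
    rw [EuclideanSpace.dist_eq, Real.sqrt_eq_iff_mul_self_eq (by positivity)
      (mul_nonneg (mul_nonneg zero_le_two (axialDist_nonneg x)) hs0), Fin.sum_univ_three]
    simp only [Real.dist_eq, sq_abs, axialRotation_zero_coord, axialRotation_one_coord,
      axialRotation_two_coord]
    have e1 : Real.sin ((θ₂ - θ₁) / 2) ^ 2 = 1 / 2 - Real.cos (θ₂ - θ₁) / 2 := by
      rw [Real.sin_sq_eq_half_sub]; congr 3; ring
    rw [Real.cos_sub] at e1
    have e2 := Real.sin_sq_add_cos_sq θ₁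
    have e3 := Real.sin_sq_add_cos_sq θ₂
    linear_combination (x 0 ^ 2 + x 1 ^ 2) * (e2 + e3) - 4 * axialDist x ^ 2 * e1 -
      (2 - 2 * Real.cos θ₂ * Real.cos θ₁ - 2 * Real.sin θ₂ * Real.sin θ₁) * hr
  rw [h2]
  have := mul_le_mul_of_nonneg_left hs (mul_nonneg zero_le_two (axialDist_nonneg x))
  calc _ = 2 * axialDist x * (2 / Real.pi * ((θ₂ - θ₁) / 2)) := by ring
    _ ≤ _ := this

/-- The integral of an axisymmetric density over a ball away from the axis is small, since the
ball has many disjoint rotated copies. -/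
theorem setLIntegral_ball_le_of_axisymmetric {F : E3 → ENNReal}
    (hF : ∀ θ : ℝ, ∀ y, axialDist y ≠ 0 → F (axialRotation θ y) = F y) (x : E3) {R : ℝ}
    (hR : 0 < R) (hx : 2 * R < axialDist x) :
    ENNReal.ofReal (axialDist x / (Real.pi * R)) * ∫⁻ y in Metric.ball x R, F y ≤
      ∫⁻ y, F y := by
  have hπ := Real.pi_pos
  have hρ : 0 < axialDist x := by linarith
  -- The angle `δ` is chosen so that the chord bound separates consecutive centres by at least `2R`.
  -- With `n` equal to one more than the integer part of `1/δ`, the total angle `(n - 1)δ` is at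
  -- most one, hence below `π`, and all pairs of copies are disjoint.
  set δ : ℝ := Real.pi * R / axialDist x with hδ
  have hδ0 : 0 < δ := by positivity
  set n : ℕ := ⌊axialDist x / (Real.pi * R)⌋₊ + 1 with hn
  have hn1 : axialDist x / (Real.pi * R) ≤ n := by
    rw [hn]; push_cast; exact (Nat.lt_floor_add_one _).le
  have hrot : ∀ θ : ℝ, ∫⁻ y in Metric.ball (axialRotation θ x) R, F y =
      ∫⁻ y in Metric.ball x R, F y := by
    intro θ
    have h1 := ((axialRotation θ).measurePreserving).setLIntegral_comp_preimage_emb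
      (axialRotation θ).toHomeomorph.measurableEmbedding F (Metric.ball (axialRotation θ x) R)
    rw [← h1, LinearIsometryEquiv.preimage_ball, LinearIsometryEquiv.symm_apply_apply]
    refine lintegral_congr_ae (ae_restrict_of_ae ?_)
    filter_upwards [ae_axialDist_pos] with y hy
    exact hF θ y hy.ne'
  have hdist : ∀ i j : ℕ, i < j → j < n → 2 * R ≤
      dist (axialRotation (i * δ) x) (axialRotation (j * δ) x) := by
    intro i j hij hj
    have h1 : ((1 : ℝ)) ≤ (j : ℝ) - i := by
      have : ((i + 1 : ℕ) : ℝ) ≤ j := by exact_mod_cast hij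
      push_cast at this; linarith
    have h2 : (j : ℝ) ≤ axialDist x / (Real.pi * R) :=
      (Nat.cast_le.2 (Nat.lt_succ_iff.1 hj)).trans (Nat.floor_le (by positivity))
    have h3 : (j : ℝ) * δ ≤ 1 := by
      rw [hδ]
      calc (j : ℝ) * (Real.pi * R / axialDist x)
          ≤ axialDist x / (Real.pi * R) * (Real.pi * R / axialDist x) := by gcongr
        _ = 1 := by field_simp
    have h4 : 0 ≤ (i : ℝ) * δ := by positivity
    have h5 := le_dist_axialRotation (θ₁ := i * δ) (θ₂ := j * δ) (by nlinarith)
      (by linarith [Real.pi_gt_three]) x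
    refine le_trans ?_ h5
    calc 2 * R = 2 / Real.pi * axialDist x * (1 * δ) := by rw [hδ]; field_simp
      _ ≤ 2 / Real.pi * axialDist x * (((j : ℝ) - i) * δ) := by gcongr
      _ = _ := by ring
  have hdisj : Set.PairwiseDisjoint (↑(Finset.range n))
      fun k : ℕ => Metric.ball (axialRotation (k * δ) x) R := by
    intro i hi j hj hij
    have hi' : i < n := Finset.mem_range.1 hi
    have hj' : j < n := Finset.mem_range.1 hj
    refine Metric.ball_disjoint_ball ?_
    rcases lt_or_gt_of_ne hij with h | h
    · linarith [hdist i j h hj']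
    · rw [dist_comm]; linarith [hdist j i h hi']
  have hsum := lintegral_biUnion_finset (μ := (volume : Measure E3)) hdisj
    (fun _ _ => measurableSet_ball) F
  calc _ ≤ (n : ENNReal) * ∫⁻ y in Metric.ball x R, F y := by
        gcongr
        rw [← ENNReal.ofReal_natCast]
        exact ENNReal.ofReal_le_ofReal hn1
    _ = ∑ k ∈ Finset.range n, ∫⁻ y in Metric.ball (axialRotation (k * δ) x) R, F y := by
        rw [Finset.sum_congr rfl fun (k : ℕ) _ => hrot (k * δ)]
        simp
    _ ≤ ∫⁻ y, F y := by
        rw [← hsum]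
        exact setLIntegral_le_lintegral _ _

/-! ### Morrey bounds -/

/-- A continuous field whose local `L^p` norms scale like those of `M / |x|`. -/
def MorreyBound (p M : ℝ) (v : E3 → E3) : Prop :=
  ∀ (x : E3) (R : ℝ), 0 < R →
    ∫⁻ y in Metric.ball x R, ‖v y‖ₑ ^ p ≤ ENNReal.ofReal (M ^ p * R ^ (3 - p))

/-- Hölder with exponents `q/p` and `q/(q-p)`: one factor is the weighted norm, the other the
integral of `r^(-b)` over the ball. The definition of `b` is what this second factor dictates. -/
theorem lintegral_ball_rpow_le_of_three_lt {q b p : ℝ} (hq : 3 < q) (hp : 2 < p) (hpq : p < q)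
    (hb : b = (q - 3) * p / (q - p)) {C : ℝ} (hC : 0 ≤ C) {x : E3} {R : ℝ} (hR : 0 < R)
    (h : ∫⁻ y in Metric.ball x R, ENNReal.ofReal (axialDist y ^ (-b)) ≤
      ENNReal.ofReal (C * R ^ (3 - b))) {A : ℝ} (hA : 0 ≤ A) {v : E3 → E3} (hv : Continuous v)
    (hF : ∫⁻ x, ‖axialDist x ^ (1 - 3 / q) • v x‖ₑ ^ q ≤ ENNReal.ofReal A ^ q) :
    ∫⁻ y in Metric.ball x R, ‖v y‖ₑ ^ p ≤
      ENNReal.ofReal (C ^ ((q - p) / q) * A ^ p * R ^ (3 - p)) := by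
  have hq0 : 0 < q := by linarith
  have hp0 : 0 < p := by linarith
  have hqp : 0 < q - p := by linarith
  have hconj : (q / (q - p)).HolderConjugate (q / p) := by
    rw [Real.holderConjugate_iff]
    constructor
    · rw [lt_div_iff₀ hqp]; linarith
    · field_simp; ring
  set α : ℝ := 1 - 3 / q with hα
  have hm := (aestronglyMeasurable_weighted α hv).enorm
  calc ∫⁻ y in Metric.ball x R, ‖v y‖ₑ ^ p
      = ∫⁻ y in Metric.ball x R, ((fun y => ENNReal.ofReal (axialDist y ^ (-α * p))) *
          fun y => ‖axialDist y ^ α • v y‖ₑ ^ p) y := by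
        refine lintegral_congr_ae (ae_restrict_of_ae ?_)
        filter_upwards [ae_axialDist_pos] with y hy
        rw [Pi.mul_apply, enorm_eq_weighted (α := α) hy, ENNReal.mul_rpow_of_nonneg _ _ hp0.le,
          ENNReal.ofReal_rpow_of_pos (by positivity), ← Real.rpow_mul hy.le]
    _ ≤ (∫⁻ y in Metric.ball x R, ENNReal.ofReal (axialDist y ^ (-α * p)) ^ (q / (q - p))) ^
          (1 / (q / (q - p))) *
        (∫⁻ y in Metric.ball x R, (‖axialDist y ^ α • v y‖ₑ ^ p) ^ (q / p)) ^ (1 / (q / p)) := by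
        refine ENNReal.lintegral_mul_le_Lp_mul_Lq _ hconj ?_ ?_
        · exact (ENNReal.measurable_ofReal.comp
            (continuous_axialDist.measurable.pow_const _)).aemeasurable
        · exact (hm.pow_const p).restrict
    _ ≤ ENNReal.ofReal (C * R ^ (3 - b)) ^ (1 / (q / (q - p))) *
        (ENNReal.ofReal A ^ q) ^ (1 / (q / p)) := by
        gcongr
        · refine le_trans (le_of_eq (lintegral_congr_ae (ae_restrict_of_ae ?_))) h
          filter_upwards [ae_axialDist_pos] with y hy
          rw [ENNReal.ofReal_rpow_of_pos (by positivity), ← Real.rpow_mul hy.le]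
          congr 2
          rw [hb, hα]; field_simp
        · refine le_trans (setLIntegral_le_lintegral _ _) (le_trans (le_of_eq ?_) hF)
          refine lintegral_congr fun y => ?_
          rw [← ENNReal.rpow_mul]
          congr 1; field_simp
    _ = _ := by
        rw [one_div_div, one_div_div, ← ENNReal.rpow_mul, mul_div_cancel₀ _ hq0.ne',
          ENNReal.ofReal_rpow_of_nonneg (by positivity) (by positivity),
          ENNReal.ofReal_rpow_of_nonneg hA hp0.le, ← ENNReal.ofReal_mul (by positivity),
          Real.mul_rpow hC (by positivity), ← Real.rpow_mul hR.le]
        congr 1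
        have : (3 - b) * ((q - p) / q) = 3 - p := by rw [hb]; field_simp; ring
        rw [this]; ring

/-- Removing the weight costs the power `r^(3-q)`, which is nondecreasing in `r`. If the ball is
close to the axis, `r` is at most `3R` on it. Otherwise `r` is comparable to the distance `ρ` of the
centre, and rotated copies give the gain `πR/ρ`; then `ρ^(2-q) R ≤ R^(3-q)` because `q > 2` and `ρ >
R`. -/
theorem lintegral_ball_rpow_le_of_axisymmetric {q : ℝ} (hq2 : 2 < q) (hq3 : q ≤ 3) {A : ℝ}
    (hA : 0 ≤ A) {v : E3 → E3} (hv : ContDiff ℝ ∞ v) (hax : IsAxisymmetric v)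
    (hF : ∫⁻ x, ‖axialDist x ^ (1 - 3 / q) • v x‖ₑ ^ q ≤ ENNReal.ofReal A ^ q) (x : E3) {R : ℝ}
    (hR : 0 < R) :
    ∫⁻ y in Metric.ball x R, ‖v y‖ₑ ^ q ≤ ENNReal.ofReal (8 * A ^ q * R ^ (3 - q)) := by
  have hq0 : 0 < q := by linarith
  have hπ := Real.pi_pos
  have hπ4 := Real.pi_le_four
  set α : ℝ := 1 - 3 / q with hα
  rw [ENNReal.ofReal_rpow_of_nonneg hA hq0.le] at hF
  set F : E3 → ENNReal := fun x => ‖axialDist x ^ α • v x‖ₑ ^ q with hFd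
  have hpt : ∀ D : ℝ, (∀ y ∈ Metric.ball x R, axialDist y ≤ D) →
      ∫⁻ y in Metric.ball x R, ‖v y‖ₑ ^ q ≤
        ENNReal.ofReal (D ^ (3 - q)) * ∫⁻ y in Metric.ball x R, F y := by
    intro D hD
    rw [← lintegral_const_mul' _ _ ENNReal.ofReal_ne_top]
    refine lintegral_mono_ae ?_
    filter_upwards [ae_restrict_of_ae ae_axialDist_pos, ae_restrict_mem measurableSet_ball]
      with y hy hyB
    rw [enorm_eq_weighted (α := α) hy, ENNReal.mul_rpow_of_nonneg _ _ hq0.le,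
      ENNReal.ofReal_rpow_of_pos (by positivity), ← Real.rpow_mul hy.le]
    gcongr
    have : -α * q = 3 - q := by rw [hα]; field_simp; ring
    rw [this]
    exact Real.rpow_le_rpow hy.le (hD y hyB) (by linarith)
  have hlip : ∀ y ∈ Metric.ball x R, axialDist y ≤ axialDist x + R := by
    intro y hy
    rw [Metric.mem_ball, dist_eq_norm, EuclideanSpace.norm_eq, Fin.sum_univ_three] at hy
    simp only [Real.norm_eq_abs, sq_abs, PiLp.sub_apply] at hy
    have hc : ∀ z : E3, axialDist z = ‖(!₂[z 0, z 1] : EuclideanSpace ℝ (Fin 2))‖ := by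
      intro z
      rw [EuclideanSpace.norm_eq, Fin.sum_univ_two, axialDist]
      simp
    have h1 : ‖(!₂[y 0, y 1] : EuclideanSpace ℝ (Fin 2)) - !₂[x 0, x 1]‖ ≤ R := by
      refine le_trans ?_ hy.le
      rw [EuclideanSpace.norm_eq, Fin.sum_univ_two]
      apply Real.sqrt_le_sqrt
      simp only [PiLp.sub_apply, Real.norm_eq_abs, sq_abs]
      simp
      positivity
    rw [hc, hc]
    linarith [norm_sub_norm_le (!₂[y 0, y 1] : EuclideanSpace ℝ (Fin 2)) !₂[x 0, x 1]]
  rcases le_or_gt (axialDist x) (2 * R) with hx | hx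
  · refine (hpt (3 * R) fun y hy => (hlip y hy).trans (by linarith)).trans ?_
    calc _ ≤ ENNReal.ofReal ((3 * R) ^ (3 - q)) * ENNReal.ofReal (A ^ q) := by
          gcongr; exact (setLIntegral_le_lintegral _ _).trans hF
      _ ≤ _ := by
          rw [← ENNReal.ofReal_mul (by positivity)]
          refine ENNReal.ofReal_le_ofReal ?_
          rw [Real.mul_rpow (by norm_num) hR.le]
          have h3 : (3 : ℝ) ^ (3 - q) ≤ 3 ^ (1 : ℝ) :=
            Real.rpow_le_rpow_of_exponent_le (by norm_num) (by linarith)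
          rw [Real.rpow_one] at h3
          have : 0 ≤ A ^ q * R ^ (3 - q) := by positivity
          nlinarith
  · have hρ : 0 < axialDist x := by linarith
    have hrot := setLIntegral_ball_le_of_axisymmetric (F := F) (fun θ y hy => by
      simp only [hFd, enorm_smul, axialDist_axialRotation]
      rw [← ofReal_norm (v _), hax.norm_axialRotation (hv.differentiable (by simp)) hy,
        ofReal_norm]) x hR hx
    have hB : ∫⁻ y in Metric.ball x R, F y ≤
        ENNReal.ofReal (A ^ q * (Real.pi * R / axialDist x)) := by
      have h1 := hrot.trans hF
      have h2 : ∫⁻ y in Metric.ball x R, F y ≤ ENNReal.ofReal (Real.pi * R / axialDist x) *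
          (ENNReal.ofReal (axialDist x / (Real.pi * R)) * ∫⁻ y in Metric.ball x R, F y) := by
        rw [← mul_assoc, ← ENNReal.ofReal_mul (by positivity)]
        have : Real.pi * R / axialDist x * (axialDist x / (Real.pi * R)) = 1 := by field_simp
        rw [this, ENNReal.ofReal_one, one_mul]
      refine h2.trans ((mul_le_mul_right h1 _).trans (le_of_eq ?_))
      rw [← ENNReal.ofReal_mul (by positivity), mul_comm]
    refine (hpt (2 * axialDist x) fun y hy => (hlip y hy).trans (by linarith)).trans
      ((mul_le_mul_right hB _).trans ?_)
    rw [← ENNReal.ofReal_mul (by positivity)]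
    refine ENNReal.ofReal_le_ofReal ?_
    rw [Real.mul_rpow (by norm_num) hρ.le]
    have h3 : (2 : ℝ) ^ (3 - q) ≤ 2 ^ (1 : ℝ) :=
      Real.rpow_le_rpow_of_exponent_le (by norm_num) (by linarith)
    rw [Real.rpow_one] at h3
    have h4 : axialDist x ^ (3 - q) = axialDist x * axialDist x ^ (2 - q) := by
      rw [mul_comm, ← Real.rpow_add_one hρ.ne']; congr 1; ring
    have h4' : R ^ (3 - q) = R * R ^ (2 - q) := by
      rw [mul_comm, ← Real.rpow_add_one hR.ne']; congr 1; ring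
    have h5 : axialDist x ^ (2 - q) ≤ R ^ (2 - q) :=
      Real.rpow_le_rpow_of_nonpos hR (by linarith) (by linarith)
    calc _ = 2 ^ (3 - q) * Real.pi * (A ^ q * (axialDist x ^ (2 - q) * R)) := by
          rw [h4]; field_simp
      _ ≤ 2 * 4 * (A ^ q * (R ^ (2 - q) * R)) := by gcongr
      _ = _ := by rw [h4']; ring

/-- The scale invariant weighted bound gives a Morrey bound with an exponent above two. -/
theorem exists_morreyBound {q : ℝ} (hq : 2 < q) : ∃ p K : ℝ, 2 < p ∧ p ≤ 3 ∧ 1 ≤ K ∧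
    ∀ (a b A : ℝ) (u : ℝ → E3 → E3), a < b → 0 ≤ A → IsClassicalNavierStokes a b u →
      weightedNorm q (1 - 3 / q) a b u ≤ ENNReal.ofReal A →
      (3 < q ∨ (q ≤ 3 ∧ ∀ t ∈ Icc a b, IsAxisymmetric (u t))) →
      ∀ t ∈ Icc a b, MorreyBound p (K * A) (u t) := by
  -- The multiplicative constant is moved into `M` as the factor `(K + 1)^(1/p)`; adding one makes
  -- this factor at least one.
  have key : ∀ p K : ℝ, 2 < p → p ≤ 3 → 0 ≤ K → (∀ (a b A : ℝ) (u : ℝ → E3 → E3), a < b →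
      0 ≤ A → IsClassicalNavierStokes a b u →
      weightedNorm q (1 - 3 / q) a b u ≤ ENNReal.ofReal A →
      (3 < q ∨ (q ≤ 3 ∧ ∀ t ∈ Icc a b, IsAxisymmetric (u t))) →
      ∀ t ∈ Icc a b, ∀ (x : E3) (R : ℝ), 0 < R → ∫⁻ y in Metric.ball x R, ‖u t y‖ₑ ^ p ≤
        ENNReal.ofReal (K * A ^ p * R ^ (3 - p))) → ∃ p K : ℝ, 2 < p ∧ p ≤ 3 ∧ 1 ≤ K ∧
    ∀ (a b A : ℝ) (u : ℝ → E3 → E3), a < b → 0 ≤ A → IsClassicalNavierStokes a b u →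
      weightedNorm q (1 - 3 / q) a b u ≤ ENNReal.ofReal A →
      (3 < q ∨ (q ≤ 3 ∧ ∀ t ∈ Icc a b, IsAxisymmetric (u t))) →
      ∀ t ∈ Icc a b, MorreyBound p (K * A) (u t) := by
    intro p K hp2 hp3 hK h
    refine ⟨p, (K + 1) ^ (1 / p), hp2, hp3,
      Real.one_le_rpow (by linarith) (by positivity), ?_⟩
    intro a b A u hab hA hu hn hc t ht x R hR
    refine (h a b A u hab hA hu hn hc t ht x R hR).trans (ENNReal.ofReal_le_ofReal ?_)
    rw [Real.mul_rpow (by positivity) hA, ← Real.rpow_mul (by positivity),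
      one_div_mul_cancel (by positivity), Real.rpow_one]
    gcongr
    linarith
  rcases lt_or_ge 3 q with h3 | h3
  -- The requirements `p > 2` and `b < 2` read `2q/q < p < 2q/(q-1)`. The choice `p = 2q/(q - 1/2)`
  -- lies strictly between.
  · set p : ℝ := 4 * q / (2 * q - 1) with hp
    set b : ℝ := (q - 3) * p / (q - p) with hb
    have h2q : 0 < 2 * q - 1 := by linarith
    have hp2 : 2 < p := by rw [hp, lt_div_iff₀ h2q]; linarith
    have hp3 : p ≤ 3 := by rw [hp, div_le_iff₀ h2q]; linarith
    have hpq : p < q := by linarith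
    have hqp : 0 < q - p := by linarith
    have hq3 : 0 < q - 3 := by linarith
    have hb0 : 0 < b := by positivity
    have hb2 : b < 2 := by
      rw [hb, div_lt_iff₀ hqp]
      have : p * (2 * q - 1) = 4 * q := by rw [hp, div_mul_cancel₀ _ h2q.ne']
      nlinarith
    obtain ⟨C, hC, h⟩ := exists_lintegral_axialDist_le hb0 hb2
    refine key p (C ^ ((q - p) / q)) hp2 hp3 (by positivity) ?_
    intro a b' A u hab hA hu hn _ t ht x R hR
    exact lintegral_ball_rpow_le_of_three_lt h3 hp2 hpq hb hC hR (h x R hR) hA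
      (hu.contDiff_slice ht).continuous
      (lintegral_weighted_le (by linarith) (hu.eLpNorm_le hab hn ht))
  · refine key q 8 hq h3 (by norm_num) ?_
    intro a b' A u hab hA hu hn hc t ht x R hR
    rcases hc with hc | hc
    · linarith
    · exact lintegral_ball_rpow_le_of_axisymmetric hq h3 hA (hu.contDiff_slice ht) (hc.2 t ht)
        (lintegral_weighted_le (by linarith) (hu.eLpNorm_le hab hn ht)) x hR

/-! ### Weighted integrals of fields with a Morrey bound -/

theorem lintegral_comp_smul_E3 (F : E3 → ENNReal) {c : ℝ} (hc : 0 < c) :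
    ∫⁻ y, F (c • y) = ENNReal.ofReal ((c ^ 3)⁻¹) * ∫⁻ y, F y := by
  have h1 := (Homeomorph.smulOfNeZero c hc.ne' (α := E3)).measurableEmbedding.lintegral_map
    (μ := volume) F
  have h2 := Measure.map_addHaar_smul (volume : Measure E3) hc.ne'
  have h3 : ⇑(Homeomorph.smulOfNeZero c hc.ne' (α := E3)) = fun x : E3 => c • x := rfl
  rw [h3] at h1
  rw [← h1, show (fun x : E3 => c • x) = (c • ·) from rfl, h2, lintegral_smul_measure,
    finrank_euclideanSpace, Fintype.card_fin, abs_of_pos (by positivity), smul_eq_mul]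

theorem lintegral_comp_add_smul (F : E3 → ENNReal) (x : E3) {c : ℝ} (hc : 0 < c) :
    ∫⁻ y, F (x + c • y) = ENNReal.ofReal ((c ^ 3)⁻¹) * ∫⁻ y, F y := by
  rw [lintegral_comp_smul_E3 (fun y => F (x + y)) hc, lintegral_add_left_eq_self F x]

theorem wt_le_one (n : ℕ) (y : E3) : wt n y ≤ 1 := by
  unfold wt
  exact inv_le_one_of_one_le₀ (one_le_pow₀ (by linarith [norm_nonneg y]))

theorem wt_le_wt {m n : ℕ} (h : m ≤ n) (y : E3) : wt n y ≤ wt m y := by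
  unfold wt
  have : 1 ≤ 1 + ‖y‖ := by linarith [norm_nonneg y]
  gcongr

/-- The least `k` with `|z| < 2ᵏ` suffices: if `k ≥ 1` then `|z| ≥ 2^(k-1)`, and the halving
accounts for the factor `16 = 2⁴`. -/
theorem wt_four_le_tsum (z : E3) : ENNReal.ofReal (wt 4 z) ≤
    ∑' k : ℕ, (Metric.ball (0 : E3) (2 ^ k)).indicator
      (fun _ => ENNReal.ofReal (16 * ((2 : ℝ) ^ (4 * k))⁻¹)) z := by
  obtain ⟨k, hk, hmin⟩ : ∃ k : ℕ, ‖z‖ < 2 ^ k ∧ ∀ j < k, (2 : ℝ) ^ j ≤ ‖z‖ := by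
    have hex : ∃ k : ℕ, ‖z‖ < 2 ^ k := pow_unbounded_of_one_lt _ (by norm_num)
    classical
    exact ⟨Nat.find hex, Nat.find_spec hex, fun j hj => not_lt.1 (Nat.find_min hex hj)⟩
  refine le_trans ?_ (ENNReal.le_tsum k)
  rw [indicator_of_mem (by simpa using hk)]
  refine ENNReal.ofReal_le_ofReal ?_
  rcases k with _ | k
  · have := wt_le_one 4 z
    simpa using this.trans (by norm_num)
  · have h1 := hmin k (Nat.lt_succ_self k)
    have h2 : ((2 : ℝ) ^ k) ^ 4 ≤ (1 + ‖z‖) ^ 4 := by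
      gcongr; linarith
    unfold wt
    rw [← div_eq_mul_inv, inv_eq_one_div, div_le_div_iff₀ (by positivity) (by positivity)]
    have h3 : (2 : ℝ) ^ (4 * (k + 1)) = 16 * (2 ^ k) ^ 4 := by
      rw [← pow_mul, mul_comm k 4, mul_add, pow_add]; norm_num; ring
    rw [h3]
    linarith

/-- Lower exponents follow by splitting according to whether `|v|` exceeds `M/R`, the natural size
at scale `R`: the two alternatives are dominated by `(M/R)^s` and `(M/R)^(s-p)|v|^p`. -/
theorem MorreyBound.lintegral_ball_le {p M s : ℝ} (hM : 0 < M) (hs : 0 < s)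
    (hsp : s ≤ p) {v : E3 → E3} (h : MorreyBound p M v) (x : E3) {R : ℝ} (hR : 0 < R) :
    ∫⁻ y in Metric.ball x R, ‖v y‖ₑ ^ s ≤
      ENNReal.ofReal (((volume (Metric.ball (0 : E3) 1)).toReal + 1) * M ^ s * R ^ (3 - s)) := by
  set V := (volume (Metric.ball (0 : E3) 1)).toReal with hV
  have hVt : volume (Metric.ball (0 : E3) 1) = ENNReal.ofReal V :=
    (ENNReal.ofReal_toReal measure_ball_lt_top.ne).symm
  have hV0 : 0 ≤ V := ENNReal.toReal_nonneg
  have hl : 0 < M / R := by positivity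
  have hpt : ∀ y, ‖v y‖ₑ ^ s ≤ ENNReal.ofReal ((M / R) ^ s) +
      ENNReal.ofReal ((M / R) ^ (s - p)) * ‖v y‖ₑ ^ p := by
    intro y
    rw [← ofReal_norm, ENNReal.ofReal_rpow_of_nonneg (norm_nonneg _) hs.le,
      ENNReal.ofReal_rpow_of_nonneg (norm_nonneg _) (by linarith),
      ← ENNReal.ofReal_mul (by positivity), ← ENNReal.ofReal_add (by positivity) (by positivity)]
    refine ENNReal.ofReal_le_ofReal ?_
    rcases le_or_gt ‖v y‖ (M / R) with h1 | h1
    · have h2 : ‖v y‖ ^ s ≤ (M / R) ^ s := by gcongr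
      have : 0 ≤ (M / R) ^ (s - p) * ‖v y‖ ^ p := by positivity
      linarith
    · have h2 : ‖v y‖ ^ (s - p) ≤ (M / R) ^ (s - p) :=
        Real.rpow_le_rpow_of_nonpos hl h1.le (by linarith)
      have h3 : ‖v y‖ ^ s = ‖v y‖ ^ (s - p) * ‖v y‖ ^ p := by
        rw [← Real.rpow_add (hl.trans h1)]; congr 1; ring
      have h4 : ‖v y‖ ^ (s - p) * ‖v y‖ ^ p ≤ (M / R) ^ (s - p) * ‖v y‖ ^ p := by gcongr
      have : 0 ≤ (M / R) ^ s := by positivity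
      linarith
  calc ∫⁻ y in Metric.ball x R, ‖v y‖ₑ ^ s
      ≤ ∫⁻ y in Metric.ball x R, (ENNReal.ofReal ((M / R) ^ s) +
          ENNReal.ofReal ((M / R) ^ (s - p)) * ‖v y‖ₑ ^ p) := lintegral_mono hpt
    _ = ENNReal.ofReal ((M / R) ^ s) * volume (Metric.ball x R) +
          ENNReal.ofReal ((M / R) ^ (s - p)) * ∫⁻ y in Metric.ball x R, ‖v y‖ₑ ^ p := by
        rw [lintegral_add_left measurable_const, setLIntegral_const,
          lintegral_const_mul' _ _ ENNReal.ofReal_ne_top]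
    _ ≤ ENNReal.ofReal ((M / R) ^ s) * (ENNReal.ofReal (R ^ 3) * ENNReal.ofReal V) +
          ENNReal.ofReal ((M / R) ^ (s - p)) * ENNReal.ofReal (M ^ p * R ^ (3 - p)) := by
        gcongr
        · rw [Measure.addHaar_ball _ _ hR.le, finrank_euclideanSpace, Fintype.card_fin, hVt]
        · exact h x R hR
    _ = _ := by
        rw [← ENNReal.ofReal_mul (by positivity), ← ENNReal.ofReal_mul (by positivity),
          ← ENNReal.ofReal_mul (by positivity), ← ENNReal.ofReal_add (by positivity)
          (by positivity)]
        congr 1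
        have e1 : (M / R) ^ s * R ^ 3 = M ^ s * R ^ (3 - s) := by
          rw [Real.div_rpow hM.le hR.le, Real.rpow_sub hR]
          norm_cast
          field_simp
        have e2 : (M / R) ^ (s - p) * (M ^ p * R ^ (3 - p)) = M ^ s * R ^ (3 - s) := by
          rw [Real.div_rpow hM.le hR.le, Real.rpow_sub hR, Real.rpow_sub hR, Real.rpow_sub hM,
            Real.rpow_sub hR]
          field_simp
        rw [e2, ← mul_assoc, e1]
        ring

/-- Weighted integrals of fields with a Morrey bound. -/
theorem exists_lintegral_wt_le : ∃ C : ℝ, 1 ≤ C ∧ ∀ (p M s : ℝ) (v : E3 → E3) (n : ℕ) (N : ℝ)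
    (x : E3), 0 < M → 0 < s → s ≤ p → Continuous v → MorreyBound p M v → 4 ≤ n → 0 < N →
      ∫⁻ y, ENNReal.ofReal (wt n (N • (x - y))) * ‖v y‖ₑ ^ s ≤
        ENNReal.ofReal (C * M ^ s * N ^ (s - 3)) := by
  set V := (volume (Metric.ball (0 : E3) 1)).toReal with hV
  have hV0 : 0 ≤ V := ENNReal.toReal_nonneg
  refine ⟨32 * (V + 1), by linarith, fun p M s v n N x hM hs hsp hv h hn hN => ?_⟩
  have hpt : ∀ y, ENNReal.ofReal (wt n (N • (x - y))) * ‖v y‖ₑ ^ s ≤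
      ∑' k : ℕ, (Metric.ball x (2 ^ k / N)).indicator
        (fun y => ENNReal.ofReal (16 * ((2 : ℝ) ^ (4 * k))⁻¹) * ‖v y‖ₑ ^ s) y := by
    intro y
    have h1 : ENNReal.ofReal (wt n (N • (x - y))) ≤ _ :=
      (ENNReal.ofReal_le_ofReal (wt_le_wt hn _)).trans (wt_four_le_tsum (N • (x - y)))
    refine (mul_le_mul_left h1 _).trans (le_of_eq ?_)
    rw [← ENNReal.tsum_mul_right]
    refine tsum_congr fun k => ?_
    have hiff : N • (x - y) ∈ Metric.ball (0 : E3) (2 ^ k) ↔ y ∈ Metric.ball x (2 ^ k / N) := by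
      rw [mem_ball_zero_iff, Metric.mem_ball, dist_comm, dist_eq_norm, norm_smul,
        Real.norm_of_nonneg hN.le, lt_div_iff₀ hN, mul_comm]
    by_cases hy : y ∈ Metric.ball x (2 ^ k / N)
    · rw [indicator_of_mem hy, indicator_of_mem (hiff.2 hy)]
    · rw [indicator_of_notMem hy, indicator_of_notMem (fun hh => hy (hiff.1 hh)), zero_mul]
  have hm : Measurable fun y => ‖v y‖ₑ ^ s := hv.enorm.measurable.pow_const s
  calc _ ≤ ∫⁻ y, ∑' k : ℕ, (Metric.ball x (2 ^ k / N)).indicator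
        (fun y => ENNReal.ofReal (16 * ((2 : ℝ) ^ (4 * k))⁻¹) * ‖v y‖ₑ ^ s) y := lintegral_mono hpt
    _ = ∑' k : ℕ, ENNReal.ofReal (16 * ((2 : ℝ) ^ (4 * k))⁻¹) *
        ∫⁻ y in Metric.ball x (2 ^ k / N), ‖v y‖ₑ ^ s := by
        rw [lintegral_tsum fun k => ((hm.const_mul _).indicator measurableSet_ball).aemeasurable]
        refine tsum_congr fun k => ?_
        rw [lintegral_indicator measurableSet_ball, lintegral_const_mul' _ _ ENNReal.ofReal_ne_top]
    _ ≤ ∑' k : ℕ, ENNReal.ofReal (16 * (V + 1) * M ^ s * N ^ (s - 3)) *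
        ENNReal.ofReal (1 / 2) ^ k := by
        refine ENNReal.tsum_le_tsum fun k => ?_
        refine (mul_le_mul_right (h.lintegral_ball_le hM hs hsp x (by positivity)) _).trans ?_
        rw [← ENNReal.ofReal_pow (by norm_num), ← ENNReal.ofReal_mul (by positivity),
          ← ENNReal.ofReal_mul (by positivity)]
        refine ENNReal.ofReal_le_ofReal ?_
        have e1 : ((2 : ℝ) ^ k / N) ^ (3 - s) = (2 ^ k) ^ (3 - s) * N ^ (s - 3) := by
          rw [Real.div_rpow (by positivity) hN.le, ← neg_sub 3 s, Real.rpow_neg hN.le,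
            div_eq_mul_inv]
        -- The integral over the ball of radius `2ᵏ/N` grows at most like `2^(3k)` as `s > 0`, while
        -- the weight decays like `2^(-4k)`; a geometric series of ratio `1/2` remains.
        have e2 : ((2 : ℝ) ^ k) ^ (3 - s) ≤ (2 ^ k) ^ 3 := by
          rw [← Real.rpow_natCast ((2 : ℝ) ^ k) 3]
          exact Real.rpow_le_rpow_of_exponent_le (one_le_pow₀ (by norm_num))
            (by push_cast; linarith)
        have e3 : ((2 : ℝ) ^ (4 * k))⁻¹ * (2 ^ k) ^ 3 = (1 / 2) ^ k := by
          rw [one_div, inv_pow, ← pow_mul, mul_comm k 3,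
            show 4 * k = k + 3 * k by ring, pow_add]
          field_simp
        rw [e1, ← e3]
        calc _ = 16 * (V + 1) * M ^ s * N ^ (s - 3) * (((2 : ℝ) ^ (4 * k))⁻¹ *
              (2 ^ k) ^ (3 - s)) := by ring
          _ ≤ _ := by gcongr
    _ = _ := by
        rw [ENNReal.tsum_mul_left, ENNReal.tsum_geometric, ← ENNReal.ofReal_one,
          ← ENNReal.ofReal_sub _ (by norm_num), ← ENNReal.ofReal_inv_of_pos (by norm_num),
          ← ENNReal.ofReal_mul (by positivity)]
        congr 1
        ring

/-! ### Pointwise bounds for Littlewood-Paley pieces -/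

theorem lintegral_wt_smul_sub (n : ℕ) {N : ℝ} (hN : 0 < N) (x : E3) :
    ∫⁻ y, ENNReal.ofReal (wt n (N • (x - y))) =
      ENNReal.ofReal ((N ^ 3)⁻¹) * ∫⁻ y, ENNReal.ofReal (wt n y) := by
  rw [lintegral_sub_left_eq_self (fun y => ENNReal.ofReal (wt n (N • y))) x]
  exact lintegral_comp_smul_E3 (fun y => ENNReal.ofReal (wt n y)) hN

theorem lintegral_wt_lt_top {n : ℕ} (hn : 4 ≤ n) :
    ∫⁻ y : E3, ENNReal.ofReal (wt n y) < ⊤ := by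
  have := (integrable_wt hn).lintegral_lt_top
  exact this

/-- The total mass of the weight `wt 4`. -/
noncomputable def wtMass : ℝ := (∫⁻ y : E3, ENNReal.ofReal (wt 4 y)).toReal

theorem wtMass_nonneg : 0 ≤ wtMass := ENNReal.toReal_nonneg

theorem lintegral_wt_le_wtMass {n : ℕ} (hn : 4 ≤ n) :
    ∫⁻ y : E3, ENNReal.ofReal (wt n y) ≤ ENNReal.ofReal wtMass := by
  rw [wtMass, ENNReal.ofReal_toReal (lintegral_wt_lt_top le_rfl).ne]
  exact lintegral_mono fun y => ENNReal.ofReal_le_ofReal (wt_le_wt hn y)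

theorem lintegral_wt_smul_sub_le {n : ℕ} (hn : 4 ≤ n) {N : ℝ} (hN : 0 < N) (x : E3) :
    ∫⁻ y, ENNReal.ofReal (wt n (N • (x - y))) ≤ ENNReal.ofReal (wtMass * (N ^ 3)⁻¹) := by
  rw [lintegral_wt_smul_sub n hN, mul_comm wtMass, ENNReal.ofReal_mul (by positivity)]
  gcongr
  exact lintegral_wt_le_wtMass hn

theorem wt_smul_comm (n : ℕ) (N : ℝ) (x y : E3) : wt n (N • (x - y)) = wt n (N • (y - x)) := by
  rw [wt, wt, ← neg_sub y x, smul_neg, norm_neg]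

theorem measurable_wt_smul_sub (n : ℕ) (N : ℝ) :
    Measurable fun z : E3 × E3 => ENNReal.ofReal (wt n (N • (z.1 - z.2))) := by
  have := continuous_wt n
  exact ENNReal.measurable_ofReal.comp
    (by fun_prop : Continuous fun z : E3 × E3 => wt n (N • (z.1 - z.2))).measurable

theorem measurable_wt_smul_const_sub (n : ℕ) (N : ℝ) (x : E3) :
    Measurable fun y : E3 => ENNReal.ofReal (wt n (N • (x - y))) := by
  have := continuous_wt n
  exact ENNReal.measurable_ofReal.comp
    (by fun_prop : Continuous fun y : E3 => wt n (N • (x - y))).measurable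

namespace IsLittlewoodPaleyBump

variable {φ : E3 → ℝ}

theorem exists_abs_lpKernel_le (hφ : IsLittlewoodPaleyBump φ) (n : ℕ) : ∃ C : ℝ, 0 ≤ C ∧
    ∀ N : ℝ, 0 < N → ∀ x, |lpKernel φ N x| ≤ C * N ^ 3 * wt n (N • x) := by
  obtain ⟨C, hC, h⟩ := hφ.exists_lpKernel_decay n
  refine ⟨C, hC, fun N hN x => ?_⟩
  have h1 := h N hN x
  rw [wt, ← div_eq_mul_inv, le_div_iff₀ (by positivity), norm_smul, Real.norm_of_nonneg hN.le]
  linarith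

theorem exists_enorm_lpLow_le (hφ : IsLittlewoodPaleyBump φ) (n : ℕ) : ∃ C : ℝ, 0 ≤ C ∧
    ∀ (f : E3 → E3) (N : ℝ) (x : E3), 0 < N → ‖lpLow φ N f x‖ₑ ≤
      ENNReal.ofReal (C * N ^ 3) * ∫⁻ y, ENNReal.ofReal (wt n (N • (x - y))) * ‖f y‖ₑ := by
  obtain ⟨C, hC, h⟩ := hφ.exists_abs_lpKernel_le n
  refine ⟨C, hC, fun f N x hN => ?_⟩
  refine (enorm_integral_le_lintegral_enorm _).trans ?_
  rw [← lintegral_const_mul' _ _ ENNReal.ofReal_ne_top]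
  refine lintegral_mono fun y => ?_
  rw [enorm_smul, ← mul_assoc, ← ENNReal.ofReal_mul (by positivity), Real.enorm_eq_ofReal_abs]
  gcongr
  exact h N hN (x - y)

theorem exists_enorm_lpProj_le (hφ : IsLittlewoodPaleyBump φ) (n : ℕ) : ∃ C : ℝ, 0 ≤ C ∧
    ∀ (f : E3 → E3) (N : ℝ) (x : E3), 0 < N → ‖lpProj φ N f x‖ₑ ≤
      ENNReal.ofReal (C * N ^ 3) * ∫⁻ y, ENNReal.ofReal (wt n (N • (x - y))) * ‖f y‖ₑ := by
  obtain ⟨C, hC, h⟩ := hφ.exists_enorm_lpLow_le n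
  refine ⟨C + C * 2 ^ n, by positivity, fun f N x hN => ?_⟩
  have h1 : ∫⁻ y, ENNReal.ofReal (wt n ((N / 2) • (x - y))) * ‖f y‖ₑ ≤
      ENNReal.ofReal (2 ^ n) * ∫⁻ y, ENNReal.ofReal (wt n (N • (x - y))) * ‖f y‖ₑ := by
    rw [← lintegral_const_mul' _ _ ENNReal.ofReal_ne_top]
    refine lintegral_mono fun y => ?_
    rw [← mul_assoc, ← ENNReal.ofReal_mul (by positivity)]
    gcongr
    unfold wt
    rw [← div_eq_mul_inv, inv_eq_one_div, div_le_div_iff₀ (by positivity) (by positivity), one_mul,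
      ← mul_pow]
    gcongr
    rw [norm_smul, norm_smul, Real.norm_of_nonneg hN.le, Real.norm_of_nonneg (half_pos hN).le]
    linarith
  calc ‖lpProj φ N f x‖ₑ ≤ ‖lpLow φ N f x‖ₑ + ‖lpLow φ (N / 2) f x‖ₑ := enorm_sub_le
    _ ≤ _ := add_le_add (h f N x hN) (h f (N / 2) x (half_pos hN))
    _ ≤ ENNReal.ofReal (C * N ^ 3) * (∫⁻ y, ENNReal.ofReal (wt n (N • (x - y))) * ‖f y‖ₑ) +
        ENNReal.ofReal (C * N ^ 3) * (ENNReal.ofReal (2 ^ n) *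
          ∫⁻ y, ENNReal.ofReal (wt n (N • (x - y))) * ‖f y‖ₑ) := by
        gcongr
        linarith
    _ = _ := by
        rw [← mul_assoc, ← ENNReal.ofReal_mul (by positivity), ← add_mul,
          ← ENNReal.ofReal_add (by positivity) (by positivity)]
        congr 2; ring

theorem aestronglyMeasurable_lpLow (hφ : IsLittlewoodPaleyBump φ) {N : ℝ} (hN : 0 < N)
    {f : E3 → E3} (hf : Continuous f) : StronglyMeasurable (lpLow φ N f) := by
  have := hφ.continuous_lpKernel hN
  exact (by fun_prop : Continuous fun z : E3 × E3 =>
    lpKernel φ N (z.1 - z.2) • f z.2).stronglyMeasurable.integral_prod_right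

theorem aestronglyMeasurable_lpProj (hφ : IsLittlewoodPaleyBump φ) {N : ℝ} (hN : 0 < N)
    {f : E3 → E3} (hf : Continuous f) : StronglyMeasurable (lpProj φ N f) :=
  (hφ.aestronglyMeasurable_lpLow hN hf).sub (hφ.aestronglyMeasurable_lpLow (half_pos hN) hf)

/-- Uniform pointwise bounds for Littlewood-Paley pieces of fields with a Morrey bound. -/
theorem exists_enorm_le_of_morreyBound (hφ : IsLittlewoodPaleyBump φ) : ∃ C : ℝ, 1 ≤ C ∧
    ∀ (p M : ℝ) (v : E3 → E3), 1 ≤ p → 0 < M → Continuous v → MorreyBound p M v →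
      ∀ (N : ℝ) (x : E3), 0 < N → ‖lpLow φ N v x‖ₑ ≤ ENNReal.ofReal (C * M * N) ∧
        ‖lpProj φ N v x‖ₑ ≤ ENNReal.ofReal (C * M * N) := by
  obtain ⟨C₁, hC₁, h₁⟩ := hφ.exists_enorm_lpLow_le 5
  obtain ⟨C₂, hC₂, h₂⟩ := hφ.exists_enorm_lpProj_le 5
  obtain ⟨C₃, hC₃, h₃⟩ := exists_lintegral_wt_le
  have hC₃0 : 0 ≤ C₃ := by linarith
  refine ⟨C₁ * C₃ + C₂ * C₃ + 1, by nlinarith [mul_nonneg hC₁ hC₃0, mul_nonneg hC₂ hC₃0],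
    fun p M v hp hM hv hB N x hN => ?_⟩
  have h4 := h₃ p M 1 v 5 N x hM one_pos hp hv hB (by norm_num) hN
  simp only [ENNReal.rpow_one, Real.rpow_one] at h4
  have key : ∀ C : ℝ, 0 ≤ C → C * C₃ ≤ C₁ * C₃ + C₂ * C₃ + 1 → ENNReal.ofReal (C * N ^ 3) *
      (∫⁻ y, ENNReal.ofReal (wt 5 (N • (x - y))) * ‖v y‖ₑ) ≤
      ENNReal.ofReal ((C₁ * C₃ + C₂ * C₃ + 1) * M * N) := by
    intro C hC hle
    refine (mul_le_mul_right h4 _).trans ?_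
    rw [← ENNReal.ofReal_mul (by positivity)]
    refine ENNReal.ofReal_le_ofReal ?_
    have e1 : N ^ (1 - 3 : ℝ) = (N ^ 2)⁻¹ := by
      rw [show (1 - 3 : ℝ) = -((2 : ℕ) : ℝ) by norm_num, Real.rpow_neg hN.le, Real.rpow_natCast]
    rw [e1]
    calc C * N ^ 3 * (C₃ * M * (N ^ 2)⁻¹) = C * C₃ * (M * N) := by field_simp
      _ ≤ (C₁ * C₃ + C₂ * C₃ + 1) * (M * N) := by gcongr
      _ = _ := by ring
  exact ⟨(h₁ v N x hN).trans (key C₁ hC₁ (by nlinarith [mul_nonneg hC₂ hC₃0])),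
    (h₂ v N x hN).trans (key C₂ hC₂ (by nlinarith [mul_nonneg hC₁ hC₃0]))⟩

theorem integral_lpKernel_sub (hφ : IsLittlewoodPaleyBump φ) {N : ℝ} (hN : 0 < N) (x : E3) :
    ∫ y, lpKernel φ N (x - y) = 1 := by
  rw [integral_sub_left_eq_self (lpKernel φ N) volume x]
  have h := Measure.integral_comp_smul (volume : Measure E3) (lpKernel φ 1) N
  rw [hφ.integral_lpKernel, finrank_euclideanSpace, Fintype.card_fin,
    abs_of_pos (by positivity)] at h
  simp only [hφ.lpKernel_smul hN]
  rw [integral_const_mul, h]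
  simp only [smul_eq_mul, mul_one]
  field_simp

end IsLittlewoodPaleyBump

theorem MorreyBound.integrable_sq_mul_wt {p M : ℝ} (hp : 2 ≤ p) (hM : 0 < M) {v : E3 → E3}
    (hv : Continuous v) (h : MorreyBound p M v) : Integrable fun y => ‖v y‖ ^ 2 * wt 5 y := by
  obtain ⟨C, hC, hle⟩ := exists_lintegral_wt_le
  have h1 := hle p M 2 v 5 1 0 hM two_pos hp hv h (by norm_num) one_pos
  have hc := continuous_wt 5
  refine ⟨(by fun_prop : Continuous fun y => ‖v y‖ ^ 2 * wt 5 y).aestronglyMeasurable, ?_⟩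
  refine lt_of_le_of_lt (le_trans (le_of_eq (lintegral_congr fun y => ?_)) h1)
    ENNReal.ofReal_lt_top
  have e : wt 5 ((1 : ℝ) • (0 - y)) = wt 5 y := by
    rw [wt, wt, one_smul, zero_sub, norm_neg]
  have e2 : ‖v y‖ₑ ^ (2 : ℝ) = ‖v y‖ₑ ^ 2 := by
    exact_mod_cast ENNReal.rpow_natCast ‖v y‖ₑ 2
  rw [e, e2, enorm_mul, Real.enorm_of_nonneg (wt_pos 5 y).le, mul_comm, enorm_pow, enorm_norm]

namespace IsLittlewoodPaleyBump

variable {φ : E3 → ℝ}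

/-- Pointwise form of the approximate identity argument. For `|x - y| < δ` continuity gives `η`;
farther away two of the six powers of the kernel decay are traded for `(Nδ)⁻²`, and four remain for
integrability. -/
theorem enorm_lpKernel_smul_sub_le {C₁ N η δ : ℝ} (hC₁ : 0 ≤ C₁) (hN : 0 < N) (hη : 0 < η)
    (hδ : 0 < δ) {x : E3} (h₁ : ∀ x, |lpKernel φ N x| ≤ C₁ * N ^ 3 * wt 6 (N • x)) {v : E3 → E3}
    (hcont : ∀ y, ‖x - y‖ < δ → ‖v y - v x‖ ≤ η) (y : E3) :
    ‖lpKernel φ N (x - y) • (v y - v x)‖ₑ ≤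
      ENNReal.ofReal (C₁ * N ^ 3 * η) * ENNReal.ofReal (wt 4 (N • (x - y))) +
      (ENNReal.ofReal (C₁ * N ^ 3 * ((N * δ) ^ 2)⁻¹) *
        (ENNReal.ofReal (wt 4 (N • (x - y))) * ‖v y‖ₑ) +
      ENNReal.ofReal (C₁ * N ^ 3 * ((N * δ) ^ 2)⁻¹ * ‖v x‖) *
        ENNReal.ofReal (wt 4 (N • (x - y)))) := by
  have hw4 := wt_pos 4 (N • (x - y))
  rw [← ofReal_norm, ← ofReal_norm (v y), ← ENNReal.ofReal_mul hw4.le,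
    ← ENNReal.ofReal_mul (by positivity), ← ENNReal.ofReal_mul (by positivity),
    ← ENNReal.ofReal_mul (by positivity), ← ENNReal.ofReal_add (by positivity) (by positivity),
    ← ENNReal.ofReal_add (by positivity) (by positivity)]
  refine ENNReal.ofReal_le_ofReal ?_
  rw [norm_smul, Real.norm_eq_abs]
  have hk := h₁ (x - y)
  rcases lt_or_ge ‖x - y‖ δ with h | h
  · have h3 := hcont y h
    have h4 : wt 6 (N • (x - y)) ≤ wt 4 (N • (x - y)) := wt_le_wt (by norm_num) _
    calc |lpKernel φ N (x - y)| * ‖v y - v x‖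
        ≤ C₁ * N ^ 3 * wt 4 (N • (x - y)) * η := by
          gcongr; exact hk.trans (by gcongr)
      _ ≤ _ := by
          have : 0 ≤ C₁ * N ^ 3 * ((N * δ) ^ 2)⁻¹ * (wt 4 (N • (x - y)) * ‖v y‖) +
            C₁ * N ^ 3 * ((N * δ) ^ 2)⁻¹ * ‖v x‖ * wt 4 (N • (x - y)) := by positivity
          linarith
  · have h4 : wt 6 (N • (x - y)) ≤ ((N * δ) ^ 2)⁻¹ * wt 4 (N • (x - y)) := by
      have e6 : wt 6 (N • (x - y)) = ((1 + ‖N • (x - y)‖) ^ 2)⁻¹ * wt 4 (N • (x - y)) := by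
        unfold wt; rw [← mul_inv, ← pow_add]
      rw [e6]
      gcongr
      rw [norm_smul, Real.norm_of_nonneg hN.le]
      nlinarith
    calc |lpKernel φ N (x - y)| * ‖v y - v x‖
        ≤ C₁ * N ^ 3 * (((N * δ) ^ 2)⁻¹ * wt 4 (N • (x - y))) * (‖v y‖ + ‖v x‖) := by
          gcongr
          · exact hk.trans (by gcongr)
          · exact norm_sub_le _ _
      _ ≤ _ := by
          have : 0 ≤ C₁ * N ^ 3 * η * wt 4 (N • (x - y)) := by positivity
          linarith

/-- An approximate identity at a point of continuity. The field need not be bounded or decay: far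
contributions are controlled by the weighted averages that the Morrey bound provides. -/
theorem tendsto_lpLow (hφ : IsLittlewoodPaleyBump φ) {p M : ℝ} (hp : 2 ≤ p) (hM : 0 < M)
    {v : E3 → E3} (hv : Continuous v) (hB : MorreyBound p M v) (x : E3) :
    Filter.Tendsto (fun N : ℝ => lpLow φ N v x) Filter.atTop (nhds (v x)) := by
  obtain ⟨C₁, hC₁, h₁⟩ := hφ.exists_abs_lpKernel_le 6
  obtain ⟨C₂, hC₂, h₂⟩ := exists_lintegral_wt_le
  have hV := wtMass_nonneg
  have hL := hB.integrable_sq_mul_wt hp hM hv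
  have hc4 := continuous_wt 4
  have main : ∀ η : ℝ, 0 < η → ∀ δ : ℝ, 0 < δ → (∀ y, ‖x - y‖ < δ → ‖v y - v x‖ ≤ η) →
      ∀ N : ℝ, 1 ≤ N → ‖lpLow φ N v x - v x‖ₑ ≤ ENNReal.ofReal (C₁ * wtMass * η +
        C₁ * (C₂ * M + ‖v x‖ * wtMass) / δ ^ 2 * N⁻¹) := by
    intro η hη δ hδ hcont N hN1
    have hN : 0 < N := by linarith
    have hi1 := hφ.integrable_lpKernel_smul hN x hv hL
    have hi2 := hφ.integrable_lpKernel_smul hN x (v := fun _ => v x) continuous_const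
      ((integrable_wt (by norm_num)).const_mul _)
    have e1 : lpLow φ N v x - v x = ∫ y, lpKernel φ N (x - y) • (v y - v x) := by
      simp only [smul_sub]
      rw [integral_sub hi1 hi2, integral_smul_const, hφ.integral_lpKernel_sub hN, one_smul]
      rfl
    have hpt := enorm_lpKernel_smul_sub_le hC₁ hN hη hδ (h₁ N hN) hcont
    have hm4 := measurable_wt_smul_const_sub 4 N x
    have h5 := h₂ p M 1 v 4 N x hM one_pos (by linarith) hv hB le_rfl hN
    simp only [ENNReal.rpow_one, Real.rpow_one] at h5
    have h6 := lintegral_wt_smul_sub_le (le_refl 4) hN x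
    rw [e1]
    refine (enorm_integral_le_lintegral_enorm _).trans ((lintegral_mono hpt).trans ?_)
    rw [lintegral_add_left (hm4.const_mul _), lintegral_add_right _ (hm4.const_mul _),
      lintegral_const_mul' _ _ ENNReal.ofReal_ne_top, lintegral_const_mul' _ _ ENNReal.ofReal_ne_top,
      lintegral_const_mul' _ _ ENNReal.ofReal_ne_top]
    refine (add_le_add (mul_le_mul_right h6 _) (add_le_add (mul_le_mul_right h5 _)
      (mul_le_mul_right h6 _))).trans ?_
    rw [← ENNReal.ofReal_mul (by positivity), ← ENNReal.ofReal_mul (by positivity),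
      ← ENNReal.ofReal_mul (by positivity), ← ENNReal.ofReal_add (by positivity) (by positivity),
      ← ENNReal.ofReal_add (by positivity) (by positivity)]
    refine ENNReal.ofReal_le_ofReal ?_
    have e7 : N ^ (1 - 3 : ℝ) = (N ^ 2)⁻¹ := by
      rw [show (1 - 3 : ℝ) = -((2 : ℕ) : ℝ) by norm_num, Real.rpow_neg hN.le, Real.rpow_natCast]
    have e8 : (N ^ 2)⁻¹ ≤ N⁻¹ := by
      gcongr; nlinarith
    rw [e7]
    calc _ = C₁ * wtMass * η + C₁ * (C₂ * M) / δ ^ 2 * N⁻¹ +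
          C₁ * (‖v x‖ * wtMass) / δ ^ 2 * (N ^ 2)⁻¹ := by field_simp; ring
      _ ≤ C₁ * wtMass * η + C₁ * (C₂ * M) / δ ^ 2 * N⁻¹ +
          C₁ * (‖v x‖ * wtMass) / δ ^ 2 * N⁻¹ := by gcongr
      _ = _ := by ring
  rw [Metric.tendsto_atTop]
  intro e he
  set η : ℝ := e / (2 * (C₁ * wtMass + 1)) with hη
  have hη0 : 0 < η := by positivity
  obtain ⟨δ, hδ, hcont⟩ := Metric.continuous_iff.1 hv x η hη0
  set Q : ℝ := C₁ * (C₂ * M + ‖v x‖ * wtMass) / δ ^ 2 with hQ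
  have hQ0 : 0 ≤ Q := by positivity
  refine ⟨max 1 (4 * Q / e), fun N hN => ?_⟩
  have hN1 : 1 ≤ N := (le_max_left _ _).trans hN
  have hN2 : 4 * Q / e ≤ N := (le_max_right _ _).trans hN
  have h := main η hη0 δ hδ (fun y hy => by
    have := hcont y (by rwa [dist_comm, dist_eq_norm])
    rw [dist_eq_norm] at this; exact this.le) N hN1
  rw [← ofReal_norm, ENNReal.ofReal_le_ofReal_iff (by positivity)] at h
  rw [dist_eq_norm]
  have h1 : C₁ * wtMass * η ≤ e / 2 := by
    have : (C₁ * wtMass + 1) * η = e / 2 := by rw [hη]; field_simp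
    nlinarith
  have h2 : Q * N⁻¹ ≤ e / 4 := by
    rw [div_le_iff₀ he] at hN2
    rw [← div_eq_mul_inv, div_le_iff₀ (by linarith)]
    linarith
  linarith

end IsLittlewoodPaleyBump

/-! ### A finite weighted measure -/

/-- The measure with density `wt 5`. -/
noncomputable def wtMeasure : Measure E3 := volume.withDensity fun y => ENNReal.ofReal (wt 5 y)

theorem measurable_ofReal_wt (n : ℕ) : Measurable fun y : E3 => ENNReal.ofReal (wt n y) :=
  ENNReal.measurable_ofReal.comp (continuous_wt n).measurable

theorem lintegral_wtMeasure (f : E3 → ENNReal) :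
    ∫⁻ y, f y ∂wtMeasure = ∫⁻ y, ENNReal.ofReal (wt 5 y) * f y := by
  rw [wtMeasure, lintegral_withDensity_eq_lintegral_mul_non_measurable _ (measurable_ofReal_wt 5)
    (Filter.Eventually.of_forall fun _ => ENNReal.ofReal_lt_top)]
  rfl

theorem wtMeasure_univ_le : wtMeasure univ ≤ ENNReal.ofReal wtMass := by
  rw [wtMeasure, withDensity_apply _ MeasurableSet.univ, Measure.restrict_univ]
  exact lintegral_wt_le_wtMass (by norm_num)

instance : IsFiniteMeasure wtMeasure :=
  ⟨lt_of_le_of_lt wtMeasure_univ_le ENNReal.ofReal_lt_top⟩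

/-- One of the five powers of the weight is exchanged for `R⁻¹`; the remaining four are integrable.
-/
theorem wtMeasure_compl_ball_le {R : ℝ} (hR : 0 < R) :
    wtMeasure {y | R < ‖y‖} ≤ ENNReal.ofReal (wtMass / R) := by
  have hm : MeasurableSet {y : E3 | R < ‖y‖} :=
    measurableSet_lt measurable_const continuous_norm.measurable
  rw [wtMeasure, withDensity_apply _ hm]
  calc ∫⁻ y in {y | R < ‖y‖}, ENNReal.ofReal (wt 5 y)
      ≤ ∫⁻ y in {y | R < ‖y‖}, ENNReal.ofReal R⁻¹ * ENNReal.ofReal (wt 4 y) := by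
        refine setLIntegral_mono' hm fun y hy => ?_
        rw [← ENNReal.ofReal_mul (by positivity)]
        refine ENNReal.ofReal_le_ofReal ?_
        have e : wt 5 y = (1 + ‖y‖)⁻¹ * wt 4 y := by
          unfold wt; rw [← mul_inv, ← pow_succ']
        rw [e]
        have hy' : R < ‖y‖ := hy
        have := (wt_pos 4 y).le
        gcongr
        linarith
    _ ≤ ENNReal.ofReal R⁻¹ * ∫⁻ y : E3, ENNReal.ofReal (wt 4 y) := by
        rw [lintegral_const_mul' _ _ ENNReal.ofReal_ne_top]
        gcongr
        exact Measure.restrict_le_self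
    _ ≤ ENNReal.ofReal R⁻¹ * ENNReal.ofReal wtMass := by
        gcongr; exact lintegral_wt_le_wtMass le_rfl
    _ = _ := by rw [← ENNReal.ofReal_mul (by positivity)]; congr 1; ring

/-- The weight is compatible with averaging at scales at most one. -/
theorem lintegral_wt_mul_wt_le {N : ℝ} (hN : 1 ≤ N) (y : E3) :
    ∫⁻ x, ENNReal.ofReal (wt 9 (N • (x - y))) ∂wtMeasure ≤
      ENNReal.ofReal (wtMass * (N ^ 3)⁻¹) * ENNReal.ofReal (wt 5 y) := by
  have hN0 : 0 < N := by linarith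
  rw [lintegral_wtMeasure]
  have hpt : ∀ x, ENNReal.ofReal (wt 5 x) * ENNReal.ofReal (wt 9 (N • (x - y))) ≤
      ENNReal.ofReal (wt 5 y) * ENNReal.ofReal (wt 4 (N • (y - x))) := by
    intro x
    rw [← ENNReal.ofReal_mul (wt_pos _ _).le, ← ENNReal.ofReal_mul (wt_pos _ _).le,
      wt_smul_comm 4]
    refine ENNReal.ofReal_le_ofReal ?_
    -- This is where the kernel decay `9 = 5 + 4` is used: five powers move the weight from `x` to
    -- `y`, by `1 + |y| ≤ (1 + |x|)(1 + N|x - y|)` for `N ≥ 1`, and four stay integrable.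
    have e : wt 9 (N • (x - y)) = wt 5 (N • (x - y)) * wt 4 (N • (x - y)) := by
      unfold wt; rw [← mul_inv, ← pow_add]
    rw [e, ← mul_assoc]
    have := (wt_pos 4 (N • (x - y))).le
    gcongr
    unfold wt
    rw [← mul_inv, ← mul_pow]
    gcongr
    rw [norm_smul, Real.norm_of_nonneg hN0.le]
    have h1 : ‖y‖ ≤ ‖x‖ + ‖x - y‖ := by
      have := norm_sub_le x (x - y)
      rwa [sub_sub_cancel] at this
    nlinarith [norm_nonneg x, norm_nonneg (x - y), mul_nonneg (norm_nonneg x)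
      (mul_nonneg hN0.le (norm_nonneg (x - y)))]
  refine (lintegral_mono hpt).trans ?_
  rw [lintegral_const_mul' _ _ ENNReal.ofReal_ne_top, mul_comm]
  gcongr
  exact lintegral_wt_smul_sub_le le_rfl hN0 y

theorem lintegral_conv_wtMeasure_le {N : ℝ} (hN : 1 ≤ N) {f : E3 → ENNReal} (hf : Measurable f) :
    ∫⁻ x, (∫⁻ y, ENNReal.ofReal (wt 9 (N • (x - y))) * f y) ∂wtMeasure ≤
      ENNReal.ofReal (wtMass * (N ^ 3)⁻¹) * ∫⁻ y, f y ∂wtMeasure := by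
  have hm : Measurable (Function.uncurry fun x y : E3 =>
      ENNReal.ofReal (wt 9 (N • (x - y))) * f y) :=
    (measurable_wt_smul_sub 9 N).mul (hf.comp measurable_snd)
  rw [lintegral_lintegral_swap hm.aemeasurable, lintegral_wtMeasure,
    ← lintegral_const_mul' _ _ ENNReal.ofReal_ne_top]
  refine lintegral_mono fun y => ?_
  have hm2 : Measurable fun x : E3 => ENNReal.ofReal (wt 9 (N • (x - y))) := by
    simp only [wt_smul_comm 9 N _ y]
    exact measurable_wt_smul_const_sub 9 N y
  rw [lintegral_mul_const _ hm2, ← mul_assoc]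
  gcongr
  exact lintegral_wt_mul_wt_le hN y

theorem lintegral_conv_time_wtMeasure_le {N : ℝ} (hN : 1 ≤ N) {f : ℝ × E3 → ENNReal}
    (hf : Measurable f) {g : ℝ → ENNReal} (hg : Measurable g) (I : Set ℝ) :
    ∫⁻ x, (∫⁻ s in I, g s * ∫⁻ y, ENNReal.ofReal (wt 9 (N • (x - y))) * f (s, y)) ∂wtMeasure ≤
      ENNReal.ofReal (wtMass * (N ^ 3)⁻¹) * ∫⁻ s in I, g s * ∫⁻ y, f (s, y) ∂wtMeasure := by
  have h1 : Measurable fun w : (E3 × ℝ) × E3 =>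
      ENNReal.ofReal (wt 9 (N • (w.1.1 - w.2))) * f (w.1.2, w.2) := by
    have hc := continuous_wt 9
    have hw : Measurable fun w : (E3 × ℝ) × E3 => ENNReal.ofReal (wt 9 (N • (w.1.1 - w.2))) :=
      ENNReal.measurable_ofReal.comp
        (by fun_prop : Continuous fun w : (E3 × ℝ) × E3 => wt 9 (N • (w.1.1 - w.2))).measurable
    have hs : Measurable fun w : (E3 × ℝ) × E3 => (w.1.2, w.2) := by fun_prop
    exact hw.mul (hf.comp hs)
  obtain ⟨J, hJ⟩ : ∃ J : E3 × ℝ → ENNReal, ∀ z,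
      J z = ∫⁻ y, ENNReal.ofReal (wt 9 (N • (z.1 - y))) * f (z.2, y) := ⟨_, fun _ => rfl⟩
  have h2 : Measurable J := by
    rw [funext hJ]
    exact h1.lintegral_prod_right'
  have hJ' : ∀ x s, (∫⁻ y, ENNReal.ofReal (wt 9 (N • (x - y))) * f (s, y)) = J (x, s) :=
    fun x s => (hJ (x, s)).symm
  have hfs : ∀ s, Measurable fun y => f (s, y) := fun s => hf.comp measurable_prodMk_left
  have h4 : ∀ s, ∫⁻ x, J (x, s) ∂wtMeasure ≤
      ENNReal.ofReal (wtMass * (N ^ 3)⁻¹) * ∫⁻ y, f (s, y) ∂wtMeasure := by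
    intro s
    have := lintegral_conv_wtMeasure_le hN (hfs s)
    simpa only [hJ'] using this
  simp only [hJ']
  have hm : Measurable (Function.uncurry fun (x : E3) (s : ℝ) => g s * J (x, s)) :=
    (hg.comp measurable_snd).mul h2
  rw [lintegral_lintegral_swap hm.aemeasurable, ← lintegral_const_mul' _ _ ENNReal.ofReal_ne_top]
  refine lintegral_mono fun s => ?_
  have h3 : Measurable fun x : E3 => J (x, s) := by fun_prop
  rw [lintegral_const_mul _ h3, mul_left_comm]
  exact mul_le_mul_right (h4 s) _

/-- Jensen's inequality for averages with respect to the weight. -/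
theorem lintegral_wt_rpow_le {p : ℝ} (hp : 1 < p) {n : ℕ} (hn : 4 ≤ n) {N : ℝ} (hN : 0 < N)
    (x : E3) {f : E3 → ENNReal} (hf : Measurable f) :
    (∫⁻ y, ENNReal.ofReal (wt n (N • (x - y))) * f y) ^ p ≤
      ENNReal.ofReal (wtMass * (N ^ 3)⁻¹) ^ (p - 1) *
        ∫⁻ y, ENNReal.ofReal (wt n (N • (x - y))) * f y ^ p := by
  have hmw := measurable_wt_smul_const_sub n N x
  have hp0 : 0 < p := by linarith
  have hconj : p.HolderConjugate (p / (p - 1)) := Real.HolderConjugate.conjExponent hp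
  have hpt : ∀ y, ENNReal.ofReal (wt n (N • (x - y))) * f y =
      ((fun y => ENNReal.ofReal (wt n (N • (x - y))) ^ (1 / p) * f y) *
        fun y => ENNReal.ofReal (wt n (N • (x - y))) ^ (1 - 1 / p)) y := by
    intro y
    have hw := wt_pos n (N • (x - y))
    rw [Pi.mul_apply, mul_right_comm, ← ENNReal.rpow_add _ _ (by simpa using hw)
      ENNReal.ofReal_ne_top, add_sub_cancel, ENNReal.rpow_one]
  have h1 := ENNReal.lintegral_mul_le_Lp_mul_Lq (volume : Measure E3) hconj
    ((hmw.pow_const (1 / p)).mul hf).aemeasurable (hmw.pow_const (1 - 1 / p)).aemeasurable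
  rw [lintegral_congr hpt]
  refine (ENNReal.rpow_le_rpow h1 hp0.le).trans ?_
  rw [ENNReal.mul_rpow_of_nonneg _ _ hp0.le, ← ENNReal.rpow_mul, ← ENNReal.rpow_mul,
    one_div_mul_cancel hp0.ne', ENNReal.rpow_one, mul_comm]
  have hp1 : 0 < p - 1 := by linarith
  have e1 : 1 / (p / (p - 1)) * p = p - 1 := by field_simp
  rw [e1]
  gcongr
  · refine le_trans (le_of_eq (lintegral_congr fun y => ?_)) (lintegral_wt_smul_sub_le hn hN x)
    rw [← ENNReal.rpow_mul]
    have : (1 - 1 / p) * (p / (p - 1)) = 1 := by field_simp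
    rw [this, ENNReal.rpow_one]
  · refine le_of_eq ?_
    rw [Pi.mul_apply, ENNReal.mul_rpow_of_nonneg _ _ hp0.le, ← ENNReal.rpow_mul,
      one_div_mul_cancel hp0.ne', ENNReal.rpow_one]

theorem lintegral_exp_le {N : ℝ} (hN : 0 < N) (t : ℝ) {σ : ℝ} (hσ : 0 < σ) :
    ∫⁻ s in Ioc (t - σ) t, ENNReal.ofReal (Real.exp (-(N ^ 2 * (t - s)) / 32)) ≤
      ENNReal.ofReal (32 * (N ^ 2)⁻¹) := by
  have hc : Continuous fun s => Real.exp (-(N ^ 2 * (t - s)) / 32) := by fun_prop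
  rw [← ofReal_integral_eq_lintegral_ofReal (hc.integrableOn_Icc.mono_set Ioc_subset_Icc_self)
    (Filter.Eventually.of_forall fun s => (Real.exp_pos _).le)]
  refine ENNReal.ofReal_le_ofReal ?_
  rw [← intervalIntegral.integral_of_le (by linarith)]
  have hd : ∀ s ∈ uIcc (t - σ) t, HasDerivAt
      (fun s => 32 * (N ^ 2)⁻¹ * Real.exp (-(N ^ 2 * (t - s)) / 32))
      (Real.exp (-(N ^ 2 * (t - s)) / 32)) s := by
    intro s _
    have h1 : HasDerivAt (fun s => -(N ^ 2 * (t - s)) / 32) (N ^ 2 / 32) s := by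
      have := ((((hasDerivAt_id s).const_sub t).const_mul (N ^ 2)).neg).div_const 32
      exact this.congr_deriv (by ring)
    refine (h1.exp.const_mul (32 * (N ^ 2)⁻¹)).congr_deriv ?_
    field_simp
  rw [intervalIntegral.integral_eq_sub_of_hasDerivAt hd (hc.intervalIntegrable _ _)]
  have : 0 < 32 * (N ^ 2)⁻¹ * Real.exp (-(N ^ 2 * (t - (t - σ))) / 32) := by positivity
  simp only [sub_self, mul_zero, neg_zero, zero_div, Real.exp_zero, mul_one]
  linarith

theorem exp_neg_le_inv {x : ℝ} (hx : 0 < x) : Real.exp (-x) ≤ x⁻¹ := by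
  rw [Real.exp_neg]
  exact inv_anti₀ hx (by linarith [Real.add_one_le_exp x])

/-! ### Mild flows and rescaling -/

/-- A global family of fields with a uniform Morrey bound that satisfies the Duhamel estimate for
its Littlewood-Paley pieces on the time interval `[a, b]`. -/
structure IsMildFlow (φ : E3 → ℝ) (C p M a b : ℝ) (v : ℝ → E3 → E3) : Prop where
  measurable : Measurable fun z : ℝ × E3 => v z.1 z.2
  continuous : ∀ t, Continuous (v t)
  morrey : ∀ t, MorreyBound p M (v t)
  duhamel : ∀ N : ℝ, 0 < N → ∀ t σ : ℝ, 0 < σ → a ≤ t - σ → t ≤ b → ∀ x : E3,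
    ‖lpProj φ N (v t) x‖ₑ ≤ ENNReal.ofReal (C * N ^ 3 * Real.exp (-(N ^ 2 * σ) / 32)) *
      (∫⁻ y, ENNReal.ofReal (wt 9 (N • (x - y))) * ‖v (t - σ) y‖ₑ) +
      ∫⁻ s in Ioc (t - σ) t, ENNReal.ofReal (C * N ^ 4 * Real.exp (-(N ^ 2 * (t - s)) / 32)) *
        ∫⁻ y, ENNReal.ofReal (wt 9 (N • (x - y))) * ‖v s y‖ₑ ^ 2

theorem setLIntegral_Ioc_comp_add_mul (G : ℝ → ENNReal) (t₁ α β : ℝ) {c : ℝ} (hc : 0 < c) :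
    ∫⁻ s in Ioc (t₁ + c * α) (t₁ + c * β), G s =
      ENNReal.ofReal c * ∫⁻ s in Ioc α β, G (t₁ + c * s) := by
  have h1 := (Homeomorph.mulLeft₀ c hc.ne').measurableEmbedding.lintegral_map
    (μ := volume) fun s => (Ioc (t₁ + c * α) (t₁ + c * β)).indicator G (t₁ + s)
  have h3 : ⇑(Homeomorph.mulLeft₀ c hc.ne') = (c * ·) := rfl
  rw [h3, Real.map_volume_mul_left hc.ne', lintegral_smul_measure, abs_of_pos (by positivity),
    lintegral_add_left_eq_self, lintegral_indicator measurableSet_Ioc] at h1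
  have h4 : ∀ s, (Ioc (t₁ + c * α) (t₁ + c * β)).indicator G (t₁ + c * s) =
      (Ioc α β).indicator (fun s => G (t₁ + c * s)) s := by
    intro s
    have : t₁ + c * s ∈ Ioc (t₁ + c * α) (t₁ + c * β) ↔ s ∈ Ioc α β := by
      simp [mem_Ioc, hc]
    by_cases hs : s ∈ Ioc α β
    · rw [indicator_of_mem hs, indicator_of_mem (this.2 hs)]
    · rw [indicator_of_notMem hs, indicator_of_notMem fun h => hs (this.1 h)]
  rw [lintegral_congr h4, lintegral_indicator measurableSet_Ioc] at h1
  rw [← h1, smul_eq_mul, ← mul_assoc, ← ENNReal.ofReal_mul hc.le, mul_inv_cancel₀ hc.ne',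
    ENNReal.ofReal_one, one_mul]

theorem IsLittlewoodPaleyBump.lpLow_rescale {φ : E3 → ℝ} (hφ : IsLittlewoodPaleyBump φ) {N L : ℝ}
    (hN : 0 < N) (hL : 0 < L) (f : E3 → E3) (x₁ x : E3) :
    lpLow φ N (fun y => L⁻¹ • f (x₁ + L⁻¹ • y)) x =
      L⁻¹ • lpLow φ (N * L) f (x₁ + L⁻¹ • x) := by
  have hk : ∀ y, lpKernel φ N (x - y) • L⁻¹ • f (x₁ + L⁻¹ • y) =
      (fun z => (L⁻¹ * (L ^ 3)⁻¹) • lpKernel φ (N * L) (L⁻¹ • x - z) • f (x₁ + z)) (L⁻¹ • y) := by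
    intro y
    simp only
    rw [hφ.lpKernel_smul hN, hφ.lpKernel_smul (mul_pos hN hL), ← smul_sub, smul_smul (N * L),
      mul_assoc N, mul_inv_cancel₀ hL.ne', mul_one, smul_smul, smul_smul]
    congr 1
    field_simp
  have h1 := Measure.integral_comp_smul (volume : Measure E3)
    (fun z => (L⁻¹ * (L ^ 3)⁻¹) • lpKernel φ (N * L) (L⁻¹ • x - z) • f (x₁ + z)) L⁻¹
  rw [lpLow, integral_congr_ae (Filter.Eventually.of_forall hk), h1,
    finrank_euclideanSpace, Fintype.card_fin, integral_smul, smul_smul, lpLow]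
  have e : |((L⁻¹) ^ 3)⁻¹| * (L⁻¹ * (L ^ 3)⁻¹) = L⁻¹ := by
    rw [abs_of_pos (by positivity)]; field_simp
  rw [e]
  congr 1
  have h2 := integral_add_left_eq_self (μ := (volume : Measure E3))
    (fun z => lpKernel φ (N * L) (x₁ + L⁻¹ • x - z) • f z) x₁
  rw [← h2]
  refine integral_congr_ae (Filter.Eventually.of_forall fun z => ?_)
  simp only [add_sub_add_left_eq_sub]

theorem IsLittlewoodPaleyBump.lpProj_rescale {φ : E3 → ℝ} (hφ : IsLittlewoodPaleyBump φ) {N L : ℝ}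
    (hN : 0 < N) (hL : 0 < L) (f : E3 → E3) (x₁ x : E3) :
    lpProj φ N (fun y => L⁻¹ • f (x₁ + L⁻¹ • y)) x =
      L⁻¹ • lpProj φ (N * L) f (x₁ + L⁻¹ • x) := by
  rw [lpProj, lpProj, hφ.lpLow_rescale hN hL, hφ.lpLow_rescale (half_pos hN) hL, smul_sub,
    div_mul_eq_mul_div]

/-- The power `R^(3-p)` is the one invariant under the Navier-Stokes scaling, so the same `M`
survives. -/
theorem MorreyBound.rescale {p M L : ℝ} (hp : 0 ≤ p) (hM : 0 ≤ M) (hL : 0 < L) {f : E3 → E3}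
    (h : MorreyBound p M f) (x₁ : E3) : MorreyBound p M fun y => L⁻¹ • f (x₁ + L⁻¹ • y) := by
  intro x R hR
  have hLi : 0 < L⁻¹ := by positivity
  have h1 := h (x₁ + L⁻¹ • x) (L⁻¹ * R) (by positivity)
  have h2 := lintegral_comp_add_smul
    ((Metric.ball (x₁ + L⁻¹ • x) (L⁻¹ * R)).indicator fun y => ‖f y‖ₑ ^ p) x₁ hLi
  rw [lintegral_indicator measurableSet_ball] at h2
  have h3 : ∀ y, (Metric.ball (x₁ + L⁻¹ • x) (L⁻¹ * R)).indicator (fun y => ‖f y‖ₑ ^ p)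
      (x₁ + L⁻¹ • y) = (Metric.ball x R).indicator (fun y => ‖f (x₁ + L⁻¹ • y)‖ₑ ^ p) y := by
    intro y
    have : x₁ + L⁻¹ • y ∈ Metric.ball (x₁ + L⁻¹ • x) (L⁻¹ * R) ↔ y ∈ Metric.ball x R := by
      rw [Metric.mem_ball, Metric.mem_ball, dist_add_left, dist_smul₀,
        Real.norm_of_nonneg hLi.le, mul_lt_mul_iff_right₀ hLi]
    by_cases hy : y ∈ Metric.ball x R
    · rw [indicator_of_mem hy, indicator_of_mem (this.2 hy)]
    · rw [indicator_of_notMem hy, indicator_of_notMem fun h => hy (this.1 h)]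
  rw [lintegral_congr h3, lintegral_indicator measurableSet_ball] at h2
  have h4 : ∀ y, ‖L⁻¹ • f (x₁ + L⁻¹ • y)‖ₑ ^ p =
      ENNReal.ofReal (L⁻¹ ^ p) * ‖f (x₁ + L⁻¹ • y)‖ₑ ^ p := by
    intro y
    rw [enorm_smul, ENNReal.mul_rpow_of_nonneg _ _ hp, Real.enorm_of_nonneg hLi.le,
      ENNReal.ofReal_rpow_of_pos hLi]
  rw [lintegral_congr h4, lintegral_const_mul' _ _ ENNReal.ofReal_ne_top, h2]
  refine (mul_le_mul_right (mul_le_mul_right h1 _) _).trans ?_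
  rw [← ENNReal.ofReal_mul (by positivity), ← ENNReal.ofReal_mul (by positivity)]
  refine ENNReal.ofReal_le_ofReal (le_of_eq ?_)
  rw [Real.mul_rpow hLi.le hR.le, Real.rpow_sub hLi]
  have e3 : L⁻¹ ^ (3 : ℝ) = L⁻¹ ^ 3 := by exact_mod_cast Real.rpow_natCast L⁻¹ 3
  rw [e3]
  have := Real.rpow_pos_of_pos hLi p
  field_simp

theorem MorreyBound.zero {p M : ℝ} (hp : 0 < p) : MorreyBound p M fun _ => 0 := by
  intro x R _
  simp [hp]

theorem exists_weightedL2 : ∃ C : ℝ, 0 ≤ C ∧ ∀ (p M a b : ℝ) (u : ℝ → E3 → E3), 2 ≤ p → 0 < M →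
    (∀ t ∈ Icc a b, Continuous (u t)) → (∀ t ∈ Icc a b, MorreyBound p M (u t)) →
      WeightedL2 a b (C * M ^ 2) u := by
  obtain ⟨C, hC, h⟩ := exists_lintegral_wt_le
  refine ⟨C, by linarith, fun p M a b u hp hM hc hB s hs => ?_⟩
  refine ⟨(hB s hs).integrable_sq_mul_wt hp hM (hc s hs), ?_⟩
  have hcw := continuous_wt 5
  have hcs := hc s hs
  have h1 := h p M 2 (u s) 5 1 0 hM two_pos hp (hc s hs) (hB s hs) (by norm_num) one_pos
  rw [Real.one_rpow, mul_one, Real.rpow_two] at h1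
  rw [integral_eq_lintegral_of_nonneg_ae (Filter.Eventually.of_forall fun y => by
    have := wt_pos 5 y; positivity) (by fun_prop : Continuous fun y =>
      ‖u s y‖ ^ 2 * wt 5 y).aestronglyMeasurable]
  refine ENNReal.toReal_le_of_le_ofReal (by positivity)
    (le_trans (le_of_eq (lintegral_congr fun y => ?_)) h1)
  have e : wt 5 ((1 : ℝ) • (0 - y)) = wt 5 y := by
    rw [wt, wt, one_smul, zero_sub, norm_neg]
  have e2 : ‖u s y‖ₑ ^ (2 : ℝ) = ‖u s y‖ₑ ^ 2 := by
    exact_mod_cast ENNReal.rpow_natCast ‖u s y‖ₑ 2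
  rw [e, e2, ENNReal.ofReal_mul (by positivity), mul_comm, ENNReal.ofReal_pow (norm_nonneg _),
    ofReal_norm]

/-- The rescaled solution about the space-time point `(t₁, x₁)` at frequency `L`, extended by zero
to all times. -/
noncomputable def rescaledFlow (a b : ℝ) (u : ℝ → E3 → E3) (t₁ : ℝ) (x₁ : E3) (L : ℝ) (t : ℝ)
    (x : E3) : E3 :=
  (Icc a b).indicator (fun s => L⁻¹ • u s (x₁ + L⁻¹ • x)) (t₁ + (L ^ 2)⁻¹ * t)

theorem rescaledFlow_of_mem {a b t₁ L t : ℝ} (u : ℝ → E3 → E3) (x₁ : E3)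
    (h : t₁ + (L ^ 2)⁻¹ * t ∈ Icc a b) : rescaledFlow a b u t₁ x₁ L t =
      fun x => L⁻¹ • u (t₁ + (L ^ 2)⁻¹ * t) (x₁ + L⁻¹ • x) :=
  funext fun _ => indicator_of_mem h _

theorem rescaledFlow_of_notMem {a b t₁ L t : ℝ} (u : ℝ → E3 → E3) (x₁ : E3)
    (h : t₁ + (L ^ 2)⁻¹ * t ∉ Icc a b) : rescaledFlow a b u t₁ x₁ L t = fun _ => 0 :=
  funext fun _ => indicator_of_notMem h _

/-- The Duhamel estimate is scale invariant, so a single constant serves all base points and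
frequencies. The weighted energy of the unscaled solution is used only through its finiteness; its
size does not enter `C`. -/
theorem exists_isMildFlow_rescaledFlow {φ : E3 → ℝ} (hφ : IsLittlewoodPaleyBump φ) :
    ∃ C : ℝ, 0 ≤ C ∧ ∀ (p M a b : ℝ) (u : ℝ → E3 → E3), 2 ≤ p → 0 < M →
      IsClassicalNavierStokes a b u → (∀ t ∈ Icc a b, MorreyBound p M (u t)) →
      ∀ (t₁ : ℝ) (x₁ : E3) (L : ℝ), 0 < L →
        IsMildFlow φ C p M (L ^ 2 * (a - t₁)) (L ^ 2 * (b - t₁)) (rescaledFlow a b u t₁ x₁ L) := by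
  obtain ⟨C, hC, hD⟩ := exists_duhamel_estimate hφ 9
  obtain ⟨C₂, hC₂, hW⟩ := exists_weightedL2
  refine ⟨C, hC, fun p M a b u hp hM hu hB t₁ x₁ L hL => ?_⟩
  have hc := fun t (ht : t ∈ Icc a b) => (hu.contDiff_slice ht).continuous
  have hL2 := hW p M a b u hp hM hc hB
  have hLi : 0 < L⁻¹ := by positivity
  refine ⟨?_, fun t => ?_, fun t => ?_, ?_⟩
  · have hcont : ContinuousOn (fun z : ℝ × E3 => L⁻¹ • u z.1 (x₁ + L⁻¹ • z.2))
        (Icc a b ×ˢ univ) := by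
      have h1 : Continuous fun z : ℝ × E3 => (z.1, x₁ + L⁻¹ • z.2) := by fun_prop
      refine ContinuousOn.fun_const_smul ?_ _
      exact hu.1.continuousOn.comp h1.continuousOn fun z hz => ⟨hz.1, mem_univ _⟩
    have hS : MeasurableSet (Icc a b ×ˢ (univ : Set E3)) := measurableSet_Icc.prod .univ
    have hm : Measurable ((Icc a b ×ˢ (univ : Set E3)).indicator
        fun z : ℝ × E3 => L⁻¹ • u z.1 (x₁ + L⁻¹ • z.2)) := by
      classical
      have := hcont.measurable_piecewise (g := fun _ => (0 : E3)) continuousOn_const hS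
      exact (piecewise_eq_indicator (f := fun z : ℝ × E3 => L⁻¹ • u z.1 (x₁ + L⁻¹ • z.2))
        (s := Icc a b ×ˢ (univ : Set E3))) ▸ this
    have hg : Measurable fun z : ℝ × E3 => (t₁ + (L ^ 2)⁻¹ * z.1, z.2) := by fun_prop
    have e : (fun z : ℝ × E3 => rescaledFlow a b u t₁ x₁ L z.1 z.2) =
        ((Icc a b ×ˢ (univ : Set E3)).indicator
          fun z : ℝ × E3 => L⁻¹ • u z.1 (x₁ + L⁻¹ • z.2)) ∘
          fun z : ℝ × E3 => (t₁ + (L ^ 2)⁻¹ * z.1, z.2) := by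
      ext1 z
      simp only [rescaledFlow, Function.comp, indicator, mem_prod, mem_univ, and_true]
    rw [e]
    exact hm.comp hg
  · by_cases h : t₁ + (L ^ 2)⁻¹ * t ∈ Icc a b
    · rw [rescaledFlow_of_mem u x₁ h]
      have := hc _ h
      fun_prop
    · rw [rescaledFlow_of_notMem u x₁ h]; exact continuous_const
  · by_cases h : t₁ + (L ^ 2)⁻¹ * t ∈ Icc a b
    · rw [rescaledFlow_of_mem u x₁ h]
      exact (hB _ h).rescale (by linarith) hM.le hL x₁
    · rw [rescaledFlow_of_notMem u x₁ h]; exact MorreyBound.zero (by linarith)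
  · intro N hN t σ hσ h1 h2 x
    have hLL : 0 < (L ^ 2)⁻¹ := by positivity
    have h1' : a ≤ t₁ + (L ^ 2)⁻¹ * (t - σ) := by
      have := mul_le_mul_of_nonneg_left h1 hLL.le
      rw [← mul_assoc, inv_mul_cancel₀ (by positivity)] at this
      linarith
    have h2' : t₁ + (L ^ 2)⁻¹ * t ≤ b := by
      have := mul_le_mul_of_nonneg_left h2 hLL.le
      rw [← mul_assoc, inv_mul_cancel₀ (by positivity)] at this
      linarith
    have hmem : ∀ s ∈ Icc (t - σ) t, t₁ + (L ^ 2)⁻¹ * s ∈ Icc a b := fun s hs =>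
      ⟨h1'.trans (by gcongr; exact hs.1), le_trans (by gcongr; exact hs.2) h2'⟩
    have hd := hD a b _ u hu hL2 (N * L) (mul_pos hN hL) (t₁ + (L ^ 2)⁻¹ * t) ((L ^ 2)⁻¹ * σ)
      (by positivity) (by linarith) h2' (x₁ + L⁻¹ • x)
    -- The change of variables is needed for `k = 1` (the linear term) and `k = 2` (the quadratic
    -- term). The powers of `L` it produces cancel those of the prefactors and of the time variable.
    have hconv : ∀ (k : ℕ) (f : E3 → E3),
        (∫⁻ y, ENNReal.ofReal (wt 9 ((N * L) • (x₁ + L⁻¹ • x - y))) * ‖f y‖ₑ ^ k) =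
        ENNReal.ofReal (L ^ k * (L ^ 3)⁻¹) *
          ∫⁻ y, ENNReal.ofReal (wt 9 (N • (x - y))) * ‖L⁻¹ • f (x₁ + L⁻¹ • y)‖ₑ ^ k := by
      intro k f
      have h3 := lintegral_comp_add_smul
        (fun y => ENNReal.ofReal (wt 9 ((N * L) • (x₁ + L⁻¹ • x - y))) * ‖f y‖ₑ ^ k) x₁ hLi
      have h4 : ∀ y, ENNReal.ofReal (wt 9 (N • (x - y))) * ‖L⁻¹ • f (x₁ + L⁻¹ • y)‖ₑ ^ k =
          ENNReal.ofReal (L⁻¹ ^ k) * (ENNReal.ofReal (wt 9 ((N * L) • (x₁ + L⁻¹ • x -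
            (x₁ + L⁻¹ • y)))) * ‖f (x₁ + L⁻¹ • y)‖ₑ ^ k) := by
        intro y
        rw [add_sub_add_left_eq_sub, ← smul_sub, smul_smul, mul_assoc N, mul_inv_cancel₀ hL.ne',
          mul_one, enorm_smul, mul_pow, Real.enorm_of_nonneg hLi.le, ENNReal.ofReal_pow hLi.le]
        ring
      rw [lintegral_congr h4, lintegral_const_mul' _ _ ENNReal.ofReal_ne_top, h3, ← mul_assoc,
        ← mul_assoc, ← ENNReal.ofReal_mul (by positivity), ← ENNReal.ofReal_mul (by positivity)]
      have : L ^ k * (L ^ 3)⁻¹ * L⁻¹ ^ k * (L⁻¹ ^ 3)⁻¹ = 1 := by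
        rw [inv_pow, inv_pow, inv_inv]; field_simp
      rw [this, ENNReal.ofReal_one, one_mul]
    rw [rescaledFlow_of_mem u x₁ (hmem t ⟨by linarith, le_rfl⟩), hφ.lpProj_rescale hN hL, enorm_smul,
      Real.enorm_of_nonneg hLi.le]
    refine (mul_le_mul_right hd _).trans ?_
    rw [mul_add]
    refine add_le_add (le_of_eq ?_) (le_of_eq ?_)
    · have h5 := hconv 1 (u (t₁ + (L ^ 2)⁻¹ * (t - σ)))
      simp only [pow_one] at h5
      rw [show t₁ + (L ^ 2)⁻¹ * t - (L ^ 2)⁻¹ * σ = t₁ + (L ^ 2)⁻¹ * (t - σ) by ring, h5,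
        rescaledFlow_of_mem u x₁ (hmem (t - σ) ⟨le_rfl, by linarith⟩),
        ← mul_assoc, ← mul_assoc, ← ENNReal.ofReal_mul (by positivity),
        ← ENNReal.ofReal_mul (by positivity)]
      congr 2
      have e1 : -((N * L) ^ 2 * ((L ^ 2)⁻¹ * σ)) / 32 = -(N ^ 2 * σ) / 32 := by field_simp
      rw [e1]
      field_simp
    · have e0 : t₁ + (L ^ 2)⁻¹ * t - (L ^ 2)⁻¹ * σ = t₁ + (L ^ 2)⁻¹ * (t - σ) := by ring
      rw [e0, setLIntegral_Ioc_comp_add_mul _ _ _ _ hLL, ← mul_assoc,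
        ← ENNReal.ofReal_mul (by positivity), ← lintegral_const_mul' _ _ ENNReal.ofReal_ne_top]
      refine setLIntegral_congr_fun measurableSet_Ioc fun s hs => ?_
      rw [hconv 2, rescaledFlow_of_mem u x₁ (hmem s ⟨hs.1.le, hs.2⟩), ← mul_assoc, ← mul_assoc,
        ← ENNReal.ofReal_mul (by positivity), ← ENNReal.ofReal_mul (by positivity)]
      congr 2
      have e1 : -((N * L) ^ 2 * (t₁ + (L ^ 2)⁻¹ * t - (t₁ + (L ^ 2)⁻¹ * s))) / 32 =
        -(N ^ 2 * (t - s)) / 32 := by field_simp; ring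
      rw [e1]
      field_simp

/-! ### Weighted bounds for Littlewood-Paley pieces -/

/-- Weighted moments of fields with a Morrey bound. -/
theorem exists_lintegral_wtMeasure_le : ∃ D : ℝ, 1 ≤ D ∧ ∀ (p M s : ℝ) (v : E3 → E3), 0 < M →
    0 < s → s ≤ p → Continuous v → MorreyBound p M v →
      ∫⁻ y, ‖v y‖ₑ ^ s ∂wtMeasure ≤ ENNReal.ofReal (D * M ^ s) := by
  obtain ⟨C, hC, h⟩ := exists_lintegral_wt_le
  refine ⟨C, hC, fun p M s v hM hs hsp hv hB => ?_⟩
  have h1 := h p M s v 5 1 0 hM hs hsp hv hB (by norm_num) one_pos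
  rw [Real.one_rpow, mul_one] at h1
  rw [lintegral_wtMeasure]
  refine le_trans (le_of_eq (lintegral_congr fun y => ?_)) h1
  rw [wt, wt, one_smul, zero_sub, norm_neg]

/-- Decay in frequency of the weighted `L¹` norm. Spatial averaging costs `N⁻³` and the time
integral of the heat factor gives `N⁻²`, so the prefactor `N⁴` becomes `N⁻¹`. In the linear term the
exponential is weakened to `32 N⁻¹/σ`, using `N ≥ 1`. -/
theorem exists_lintegral_lpProj_le (φ : E3 → ℝ) {C : ℝ} (hC : 0 ≤ C) : ∃ D : ℝ, 1 ≤ D ∧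
    ∀ (p M a b : ℝ) (v : ℝ → E3 → E3), 2 ≤ p → 0 < M → IsMildFlow φ C p M a b v →
      ∀ N t σ S : ℝ, 1 ≤ N → 0 < σ → a ≤ t - σ → t ≤ b → 0 ≤ S →
        (∀ s ∈ Ioc (t - σ) t, ∫⁻ y, ‖v s y‖ₑ ^ 2 ∂wtMeasure ≤ ENNReal.ofReal S) →
        ∫⁻ x, ‖lpProj φ N (v t) x‖ₑ ∂wtMeasure ≤ ENNReal.ofReal (D * N⁻¹ * (M / σ + S)) := by
  obtain ⟨D₀, hD₀, h₀⟩ := exists_lintegral_wtMeasure_le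
  have hW := wtMass_nonneg
  have hD₀0 : 0 < D₀ := by linarith
  have hD : 0 ≤ 32 * C * wtMass * D₀ := by positivity
  refine ⟨32 * C * wtMass * D₀ + 1, by linarith, fun p M a b v hp hM hv N t σ S hN hσ ha hb hS hSb => ?_⟩
  have hN0 : 0 < N := by linarith
  have hm1 : Measurable fun y => ‖v (t - σ) y‖ₑ := (hv.continuous _).enorm.measurable
  have hm2 : Measurable fun z : ℝ × E3 => ‖v z.1 z.2‖ₑ ^ 2 := hv.measurable.enorm.pow_const 2
  have hg : Measurable fun s : ℝ =>
      ENNReal.ofReal (C * N ^ 4 * Real.exp (-(N ^ 2 * (t - s)) / 32)) :=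
    ENNReal.measurable_ofReal.comp (by fun_prop : Continuous fun s : ℝ =>
      C * N ^ 4 * Real.exp (-(N ^ 2 * (t - s)) / 32)).measurable
  have h1 := h₀ p M 1 (v (t - σ)) hM one_pos (by linarith) (hv.continuous _) (hv.morrey _)
  simp only [ENNReal.rpow_one, Real.rpow_one] at h1
  have hmeas : Measurable fun x => ∫⁻ y, ENNReal.ofReal (wt 9 (N • (x - y))) * ‖v (t - σ) y‖ₑ :=
    ((measurable_wt_smul_sub 9 N).mul (hm1.comp measurable_snd)).lintegral_prod_right'
  calc ∫⁻ x, ‖lpProj φ N (v t) x‖ₑ ∂wtMeasure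
      ≤ ∫⁻ x, (ENNReal.ofReal (C * N ^ 3 * Real.exp (-(N ^ 2 * σ) / 32)) *
        (∫⁻ y, ENNReal.ofReal (wt 9 (N • (x - y))) * ‖v (t - σ) y‖ₑ) +
        ∫⁻ s in Ioc (t - σ) t, ENNReal.ofReal (C * N ^ 4 * Real.exp (-(N ^ 2 * (t - s)) / 32)) *
          ∫⁻ y, ENNReal.ofReal (wt 9 (N • (x - y))) * ‖v s y‖ₑ ^ 2) ∂wtMeasure :=
        lintegral_mono fun x => hv.duhamel N hN0 t σ hσ ha hb x
    _ ≤ ENNReal.ofReal (C * N ^ 3 * Real.exp (-(N ^ 2 * σ) / 32)) *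
          (ENNReal.ofReal (wtMass * (N ^ 3)⁻¹) * ENNReal.ofReal (D₀ * M)) +
        ENNReal.ofReal (wtMass * (N ^ 3)⁻¹) * (ENNReal.ofReal (C * N ^ 4) *
          ENNReal.ofReal (32 * (N ^ 2)⁻¹) * ENNReal.ofReal S) := by
        rw [lintegral_add_left (hmeas.const_mul _),
          lintegral_const_mul' _ _ ENNReal.ofReal_ne_top]
        refine add_le_add (mul_le_mul_right ?_ _) ?_
        · exact (lintegral_conv_wtMeasure_le hN hm1).trans (mul_le_mul_right h1 _)
        · refine (lintegral_conv_time_wtMeasure_le hN hm2 hg _).trans (mul_le_mul_right ?_ _)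
          calc _ ≤ ∫⁻ s in Ioc (t - σ) t, ENNReal.ofReal (C * N ^ 4) *
                ENNReal.ofReal (Real.exp (-(N ^ 2 * (t - s)) / 32)) * ENNReal.ofReal S := by
                refine setLIntegral_mono' measurableSet_Ioc fun s hs => ?_
                rw [← ENNReal.ofReal_mul (by positivity)]
                exact mul_le_mul_right (hSb s hs) _
            _ ≤ _ := by
                rw [lintegral_mul_const' _ _ ENNReal.ofReal_ne_top,
                  lintegral_const_mul' _ _ ENNReal.ofReal_ne_top]
                gcongr
                exact lintegral_exp_le hN0 t hσ
    _ ≤ _ := by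
        rw [← ENNReal.ofReal_mul (by positivity), ← ENNReal.ofReal_mul (by positivity),
          ← ENNReal.ofReal_mul (by positivity), ← ENNReal.ofReal_mul (by positivity),
          ← ENNReal.ofReal_mul (by positivity), ← ENNReal.ofReal_add (by positivity)
          (by positivity)]
        refine ENNReal.ofReal_le_ofReal ?_
        have e1 : Real.exp (-(N ^ 2 * σ) / 32) ≤ 32 * N⁻¹ / σ := by
          have h2 := exp_neg_le_inv (by positivity : 0 < N ^ 2 * σ / 32)
          rw [neg_div]
          refine h2.trans ?_
          rw [inv_div, ← div_eq_mul_inv, div_div]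
          gcongr
          nlinarith
        calc _ = C * wtMass * D₀ * M * Real.exp (-(N ^ 2 * σ) / 32) +
              32 * C * wtMass * N⁻¹ * S := by field_simp
          _ ≤ C * wtMass * D₀ * M * (32 * N⁻¹ / σ) + 32 * C * wtMass * N⁻¹ * S * D₀ := by
              refine add_le_add (by gcongr) ?_
              exact le_mul_of_one_le_right (by positivity) hD₀
          _ = 32 * C * wtMass * D₀ * N⁻¹ * (M / σ + S) := by ring
          _ ≤ _ := by
              have : 0 ≤ 1 * N⁻¹ * (M / σ + S) := by positivity
              linarith

/-- Jensen's inequality for the averaging kernel. There is no gain in `N`, but the exponent exceeds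
two in the application; interpolation with the decaying `L¹` norm then yields decay in `L²`. -/
theorem exists_lintegral_lpProj_rpow_le {φ : E3 → ℝ} (hφ : IsLittlewoodPaleyBump φ) {p : ℝ}
    (hp : 1 < p) : ∃ D : ℝ, 1 ≤ D ∧ ∀ (M : ℝ) (v : E3 → E3), 0 < M → Continuous v →
      MorreyBound p M v → ∀ N : ℝ, 1 ≤ N →
        ∫⁻ x, ‖lpProj φ N v x‖ₑ ^ p ∂wtMeasure ≤ ENNReal.ofReal (D * M ^ p) := by
  obtain ⟨D₀, hD₀, h₀⟩ := exists_lintegral_wtMeasure_le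
  obtain ⟨C, hC, h⟩ := hφ.exists_enorm_lpProj_le 9
  have hW := wtMass_nonneg
  have hp0 : 0 < p := by linarith
  refine ⟨(C * wtMass) ^ p * D₀ + 1, by
    have : 0 ≤ (C * wtMass) ^ p * D₀ := by positivity
    linarith, fun M v hM hv hB N hN => ?_⟩
  have hN0 : 0 < N := by linarith
  have hm : Measurable fun y => ‖v y‖ₑ := hv.enorm.measurable
  have h1 := h₀ p M p v hM hp0 le_rfl hv hB
  calc ∫⁻ x, ‖lpProj φ N v x‖ₑ ^ p ∂wtMeasure
      ≤ ∫⁻ x, ENNReal.ofReal (C * N ^ 3) ^ p * (ENNReal.ofReal (wtMass * (N ^ 3)⁻¹) ^ (p - 1) *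
          ∫⁻ y, ENNReal.ofReal (wt 9 (N • (x - y))) * ‖v y‖ₑ ^ p) ∂wtMeasure := by
        refine lintegral_mono fun x => ?_
        refine (ENNReal.rpow_le_rpow (h v N x hN0) hp0.le).trans ?_
        rw [ENNReal.mul_rpow_of_nonneg _ _ hp0.le]
        exact mul_le_mul_right (lintegral_wt_rpow_le hp (by norm_num) hN0 x hm) _
    _ ≤ ENNReal.ofReal (C * N ^ 3) ^ p * (ENNReal.ofReal (wtMass * (N ^ 3)⁻¹) ^ (p - 1) *
          (ENNReal.ofReal (wtMass * (N ^ 3)⁻¹) * ENNReal.ofReal (D₀ * M ^ p))) := by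
        have hp1 : 0 ≤ p - 1 := by linarith
        rw [lintegral_const_mul' _ _ (ENNReal.rpow_ne_top_of_nonneg hp0.le ENNReal.ofReal_ne_top),
          lintegral_const_mul' _ _ (ENNReal.rpow_ne_top_of_nonneg hp1 ENNReal.ofReal_ne_top)]
        refine mul_le_mul_right (mul_le_mul_right ?_ _) _
        exact (lintegral_conv_wtMeasure_le hN (hm.pow_const p)).trans (mul_le_mul_right h1 _)
    _ ≤ _ := by
        rw [ENNReal.ofReal_rpow_of_nonneg (by positivity) hp0.le,
          ENNReal.ofReal_rpow_of_nonneg (by positivity) (by linarith),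
          ← ENNReal.ofReal_mul (by positivity), ← ENNReal.ofReal_mul (by positivity),
          ← ENNReal.ofReal_mul (by positivity)]
        refine ENNReal.ofReal_le_ofReal ?_
        have e1 : (wtMass * (N ^ 3)⁻¹) ^ (p - 1) * (wtMass * (N ^ 3)⁻¹) =
            (wtMass * (N ^ 3)⁻¹) ^ p := by
          rw [← Real.rpow_add_one' (by positivity) (by linarith)]; congr 1; ring
        have e2 : (C * N ^ 3) ^ p * (wtMass * (N ^ 3)⁻¹) ^ p = (C * wtMass) ^ p := by
          rw [← Real.mul_rpow (by positivity) (by positivity)]; congr 1; field_simp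
        rw [← mul_assoc (_ ^ (p - 1)), e1, ← mul_assoc, e2, add_mul, mul_assoc]
        have : 0 ≤ 1 * M ^ p := by positivity
        linarith

/-- The final pointwise bound at the base point. -/
theorem exists_enorm_lpProj_one_le (φ : E3 → ℝ) {C : ℝ} (hC : 0 ≤ C) : ∃ D : ℝ, 1 ≤ D ∧
    ∀ (p M a b : ℝ) (v : ℝ → E3 → E3), 2 ≤ p → 0 < M → IsMildFlow φ C p M a b v →
      ∀ t σ κ S : ℝ, 0 < σ → 0 ≤ κ → a ≤ t - σ → t ≤ b → 0 ≤ S →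
        (∀ s ∈ Ioc (t - σ) t, s ≤ t - κ →
          ∫⁻ y, ‖v s y‖ₑ ^ 2 ∂wtMeasure ≤ ENNReal.ofReal S) →
        ‖lpProj φ 1 (v t) 0‖ₑ ≤ ENNReal.ofReal (D * (M / σ + κ * M ^ 2 + S)) := by
  obtain ⟨D₀, hD₀, h₀⟩ := exists_lintegral_wtMeasure_le
  refine ⟨32 * C * D₀ + 1, by nlinarith [mul_nonneg hC (by linarith : (0 : ℝ) ≤ D₀)],
    fun p M a b v hp hM hv t σ κ S hσ hκ ha hb hS hSb => ?_⟩
  have hD₀0 : 0 < D₀ := by linarith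
  have hle : ∀ f : E3 → ENNReal, ∫⁻ y, ENNReal.ofReal (wt 9 ((1 : ℝ) • (0 - y))) * f y ≤
      ∫⁻ y, f y ∂wtMeasure := by
    intro f
    rw [lintegral_wtMeasure]
    refine lintegral_mono fun y => mul_le_mul_left (ENNReal.ofReal_le_ofReal ?_) _
    refine (wt_le_wt (show 5 ≤ 9 by norm_num) _).trans (le_of_eq ?_)
    rw [wt, wt, one_smul, zero_sub, norm_neg]
  have h1 := h₀ p M 1 (v (t - σ)) hM one_pos (by linarith) (hv.continuous _) (hv.morrey _)
  simp only [ENNReal.rpow_one, Real.rpow_one] at h1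
  have h2 : ∀ s, ∫⁻ y, ‖v s y‖ₑ ^ 2 ∂wtMeasure ≤ ENNReal.ofReal (D₀ * M ^ 2) := by
    intro s
    have := h₀ p M 2 (v s) hM two_pos hp (hv.continuous _) (hv.morrey _)
    rw [Real.rpow_two] at this
    refine le_trans (le_of_eq (lintegral_congr fun y => ?_)) this
    exact_mod_cast (ENNReal.rpow_natCast ‖v s y‖ₑ 2).symm
  have hd := hv.duhamel 1 one_pos t σ hσ ha hb 0
  have hexp : ∀ s ≤ t, Real.exp (-((1 : ℝ) ^ 2 * (t - s)) / 32) ≤ 1 := by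
    intro s hs
    rw [Real.exp_le_one_iff]; linarith
  refine hd.trans ?_
  calc _ ≤ ENNReal.ofReal (C * 1 ^ 3 * (32 / σ)) * ENNReal.ofReal (D₀ * M) +
        ∫⁻ s in Ioc (t - σ) t, ((Ioc (t - κ) t).indicator
          (fun _ => ENNReal.ofReal (C * (D₀ * M ^ 2))) s +
          ENNReal.ofReal (C * S) *
            ENNReal.ofReal (Real.exp (-((1 : ℝ) ^ 2 * (t - s)) / 32))) := by
        refine add_le_add ?_ ?_
        · refine mul_le_mul' (ENNReal.ofReal_le_ofReal ?_) ((hle _).trans h1)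
          gcongr
          have := exp_neg_le_inv (by positivity : 0 < 1 ^ 2 * σ / 32)
          rw [neg_div]
          refine this.trans (le_of_eq ?_)
          rw [one_pow, one_mul, inv_div]
        · refine setLIntegral_mono' measurableSet_Ioc fun s hs => ?_
          -- In the last `κ` units of time only the a priori energy bound `D₀M²` is available, and
          -- smallness comes from the length of the window. Earlier times use `S` and the integrated
          -- heat factor.
          by_cases hsκ : s ∈ Ioc (t - κ) t
          · rw [indicator_of_mem hsκ]
            refine le_add_right ?_
            refine (mul_le_mul' (ENNReal.ofReal_le_ofReal ?_) ((hle _).trans (h2 s))).trans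
              (le_of_eq (ENNReal.ofReal_mul hC).symm)
            have := hexp s hs.2
            rw [one_pow, mul_one]
            exact mul_le_of_le_one_right hC this
          · rw [indicator_of_notMem hsκ, zero_add, ← ENNReal.ofReal_mul (by positivity)]
            have hs' : s ≤ t - κ := by
              by_contra hcon
              exact hsκ ⟨not_le.1 hcon, hs.2⟩
            refine (mul_le_mul_right ((hle _).trans (hSb s hs hs')) _).trans (le_of_eq ?_)
            rw [← ENNReal.ofReal_mul (by positivity)]
            congr 1; ring
    _ ≤ ENNReal.ofReal (C * 1 ^ 3 * (32 / σ)) * ENNReal.ofReal (D₀ * M) +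
        (ENNReal.ofReal (C * (D₀ * M ^ 2)) * ENNReal.ofReal κ +
          ENNReal.ofReal (C * S) * ENNReal.ofReal (32 * ((1 : ℝ) ^ 2)⁻¹)) := by
        gcongr
        rw [lintegral_add_left (measurable_const.indicator measurableSet_Ioc),
          lintegral_const_mul' _ _ ENNReal.ofReal_ne_top]
        refine add_le_add ?_ (mul_le_mul_right (lintegral_exp_le one_pos t hσ) _)
        refine (setLIntegral_le_lintegral _ _).trans ?_
        rw [lintegral_indicator measurableSet_Ioc, setLIntegral_const, Real.volume_Ioc,
          sub_sub_cancel]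
    _ ≤ _ := by
        rw [← ENNReal.ofReal_mul (by positivity), ← ENNReal.ofReal_mul (by positivity),
          ← ENNReal.ofReal_mul (by positivity), ← ENNReal.ofReal_add (by positivity)
          (by positivity), ← ENNReal.ofReal_add (by positivity) (by positivity)]
        refine ENNReal.ofReal_le_ofReal ?_
        have e1 : 0 ≤ 31 * (C * D₀ * (κ * M ^ 2)) := by positivity
        have e2 : 32 * C * S ≤ 32 * C * S * D₀ := le_mul_of_one_le_right (by positivity) hD₀
        have e3 : 0 ≤ M / σ + κ * M ^ 2 + S := by positivity
        calc _ = 32 * C * D₀ * (M / σ) + C * D₀ * (κ * M ^ 2) + 32 * C * S := by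
              field_simp; ring
          _ ≤ _ := by linarith

/-! ### Littlewood-Paley summation -/

theorem eLpNorm_two_sq (f : E3 → E3) :
    eLpNorm f 2 wtMeasure ^ 2 = ∫⁻ y, ‖f y‖ₑ ^ 2 ∂wtMeasure := by
  have h := eLpNorm_nnreal_pow_eq_lintegral (f := f) (μ := wtMeasure) (p := 2) two_ne_zero
  have h2 : ((2 : NNReal) : ℝ) = ((2 : ℕ) : ℝ) := by norm_num
  rw [h2, ENNReal.rpow_natCast] at h
  simp only [ENNReal.rpow_natCast] at h
  exact h

theorem eLpNorm_two_le {f : E3 → E3} {B : ℝ}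
    (h : ∫⁻ y, ‖f y‖ₑ ^ 2 ∂wtMeasure ≤ ENNReal.ofReal B) :
    eLpNorm f 2 wtMeasure ≤ ENNReal.ofReal (Real.sqrt B) := by
  rcases le_total B 0 with hB | hB
  · rw [ENNReal.ofReal_of_nonpos hB, ← eLpNorm_two_sq, nonpos_iff_eq_zero] at h
    rw [pow_eq_zero_iff two_ne_zero] at h
    rw [h]; exact zero_le
  · rw [← eLpNorm_two_sq, ← Real.sq_sqrt hB, ENNReal.ofReal_pow (Real.sqrt_nonneg _)] at h
    exact (ENNReal.pow_le_pow_left_iff two_ne_zero).1 h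

theorem lintegral_sq_le_of_eLpNorm_two_le {f : E3 → E3} {B : ℝ} (hB : 0 ≤ B)
    (h : eLpNorm f 2 wtMeasure ≤ ENNReal.ofReal B) :
    ∫⁻ y, ‖f y‖ₑ ^ 2 ∂wtMeasure ≤ ENNReal.ofReal (B ^ 2) := by
  rw [← eLpNorm_two_sq, ENNReal.ofReal_pow hB]
  gcongr

namespace IsLittlewoodPaleyBump

variable {φ : E3 → ℝ}

/-- The partial sums telescope to `lpLow` at frequency `2ᵏL`. Pointwise convergence and Fatou's
lemma suffice, so convergence of the series in norm is not required. -/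
theorem eLpNorm_le_tsum (hφ : IsLittlewoodPaleyBump φ) {p M : ℝ} (hp : 2 ≤ p) (hM : 0 < M)
    {v : E3 → E3} (hv : Continuous v) (hB : MorreyBound p M v) {L : ℝ} (hL : 0 < L) :
    eLpNorm v 2 wtMeasure ≤ eLpNorm (lpLow φ L v) 2 wtMeasure +
      ∑' j : ℕ, eLpNorm (lpProj φ (2 ^ (j + 1) * L) v) 2 wtMeasure := by
  have hfin : ∀ k : ℕ, eLpNorm (lpLow φ (2 ^ k * L) v) 2 wtMeasure ≤
      eLpNorm (lpLow φ L v) 2 wtMeasure +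
        ∑ j ∈ Finset.range k, eLpNorm (lpProj φ (2 ^ (j + 1) * L) v) 2 wtMeasure := by
    intro k
    induction k with
    | zero => simp
    | succ k ih =>
      have e : lpLow φ (2 ^ (k + 1) * L) v =
          lpLow φ (2 ^ k * L) v + lpProj φ (2 ^ (k + 1) * L) v := by
        ext1 x
        have : (2 : ℝ) ^ (k + 1) * L / 2 = 2 ^ k * L := by rw [pow_succ]; ring
        rw [Pi.add_apply, lpProj, this]
        abel
      rw [e, Finset.sum_range_succ, ← add_assoc]
      refine (eLpNorm_add_le
        (hφ.aestronglyMeasurable_lpLow (by positivity) hv).aestronglyMeasurable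
        (hφ.aestronglyMeasurable_lpProj (by positivity) hv).aestronglyMeasurable
        one_le_two).trans ?_
      gcongr
  have hlim : Filter.Tendsto (fun k : ℕ => (2 : ℝ) ^ k * L) Filter.atTop Filter.atTop :=
    (tendsto_pow_atTop_atTop_of_one_lt one_lt_two).atTop_mul_const hL
  have h1 := Lp.eLpNorm_lim_le_liminf_eLpNorm (p := 2) (μ := wtMeasure)
    (f := fun (k : ℕ) => lpLow φ (2 ^ k * L) v)
    (fun k => (hφ.aestronglyMeasurable_lpLow (by positivity) hv).aestronglyMeasurable) v
    (Filter.Eventually.of_forall fun x => (hφ.tendsto_lpLow hp hM hv hB x).comp hlim)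
  refine h1.trans (Filter.liminf_le_of_frequently_le' (Filter.Frequently.of_forall fun k => ?_))
  refine (hfin k).trans ?_
  gcongr
  exact ENNReal.sum_le_tsum _

end IsLittlewoodPaleyBump

/-- On the ball one factor is replaced by its supremum and the other is kept in `L¹`; outside, the
global bound is paired with the small mass of the weight. -/
theorem lintegral_sq_le_of_le_on_ball {f : E3 → E3} {e G R : ℝ} (hG : 0 ≤ G)
    (hR : 0 < R) (h1 : ∀ x, ‖x‖ ≤ R → ‖f x‖ₑ ≤ ENNReal.ofReal e)
    (h2 : ∀ x, ‖f x‖ₑ ≤ ENNReal.ofReal G) :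
    ∫⁻ x, ‖f x‖ₑ ^ 2 ∂wtMeasure ≤ ENNReal.ofReal e * ∫⁻ x, ‖f x‖ₑ ∂wtMeasure +
      ENNReal.ofReal (G ^ 2 * (wtMass / R)) := by
  have hm : MeasurableSet {y : E3 | R < ‖y‖} :=
    measurableSet_lt measurable_const continuous_norm.measurable
  have hpt : ∀ x, ‖f x‖ₑ ^ 2 ≤ ENNReal.ofReal e * ‖f x‖ₑ +
      {y : E3 | R < ‖y‖}.indicator (fun _ => ENNReal.ofReal (G ^ 2)) x := by
    intro x
    rcases le_or_gt ‖x‖ R with hx | hx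
    · refine le_add_right ?_
      rw [sq]
      exact mul_le_mul_left (h1 x hx) _
    · refine le_add_left ?_
      rw [indicator_of_mem (show x ∈ {y : E3 | R < ‖y‖} from hx), ENNReal.ofReal_pow hG]
      gcongr
      exact h2 x
  refine (lintegral_mono hpt).trans ?_
  rw [lintegral_add_right _ (measurable_const.indicator hm),
    lintegral_const_mul' _ _ ENNReal.ofReal_ne_top, lintegral_indicator hm, setLIntegral_const]
  gcongr
  rw [ENNReal.ofReal_mul (by positivity)]
  gcongr
  exact wtMeasure_compl_ball_le hR

/-- Interpolation between `L¹` and `L^p` by cutting at height `l`, which stays free so that it can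
be tuned to the frequency. -/
theorem lintegral_sq_le_add_rpow {f : E3 → E3} (hf : StronglyMeasurable f) {p l : ℝ} (hp : 2 ≤ p)
    (hl : 0 < l) :
    ∫⁻ x, ‖f x‖ₑ ^ 2 ∂wtMeasure ≤ ENNReal.ofReal l * ∫⁻ x, ‖f x‖ₑ ∂wtMeasure +
      ENNReal.ofReal (l ^ (2 - p)) * ∫⁻ x, ‖f x‖ₑ ^ p ∂wtMeasure := by
  have hpt : ∀ x, ‖f x‖ₑ ^ 2 ≤ ENNReal.ofReal l * ‖f x‖ₑ +
      ENNReal.ofReal (l ^ (2 - p)) * ‖f x‖ₑ ^ p := by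
    intro x
    rw [← ofReal_norm, ENNReal.ofReal_rpow_of_nonneg (norm_nonneg _) (by linarith),
      ← ENNReal.ofReal_pow (norm_nonneg _), ← ENNReal.ofReal_mul hl.le,
      ← ENNReal.ofReal_mul (by positivity), ← ENNReal.ofReal_add (by positivity) (by positivity)]
    refine ENNReal.ofReal_le_ofReal ?_
    rcases le_or_gt ‖f x‖ l with h1 | h1
    · have : 0 ≤ l ^ (2 - p) * ‖f x‖ ^ p := by positivity
      nlinarith [norm_nonneg (f x)]
    · have h2 : ‖f x‖ ^ (2 - p) ≤ l ^ (2 - p) :=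
        Real.rpow_le_rpow_of_nonpos hl h1.le (by linarith)
      have h3 : ‖f x‖ ^ 2 = ‖f x‖ ^ (2 - p) * ‖f x‖ ^ p := by
        rw [← Real.rpow_add (hl.trans h1), ← Real.rpow_natCast]; congr 1; push_cast; ring
      have h4 : ‖f x‖ ^ (2 - p) * ‖f x‖ ^ p ≤ l ^ (2 - p) * ‖f x‖ ^ p := by gcongr
      have : 0 ≤ l * ‖f x‖ := by positivity
      linarith
  refine (lintegral_mono hpt).trans (le_of_eq ?_)
  rw [lintegral_add_left (hf.measurable.enorm.const_mul _),
    lintegral_const_mul' _ _ ENNReal.ofReal_ne_top, lintegral_const_mul' _ _ ENNReal.ofReal_ne_top]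

theorem tsum_le_of_geometric {f : ℕ → ENNReal} {n : ℕ} {B Q r : ℝ} (hB : 0 ≤ B) (hQ : 0 ≤ Q)
    (hr0 : 0 ≤ r) (hr1 : r < 1) (h1 : ∀ j < n, f j ≤ ENNReal.ofReal B)
    (h2 : ∀ j, f (j + n) ≤ ENNReal.ofReal (Q * r ^ j)) :
    ∑' j, f j ≤ ENNReal.ofReal (n * B + Q * (1 - r)⁻¹) := by
  have hr : 0 < 1 - r := by linarith
  rw [← ENNReal.summable.sum_add_tsum_nat_add' (k := n),
    ENNReal.ofReal_add (by positivity) (by positivity)]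
  refine add_le_add ?_ ?_
  · calc ∑ j ∈ Finset.range n, f j ≤ ∑ _j ∈ Finset.range n, ENNReal.ofReal B :=
          Finset.sum_le_sum fun j hj => h1 j (Finset.mem_range.1 hj)
      _ = _ := by
          rw [Finset.sum_const, Finset.card_range, nsmul_eq_mul,
            ENNReal.ofReal_mul (by positivity), ENNReal.ofReal_natCast]
  · calc ∑' j, f (j + n) ≤ ∑' j : ℕ, ENNReal.ofReal Q * ENNReal.ofReal r ^ j := by
          refine ENNReal.tsum_le_tsum fun j => (h2 j).trans (le_of_eq ?_)
          rw [ENNReal.ofReal_mul hQ, ENNReal.ofReal_pow hr0]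
      _ = _ := by
          rw [ENNReal.tsum_mul_left, ENNReal.tsum_geometric, ← ENNReal.ofReal_one,
            ← ENNReal.ofReal_sub _ hr0, ← ENNReal.ofReal_inv_of_pos hr, ← ENNReal.ofReal_mul hQ]

/-! ### Improvement of the weighted energy -/

/-- Variant for frequencies below one, where the `L¹` estimate is not available but the square of
the supremum is already small enough. -/
theorem lintegral_sq_le_of_le_on_ball_of_le {f : E3 → E3} {e G R : ℝ} (he : 0 ≤ e) (hG : 0 ≤ G)
    (hR : 0 < R) (h1 : ∀ x, ‖x‖ ≤ R → ‖f x‖ₑ ≤ ENNReal.ofReal e)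
    (h2 : ∀ x, ‖f x‖ₑ ≤ ENNReal.ofReal G) :
    ∫⁻ x, ‖f x‖ₑ ^ 2 ∂wtMeasure ≤ ENNReal.ofReal (e ^ 2 * wtMass + G ^ 2 * (wtMass / R)) := by
  have hW := wtMass_nonneg
  have hm : MeasurableSet {y : E3 | R < ‖y‖} :=
    measurableSet_lt measurable_const continuous_norm.measurable
  have hpt : ∀ x, ‖f x‖ₑ ^ 2 ≤ ENNReal.ofReal (e ^ 2) +
      {y : E3 | R < ‖y‖}.indicator (fun _ => ENNReal.ofReal (G ^ 2)) x := by
    intro x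
    rcases le_or_gt ‖x‖ R with hx | hx
    · refine le_add_right ?_
      rw [ENNReal.ofReal_pow he]
      gcongr
      exact h1 x hx
    · refine le_add_left ?_
      rw [indicator_of_mem (show x ∈ {y : E3 | R < ‖y‖} from hx), ENNReal.ofReal_pow hG]
      gcongr
      exact h2 x
  refine (lintegral_mono hpt).trans ?_
  rw [lintegral_add_right _ (measurable_const.indicator hm), lintegral_const,
    lintegral_indicator hm, setLIntegral_const, ENNReal.ofReal_add (by positivity) (by positivity),
    ENNReal.ofReal_mul (by positivity), ENNReal.ofReal_mul (by positivity)]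
  gcongr
  · exact wtMeasure_univ_le
  · exact wtMeasure_compl_ball_le hR

theorem sqrt_le_mul_sqrt {x c y : ℝ} (hc : 0 ≤ c) (h : x ≤ c * y) :
    Real.sqrt x ≤ Real.sqrt c * Real.sqrt y := by
  rw [← Real.sqrt_mul hc]
  exact Real.sqrt_le_sqrt h

set_option maxHeartbeats 1000000 in
/-- If the Littlewood-Paley pieces at the frequencies in `[1 / A₂, A₂]` are small on a large ball,
then the weighted energy is small in terms of the weighted energy at earlier times. -/
theorem exists_lintegral_sq_le {φ : E3 → ℝ} (hφ : IsLittlewoodPaleyBump φ) {C p : ℝ} (hC : 0 ≤ C)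
    (hp2 : 2 < p) (hp3 : p ≤ 3) : ∃ D : ℝ, 1 ≤ D ∧ ∀ (M a b : ℝ) (v : ℝ → E3 → E3), 1 ≤ M →
      IsMildFlow φ C p M a b v → ∀ (t σ S ε A₂ A₄ : ℝ) (m : ℕ), 0 < σ → a ≤ t - σ → t ≤ b →
      0 ≤ S → 0 < ε → 2 ^ m ≤ A₂ → A₂ < 2 ^ (m + 1) → 0 < A₄ →
      (∀ s ∈ Ioc (t - σ) t, ∫⁻ y, ‖v s y‖ₑ ^ 2 ∂wtMeasure ≤ ENNReal.ofReal S) →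
      M ≤ ε * A₂ → M ^ 2 * A₂ ^ 2 ≤ ε ^ 2 * A₄ →
      M / σ + S + M ^ 3 ≤ ε ^ 2 * A₂ ^ ((p - 2) / 2) →
      (∀ N ∈ Icc A₂⁻¹ A₂, ∀ x, ‖x‖ ≤ A₄ → ‖lpProj φ N (v t) x‖ ≤ ε * N) →
      ∫⁻ y, ‖v t y‖ₑ ^ 2 ∂wtMeasure ≤
        ENNReal.ofReal (D * (m + 1) ^ 2 * (ε * (M / σ + S) + ε ^ 2)) := by
  obtain ⟨D₁, hD₁, h₁⟩ := exists_lintegral_lpProj_le φ hC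
  obtain ⟨D₂, hD₂, h₂⟩ := exists_lintegral_lpProj_rpow_le hφ (by linarith : 1 < p)
  obtain ⟨D₃, hD₃, h₃⟩ := hφ.exists_enorm_le_of_morreyBound
  have hW := wtMass_nonneg
  set W := wtMass
  set δ : ℝ := (p - 2) / 2 with hδ
  have hδ0 : 0 < δ := by rw [hδ]; linarith
  have hδ1 : δ ≤ 1 / 2 := by rw [hδ]; linarith
  set r : ℝ := 2 ^ (-δ / 2) with hr
  have hr0 : 0 < r := by positivity
  have hr1 : r < 1 := Real.rpow_lt_one_of_one_lt_of_neg one_lt_two (by linarith)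
  have hr2 : 0 < 1 - r := by linarith
  set K : ℝ := Real.sqrt (4 * D₃ ^ 2 * W) + 2 * Real.sqrt (D₁ + D₃ ^ 2 * W + W) +
    Real.sqrt (D₁ + D₂) * (1 - r)⁻¹ with hK
  have hD₁0 : 0 < D₁ := by linarith
  have hD₂0 : 0 < D₂ := by linarith
  have hD₃0 : 0 < D₃ := by linarith
  have hK0 : 0 ≤ K := by positivity
  refine ⟨K ^ 2 + 1, by nlinarith, ?_⟩
  intro M a b v hM hv t σ S ε A₂ A₄ m hσ ha hb hS hε hA₂ hA₂' hA₄ hSb hsm1 hsm2 hsm3 H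
  have hM0 : 0 < M := by linarith
  have hvt := hv.continuous t
  have hBt := hv.morrey t
  have hA₂1 : 1 ≤ A₂ := le_trans (one_le_pow₀ one_le_two) hA₂
  have hA₂0 : 0 < A₂ := by linarith
  set Q : ℝ := M / σ + S with hQ
  have hQ0 : 0 ≤ Q := by positivity
  set P : ℝ := ε * Q + ε ^ 2 with hP
  have hP0 : 0 < P := by positivity
  have hεP : ε ≤ Real.sqrt P := by
    apply Real.le_sqrt_of_sq_le
    rw [hP]
    have : 0 ≤ ε * Q := by positivity
    linarith
  -- The lowest frequency, comparable to `A₂⁻¹`. The `2m` pieces `2^(j+1)L` run from `2·2⁻ᵐ` to `2ᵐ`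
  -- and stay inside `[A₂⁻¹, A₂]`; all later ones count as high.
  set L : ℝ := ((2 : ℝ) ^ m)⁻¹ with hL
  have hL0 : 0 < L := by positivity
  have hLA : A₂⁻¹ ≤ L := inv_anti₀ (by positivity) hA₂
  have h2L : (2 : ℝ) ^ m * L = 1 := mul_inv_cancel₀ (by positivity)
  have hLA2 : L * A₂ ≤ 2 := by
    have : L * A₂ ≤ L * 2 ^ (m + 1) := by gcongr
    rw [pow_succ] at this
    linarith
  have hML : M * L ≤ 2 * ε := by
    calc M * L ≤ ε * A₂ * L := by gcongr
      _ = ε * (L * A₂) := by ring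
      _ ≤ ε * 2 := by gcongr
      _ = _ := by ring
  have hlow : eLpNorm (lpLow φ L (v t)) 2 wtMeasure ≤
      ENNReal.ofReal (Real.sqrt (4 * D₃ ^ 2 * W) * Real.sqrt P) := by
    have hb : ∀ x, ‖lpLow φ L (v t) x‖ₑ ≤ ENNReal.ofReal (D₃ * M * L) := fun x =>
      (h₃ p M (v t) (by linarith) hM0 hvt hBt L x hL0).1
    have h4 : ∫⁻ y, ‖lpLow φ L (v t) y‖ₑ ^ 2 ∂wtMeasure ≤
        ENNReal.ofReal ((D₃ * M * L) ^ 2 * W) := by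
      rw [ENNReal.ofReal_mul (by positivity), ENNReal.ofReal_pow (by positivity)]
      calc _ ≤ ∫⁻ _y, ENNReal.ofReal (D₃ * M * L) ^ 2 ∂wtMeasure :=
            lintegral_mono fun y => pow_le_pow_left' (hb y) 2
        _ ≤ _ := by
            rw [lintegral_const]
            gcongr
            exact wtMeasure_univ_le
    refine (eLpNorm_two_le h4).trans (ENNReal.ofReal_le_ofReal (sqrt_le_mul_sqrt (by positivity) ?_))
    have h5 : (M * L) ^ 2 ≤ (2 * ε) ^ 2 := by gcongr
    have h6 : 0 ≤ ε * Q := by positivity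
    calc (D₃ * M * L) ^ 2 * W = D₃ ^ 2 * W * (M * L) ^ 2 := by ring
      _ ≤ D₃ ^ 2 * W * (4 * P) := by
          gcongr
          rw [hP]; linarith
      _ = _ := by ring
  have hmid : ∀ j < 2 * m, eLpNorm (lpProj φ (2 ^ (j + 1) * L) (v t)) 2 wtMeasure ≤
      ENNReal.ofReal (Real.sqrt (D₁ + D₃ ^ 2 * W + W) * Real.sqrt P) := by
    intro j hj
    set N : ℝ := 2 ^ (j + 1) * L with hN
    have hN0 : 0 < N := by positivity
    have hN1 : A₂⁻¹ ≤ N := hLA.trans (le_mul_of_one_le_left hL0.le (one_le_pow₀ one_le_two))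
    have hN2 : N ≤ A₂ := by
      have h5 : (2 : ℝ) ^ (j + 1) ≤ 2 ^ (m + m) :=
        pow_le_pow_right₀ one_le_two (by omega)
      calc N ≤ 2 ^ (m + m) * L := by rw [hN]; gcongr
        _ = 2 ^ m := by rw [pow_add, mul_assoc, h2L, mul_one]
        _ ≤ A₂ := hA₂
    have hball : ∀ x, ‖x‖ ≤ A₄ → ‖lpProj φ N (v t) x‖ₑ ≤ ENNReal.ofReal (ε * N) := by
      intro x hx
      rw [← ofReal_norm]
      exact ENNReal.ofReal_le_ofReal (H N ⟨hN1, hN2⟩ x hx)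
    have hglob : ∀ x, ‖lpProj φ N (v t) x‖ₑ ≤ ENNReal.ofReal (D₃ * M * N) := fun x =>
      (h₃ p M (v t) (by linarith) hM0 hvt hBt N x hN0).2
    have htail : (D₃ * M * N) ^ 2 * (W / A₄) ≤ D₃ ^ 2 * W * ε ^ 2 := by
      have h6 : M ^ 2 * N ^ 2 / A₄ ≤ ε ^ 2 := by
        rw [div_le_iff₀ hA₄]
        refine le_trans ?_ hsm2
        gcongr
      calc _ = D₃ ^ 2 * W * (M ^ 2 * N ^ 2 / A₄) := by field_simp
        _ ≤ _ := by gcongr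
    have hεQ : 0 ≤ ε * Q := by positivity
    -- For `N ≥ 1` the supremum `εN` meets the `L¹` bound `N⁻¹Q`, and the product `εQ` does not
    -- depend on `N`. For `N < 1` the bound `(εN)²` is at most `ε²`.
    rcases le_or_gt 1 N with h1N | h1N
    · have h5 := h₁ p M a b v hp2.le hM0 hv N t σ S h1N hσ ha hb hS hSb
      have h6 := (lintegral_sq_le_of_le_on_ball (by positivity) hA₄ hball hglob).trans
        (add_le_add_left (mul_le_mul_right h5 _) _)
      rw [← ENNReal.ofReal_mul (by positivity), ← ENNReal.ofReal_add (by positivity)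
        (by positivity)] at h6
      refine (eLpNorm_two_le h6).trans
        (ENNReal.ofReal_le_ofReal (sqrt_le_mul_sqrt (by positivity) ?_))
      have e1 : ε * N * (D₁ * N⁻¹ * Q) = D₁ * (ε * Q) := by field_simp
      rw [e1]
      have e2 : D₁ * (ε * Q) ≤ D₁ * P := by
        gcongr; rw [hP]; linarith [sq_nonneg ε]
      have e3 : D₃ ^ 2 * W * ε ^ 2 ≤ D₃ ^ 2 * W * P := by
        gcongr; rw [hP]; linarith
      have e4 : 0 ≤ W * P := by positivity
      linarith
    · have h6 := lintegral_sq_le_of_le_on_ball_of_le (by positivity) (by positivity) hA₄ hball hglob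
      refine (eLpNorm_two_le h6).trans
        (ENNReal.ofReal_le_ofReal (sqrt_le_mul_sqrt (by positivity) ?_))
      have e1 : (ε * N) ^ 2 * W ≤ W * P := by
        rw [mul_comm W]
        gcongr
        rw [hP]
        have : (ε * N) ^ 2 ≤ (ε * 1) ^ 2 := by gcongr
        linarith
      have e3 : D₃ ^ 2 * W * ε ^ 2 ≤ D₃ ^ 2 * W * P := by
        gcongr; rw [hP]; linarith
      have e4 : 0 ≤ D₁ * P := by positivity
      linarith
  have hhigh : ∀ j, eLpNorm (lpProj φ (2 ^ (j + 2 * m + 1) * L) (v t)) 2 wtMeasure ≤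
      ENNReal.ofReal (Real.sqrt (D₁ + D₂) * ε * r ^ j) := by
    intro j
    set N : ℝ := 2 ^ (j + 2 * m + 1) * L with hN
    have hN0 : 0 < N := by positivity
    have hNA : 2 ^ j * A₂ ≤ N := by
      have e : N = 2 ^ j * 2 ^ (m + 1) := by
        rw [hN, show j + 2 * m + 1 = j + (m + 1) + m by ring, pow_add _ (j + (m + 1)), mul_assoc,
          h2L, mul_one, pow_add _ j]
      rw [e]; gcongr
    have h2j : (1 : ℝ) ≤ 2 ^ j := one_le_pow₀ one_le_two
    have hN1 : 1 ≤ N := le_trans (by nlinarith) hNA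
    have h5 := h₁ p M a b v hp2.le hM0 hv N t σ S hN1 hσ ha hb hS hSb
    have h6 := h₂ M (v t) hM0 hvt hBt N hN1
    -- The height `N^(1/2)` turns the two contributions into multiples of `N^(-1/2)` and
    -- `N^((2-p)/2) = N^(-δ)`. As `p ≤ 3`, both are at most `N^(-δ)`; square roots along `N ≥ 2ʲA₂`
    -- give the ratio `r = 2^(-δ/2)`.
    have h7 := (lintegral_sq_le_add_rpow (hφ.aestronglyMeasurable_lpProj hN0 hvt) hp2.le
      (Real.rpow_pos_of_pos hN0 (1 / 2))).trans (add_le_add (mul_le_mul_right h5 _)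
        (mul_le_mul_right h6 _))
    rw [← ENNReal.ofReal_mul (by positivity), ← ENNReal.ofReal_mul (by positivity),
      ← ENNReal.ofReal_add (by positivity) (by positivity)] at h7
    refine (eLpNorm_two_le h7).trans (ENNReal.ofReal_le_ofReal ?_)
    have e1 : N ^ (1 / 2 : ℝ) * (D₁ * N⁻¹ * Q) ≤ D₁ * Q * N ^ (-δ) := by
      have e : N ^ (1 / 2 : ℝ) * N⁻¹ = N ^ (-(1 / 2) : ℝ) := by
        rw [← Real.rpow_neg_one N, ← Real.rpow_add hN0]; norm_num
      calc _ = D₁ * Q * (N ^ (1 / 2 : ℝ) * N⁻¹) := by ring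
        _ ≤ _ := by
            rw [e]
            gcongr
    have e2 : (N ^ (1 / 2 : ℝ)) ^ (2 - p) * (D₂ * M ^ p) ≤ D₂ * M ^ 3 * N ^ (-δ) := by
      have e : (N ^ (1 / 2 : ℝ)) ^ (2 - p) = N ^ (-δ) := by
        rw [← Real.rpow_mul hN0.le]; congr 1; rw [hδ]; ring
      have e' : M ^ p ≤ M ^ 3 := by
        rw [← Real.rpow_natCast M 3]
        exact Real.rpow_le_rpow_of_exponent_le hM (by exact_mod_cast hp3)
      rw [e, mul_comm]
      gcongr
    have e3 : N ^ (-δ) ≤ (A₂ ^ δ)⁻¹ * (r ^ j) ^ 2 := by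
      have e : (r ^ j) ^ 2 = ((2 : ℝ) ^ j) ^ (-δ) := by
        rw [hr, ← Real.rpow_natCast, ← Real.rpow_natCast, ← Real.rpow_natCast, ← Real.rpow_mul
          zero_le_two, ← Real.rpow_mul zero_le_two, ← Real.rpow_mul zero_le_two]
        congr 1; push_cast; ring
      rw [e, ← Real.rpow_neg hA₂0.le, mul_comm, ← Real.mul_rpow (by positivity) hA₂0.le]
      exact Real.rpow_le_rpow_of_nonpos (by positivity) hNA (by linarith)
    have e4 : (Q + M ^ 3) * (A₂ ^ δ)⁻¹ ≤ ε ^ 2 := by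
      rw [← div_eq_mul_inv, div_le_iff₀ (by positivity)]
      exact hsm3
    have e5 : N ^ (1 / 2 : ℝ) * (D₁ * N⁻¹ * Q) + (N ^ (1 / 2 : ℝ)) ^ (2 - p) * (D₂ * M ^ p) ≤
        (D₁ + D₂) * (ε * r ^ j) ^ 2 := by
      calc _ ≤ D₁ * Q * N ^ (-δ) + D₂ * M ^ 3 * N ^ (-δ) := add_le_add e1 e2
        _ ≤ (D₁ + D₂) * (Q + M ^ 3) * N ^ (-δ) := by
            have : 0 ≤ (D₁ * M ^ 3 + D₂ * Q) * N ^ (-δ) := by positivity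
            linarith
        _ ≤ (D₁ + D₂) * (Q + M ^ 3) * ((A₂ ^ δ)⁻¹ * (r ^ j) ^ 2) := by gcongr
        _ = (D₁ + D₂) * ((Q + M ^ 3) * (A₂ ^ δ)⁻¹) * (r ^ j) ^ 2 := by ring
        _ ≤ (D₁ + D₂) * ε ^ 2 * (r ^ j) ^ 2 := by gcongr
        _ = _ := by ring
    refine (sqrt_le_mul_sqrt (by positivity) e5).trans (le_of_eq ?_)
    rw [Real.sqrt_sq (by positivity), mul_assoc]
  have hsum := tsum_le_of_geometric (f := fun j : ℕ =>
    eLpNorm (lpProj φ (2 ^ (j + 1) * L) (v t)) 2 wtMeasure) (n := 2 * m)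
    (by positivity) (by positivity) hr0.le hr1 hmid hhigh
  have htot := (hφ.eLpNorm_le_tsum hp2.le hM0 hvt hBt hL0).trans (add_le_add hlow hsum)
  rw [← ENNReal.ofReal_add (by positivity) (by positivity)] at htot
  -- The number of middle pieces produces the factor `m + 1`, which is squared on returning from the
  -- norm to the energy.
  have hfin : Real.sqrt (4 * D₃ ^ 2 * W) * Real.sqrt P + (((2 * m : ℕ) : ℝ) *
      (Real.sqrt (D₁ + D₃ ^ 2 * W + W) * Real.sqrt P) +
      Real.sqrt (D₁ + D₂) * ε * (1 - r)⁻¹) ≤ K * (m + 1) * Real.sqrt P := by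
    have e1 : Real.sqrt (D₁ + D₂) * ε * (1 - r)⁻¹ ≤
        Real.sqrt (D₁ + D₂) * Real.sqrt P * (1 - r)⁻¹ := by gcongr
    have e2 : 0 ≤ (Real.sqrt (4 * D₃ ^ 2 * W) * m + 2 * Real.sqrt (D₁ + D₃ ^ 2 * W + W) +
      Real.sqrt (D₁ + D₂) * (1 - r)⁻¹ * m) * Real.sqrt P := by positivity
    rw [hK]
    push_cast
    linarith
  have := lintegral_sq_le_of_eLpNorm_two_le (by positivity)
    (htot.trans (ENNReal.ofReal_le_ofReal hfin))
  refine this.trans (ENNReal.ofReal_le_ofReal ?_)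
  rw [mul_pow, mul_pow, Real.sq_sqrt hP0.le]
  have : 0 ≤ 1 * ((m : ℝ) + 1) ^ 2 * P := by positivity
  linarith

/-- If all Littlewood-Paley pieces at the frequencies in `[1 / A₂, A₂]` are small in the past, then
the piece at frequency one is small at the base point. -/
theorem exists_norm_lpProj_one_lt {φ : E3 → ℝ} (hφ : IsLittlewoodPaleyBump φ) {C p : ℝ}
    (hC : 0 ≤ C) (hp2 : 2 < p) (hp3 : p ≤ 3) : ∃ D : ℝ, 1 ≤ D ∧
    ∀ (M a b : ℝ) (v : ℝ → E3 → E3), 1 ≤ M → 0 ≤ b → IsMildFlow φ C p M a b v →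
      ∀ (ε A₂ A₃ A₄ : ℝ) (m : ℕ), 0 < ε → ε ≤ 1 → 2 ^ m ≤ A₂ → A₂ < 2 ^ (m + 1) → 0 < A₄ →
      M ≤ ε * A₂ → M ^ 2 * A₂ ^ 2 ≤ ε ^ 2 * A₄ → D * M ^ 3 ≤ ε ^ 2 * A₂ ^ ((p - 2) / 2) →
      3 * (ε ^ 2)⁻¹ ≤ A₃ → a ≤ -A₃ → D * (m + 1) ^ 4 * M ^ 2 * ε < 1 →
      (∀ t ∈ Icc (-A₃) (-A₃⁻¹), ∀ N ∈ Icc A₂⁻¹ A₂, ∀ x, ‖x‖ ≤ A₄ →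
        ‖lpProj φ N (v t) x‖ ≤ ε * N) →
      ‖lpProj φ 1 (v 0) 0‖ < ε := by
  obtain ⟨D₀, hD₀, h₀⟩ := exists_lintegral_wtMeasure_le
  obtain ⟨E, hE, hstep⟩ := exists_lintegral_sq_le hφ hC hp2 hp3
  obtain ⟨F, hF, hlast⟩ := exists_enorm_lpProj_one_le φ hC
  have hD₀0 : 0 < D₀ := by linarith
  have hE0 : 0 < E := by linarith
  have hF0 : 0 < F := by linarith
  have hFED : 0 < F * E ^ 2 * D₀ := by positivity
  have hED : 0 < E * D₀ := by positivity
  -- The first summand closes the final inequality, the second gives `M/σ + S₁ ≤ 1`, and the rest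
  -- serves the high-frequency condition in the two energy steps.
  refine ⟨7 * (F * E ^ 2 * D₀) + 4 * (E * D₀) + 2 * D₀ + 2, by linarith, ?_⟩
  intro M a b v hM hb hv ε A₂ A₃ A₄ m hε hε1 hA₂ hA₂' hA₄ hs1 hs2 hs3 hA₃ ha hs4 H
  set D : ℝ := 7 * (F * E ^ 2 * D₀) + 4 * (E * D₀) + 2 * D₀ + 2 with hD
  have hM0 : 0 < M := by linarith
  have hM2 : 1 ≤ M ^ 2 := one_le_pow₀ hM
  have hM3 : M ^ 2 ≤ M ^ 3 := pow_le_pow_right₀ hM (by norm_num)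
  have hMM : M ≤ M ^ 2 := by nlinarith
  have hε2 : ε ^ 2 ≤ ε := by nlinarith
  have hε2' : ε ^ 2 ≤ 1 := by linarith
  -- With this time step the linear term `M/σ = Mε²` is as small as the final target. Three
  -- successive steps fit in the available past since `A₃ ≥ 3σ`.
  set σ : ℝ := (ε ^ 2)⁻¹ with hσ
  have hσ0 : 0 < σ := by positivity
  have hσ1 : 1 ≤ σ := (one_le_inv₀ (by positivity)).2 hε2'
  have hMσ : M / σ = M * ε ^ 2 := by rw [hσ, div_inv_eq_mul]
  have hA₃0 : 0 < A₃ := by linarith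
  have hA₃i : A₃⁻¹ ≤ ε ^ 2 := by
    have := inv_anti₀ hσ0 (by linarith : σ ≤ A₃)
    rwa [hσ, inv_inv] at this
  have hA₃i0 : 0 < A₃⁻¹ := by positivity
  set k : ℝ := (m : ℝ) + 1 with hk
  have hk1 : 1 ≤ k := by rw [hk]; linarith [(Nat.cast_nonneg m : (0 : ℝ) ≤ m)]
  have hk2 : 1 ≤ k ^ 2 := one_le_pow₀ hk1
  have hk4 : k ^ 2 ≤ k ^ 4 := pow_le_pow_right₀ hk1 (by norm_num)
  have hE₀ : ∀ s, ∫⁻ y, ‖v s y‖ₑ ^ 2 ∂wtMeasure ≤ ENNReal.ofReal (D₀ * M ^ 2) := by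
    intro s
    have := h₀ p M 2 (v s) hM0 two_pos hp2.le (hv.continuous _) (hv.morrey _)
    rw [Real.rpow_two] at this
    refine le_trans (le_of_eq (lintegral_congr fun y => ?_)) this
    exact_mod_cast (ENNReal.rpow_natCast ‖v s y‖ₑ 2).symm
  have hM2D : M ^ 2 ≤ D₀ * M ^ 2 := le_mul_of_one_le_left (by positivity) hD₀
  -- First round: from the a priori energy `D₀M²` to one with a factor `ε`.
  set S₁ : ℝ := 3 * E * D₀ * k ^ 2 * M ^ 2 * ε with hS₁
  have hS₁0 : 0 < S₁ := by positivity
  have hE₁ : ∀ t, -A₃ + σ ≤ t → t ≤ -A₃⁻¹ →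
      ∫⁻ y, ‖v t y‖ₑ ^ 2 ∂wtMeasure ≤ ENNReal.ofReal S₁ := by
    intro t ht1 ht2
    refine (hstep M a b v hM hv t σ (D₀ * M ^ 2) ε A₂ A₄ m hσ0 (by linarith) (by linarith)
      (by positivity) hε hA₂ hA₂' hA₄ (fun s _ => hE₀ s) hs1 hs2 ?_
      (H t ⟨by linarith, ht2⟩)).trans (ENNReal.ofReal_le_ofReal ?_)
    · refine le_trans ?_ hs3
      rw [hMσ]
      have e1 : M * ε ^ 2 ≤ M * 1 := by gcongr
      have e2 : D₀ * M ^ 2 ≤ D₀ * M ^ 3 := by gcongr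
      have e3 : 0 ≤ (7 * (F * E ^ 2 * D₀) + 4 * (E * D₀) + D₀) * M ^ 3 := by positivity
      linarith
    · rw [hMσ]
      have e1 : M * ε ^ 2 ≤ D₀ * M ^ 2 * 1 := by
        have : M * ε ^ 2 ≤ M * 1 := by gcongr
        linarith
      have e2 : ε ^ 2 ≤ ε * (D₀ * M ^ 2) := by
        have : ε * 1 ≤ ε * (D₀ * M ^ 2) := by gcongr; linarith
        linarith
      calc _ ≤ E * k ^ 2 * (ε * (D₀ * M ^ 2 * 1 + D₀ * M ^ 2) + ε * (D₀ * M ^ 2)) := by gcongr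
        _ = S₁ := by rw [hS₁]; ring
  -- Second round: the energy `S₁` at earlier times yields a factor `ε²`. The admissible times
  -- shrink by another `σ`.
  set S₂ : ℝ := 5 * E ^ 2 * D₀ * k ^ 4 * M ^ 2 * ε ^ 2 with hS₂
  have hS₂0 : 0 < S₂ := by positivity
  have hQ : M / σ + S₁ ≤ 4 * (E * D₀) * k ^ 2 * M ^ 2 * ε := by
    rw [hMσ, hS₁]
    have e1 : M * ε ^ 2 ≤ M ^ 2 * ε := by gcongr
    have e2 : 1 * (M ^ 2 * ε) ≤ (E * D₀ * k ^ 2) * (M ^ 2 * ε) := by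
      gcongr
      have : 1 ≤ E * D₀ := one_le_mul_of_one_le_of_one_le hE hD₀
      exact one_le_mul_of_one_le_of_one_le this hk2
    linarith
  have hQ1 : M / σ + S₁ ≤ 1 := by
    refine hQ.trans (le_trans ?_ hs4.le)
    gcongr
    rw [hD]; linarith
  have hE₂ : ∀ t, -A₃ + 2 * σ ≤ t → t ≤ -A₃⁻¹ →
      ∫⁻ y, ‖v t y‖ₑ ^ 2 ∂wtMeasure ≤ ENNReal.ofReal S₂ := by
    intro t ht1 ht2
    refine (hstep M a b v hM hv t σ S₁ ε A₂ A₄ m hσ0 (by linarith) (by linarith)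
      hS₁0.le hε hA₂ hA₂' hA₄ (fun s hs => hE₁ s (by linarith [hs.1]) (hs.2.trans ht2)) hs1 hs2 ?_
      (H t ⟨by linarith, ht2⟩)).trans (ENNReal.ofReal_le_ofReal ?_)
    · refine le_trans ?_ hs3
      have e3 : 0 ≤ (7 * (F * E ^ 2 * D₀) + 4 * (E * D₀) + 2 * D₀) * M ^ 3 := by positivity
      have e4 : 1 ≤ M ^ 3 := one_le_pow₀ hM
      linarith
    · have e1 : ε ^ 2 ≤ E * D₀ * k ^ 2 * M ^ 2 * ε ^ 2 := by
        have : 1 ≤ E * D₀ * k ^ 2 * M ^ 2 := one_le_mul_of_one_le_of_one_le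
          (one_le_mul_of_one_le_of_one_le (one_le_mul_of_one_le_of_one_le hE hD₀) hk2) hM2
        exact le_mul_of_one_le_left (by positivity) this
      calc _ ≤ E * k ^ 2 * (ε * (4 * (E * D₀) * k ^ 2 * M ^ 2 * ε) +
            E * D₀ * k ^ 2 * M ^ 2 * ε ^ 2) := by gcongr
        _ = S₂ := by rw [hS₂]; ring
  have hfin := hlast p M a b v hp2.le hM0 hv 0 σ A₃⁻¹ S₂ hσ0 hA₃i0.le (by linarith) hb hS₂0.le
    fun s hs hs' => hE₂ s (by linarith [hs.1]) (by linarith)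
  rw [← ofReal_norm, ENNReal.ofReal_le_ofReal_iff (by positivity)] at hfin
  refine lt_of_le_of_lt hfin ?_
  have hbound : M / σ + A₃⁻¹ * M ^ 2 + S₂ ≤ 7 * (E ^ 2 * D₀) * k ^ 4 * M ^ 2 * ε ^ 2 := by
    have hE2 : 1 ≤ E ^ 2 := one_le_pow₀ hE
    have e0 : 1 ≤ E ^ 2 * D₀ * k ^ 4 := one_le_mul_of_one_le_of_one_le
      (one_le_mul_of_one_le_of_one_le hE2 hD₀) (hk2.trans hk4)
    have e1 : M ^ 2 * ε ^ 2 ≤ E ^ 2 * D₀ * k ^ 4 * (M ^ 2 * ε ^ 2) :=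
      le_mul_of_one_le_left (by positivity) e0
    have e2 : M / σ ≤ M ^ 2 * ε ^ 2 := by rw [hMσ]; gcongr
    have e3 : A₃⁻¹ * M ^ 2 ≤ ε ^ 2 * M ^ 2 := by gcongr
    rw [hS₂]
    linarith
  calc F * (M / σ + A₃⁻¹ * M ^ 2 + S₂) ≤ F * (7 * (E ^ 2 * D₀) * k ^ 4 * M ^ 2 * ε ^ 2) := by
        gcongr
    _ = 7 * (F * E ^ 2 * D₀) * k ^ 4 * M ^ 2 * ε * ε := by ring
    _ ≤ D * k ^ 4 * M ^ 2 * ε * ε := by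
        gcongr
        rw [hD]; linarith
    _ < 1 * ε := by gcongr
    _ = ε := one_mul ε

/-! ### The hierarchy of constants -/

/-- The ninth term of the exponential series dominates the eighth power. The power eight appears
because the logarithmic loss is a fourth power of `m`, and `m` is of order `C₀²`. -/
theorem exists_pow_eight_le : ∃ c : ℝ, 0 ≤ c ∧ ∀ x : ℝ, c ≤ x → x ^ 8 ≤ 2 ^ (x / 2) := by
  have hl : 0 < Real.log 2 / 2 := by have := Real.log_pos one_lt_two; positivity
  refine ⟨(Nat.factorial 9 : ℝ) / (Real.log 2 / 2) ^ 9, by positivity, fun x hx => ?_⟩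
  have hx0 : 0 ≤ x := le_trans (by positivity) hx
  have h1 := Real.pow_div_factorial_le_exp (x := Real.log 2 / 2 * x) (by positivity) 9
  have h2 : (2 : ℝ) ^ (x / 2) = Real.exp (Real.log 2 / 2 * x) := by
    rw [Real.rpow_def_of_pos two_pos]; congr 1; ring
  rw [h2]
  refine le_trans ?_ h1
  rw [div_le_iff₀ (by positivity)] at hx
  rw [le_div_iff₀ (by positivity), mul_pow]
  calc x ^ 8 * (Nat.factorial 9 : ℝ) ≤ x ^ 8 * (x * (Real.log 2 / 2) ^ 9) := by gcongr
    _ = _ := by ring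

/-- The smallness conditions hold for the hierarchy of constants with a large base exponent. -/
theorem exists_hierarchy (K D δ : ℝ) (hK : 1 ≤ K) (hD : 1 ≤ D) (hδ : 0 < δ) : ∃ C : ℝ, 1 ≤ C ∧
    ∀ C₀ : ℝ, C ≤ C₀ → ∀ A : ℝ, 2 ≤ A → ∀ m : ℕ, 2 ^ m ≤ A ^ C₀ ^ 2 →
      K * A * A ^ C₀ ≤ A ^ C₀ ^ 2 ∧
      (K * A) ^ 2 * (A ^ C₀ ^ 2) ^ 2 * (A ^ C₀) ^ 2 ≤ A ^ C₀ ^ 4 ∧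
      D * (K * A) ^ 3 * (A ^ C₀) ^ 2 ≤ (A ^ C₀ ^ 2) ^ δ ∧
      3 * (A ^ C₀) ^ 2 ≤ A ^ C₀ ^ 3 ∧
      D * ((m : ℝ) + 1) ^ 4 * (K * A) ^ 2 < A ^ C₀ := by
  obtain ⟨c₁, hc₁, h8⟩ := exists_pow_eight_le
  obtain ⟨c, hc⟩ := pow_unbounded_of_one_lt (81 * K + D) one_lt_two (R := ℝ)
  -- Since `A ≥ 2`, all fixed constants are at most `A ^ c`, and each condition becomes a comparison
  -- of exponents. The last summand handles the condition with the exponent `δ`.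
  set C : ℝ := c₁ + 8 * c + 20 + (8 * c + 20) / δ with hCd
  have hd0 : 0 ≤ (8 * c + 20) / δ := by positivity
  have hcn : (0 : ℝ) ≤ c := Nat.cast_nonneg c
  refine ⟨C, by linarith, fun C₀ hC₀ A hA m hm => ?_⟩
  have hA0 : 0 < A := by linarith
  have hA1 : 1 ≤ A := by linarith
  have hA1' : 1 < A := by linarith
  have hC1 : 8 * c + 20 ≤ C₀ := by linarith
  have hC2 : 8 * c + 20 ≤ δ * C₀ := by
    have : (8 * c + 20) / δ ≤ C₀ := by linarith
    rw [div_le_iff₀ hδ] at this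
    linarith
  have hC20 : 20 ≤ C₀ := by linarith
  have hcA : 81 * K + D ≤ A ^ (c : ℝ) := by
    rw [Real.rpow_natCast]
    exact hc.le.trans (by gcongr)
  have hKA : K ≤ A ^ (c : ℝ) := by linarith
  have hDA : D ≤ A ^ (c : ℝ) := by linarith
  have h81 : 81 ≤ A ^ (c : ℝ) := by linarith
  have hmono : ∀ {x y : ℝ}, x ≤ y → A ^ x ≤ A ^ y := fun h =>
    Real.rpow_le_rpow_of_exponent_le hA1 h
  have hMA : K * A ≤ A ^ ((c : ℝ) + 1) := by
    rw [Real.rpow_add_one hA0.ne']; gcongr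
  have hpow : ∀ (x : ℝ) (n : ℕ), (A ^ x) ^ n = A ^ (x * n) := fun x n => by
    rw [Real.rpow_mul hA0.le, Real.rpow_natCast]
  have hCC : 20 * C₀ ≤ C₀ ^ 2 := by nlinarith
  have hC3 : C₀ ^ 2 ≤ C₀ ^ 3 := pow_le_pow_right₀ (by linarith) (by norm_num)
  have hC4 : 20 * C₀ ^ 2 ≤ C₀ ^ 4 := by nlinarith
  refine ⟨?_, ?_, ?_, ?_, ?_⟩
  · calc K * A * A ^ C₀ ≤ A ^ ((c : ℝ) + 1) * A ^ C₀ := by gcongr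
      _ = A ^ ((c : ℝ) + 1 + C₀) := by rw [← Real.rpow_add hA0]
      _ ≤ _ := hmono (by linarith)
  · calc _ ≤ (A ^ ((c : ℝ) + 1)) ^ 2 * (A ^ C₀ ^ 2) ^ 2 * (A ^ C₀) ^ 2 := by gcongr
      _ = A ^ (((c : ℝ) + 1) * (2 : ℕ) + C₀ ^ 2 * (2 : ℕ) + C₀ * (2 : ℕ)) := by
          rw [hpow, hpow, hpow, ← Real.rpow_add hA0, ← Real.rpow_add hA0]
      _ ≤ _ := hmono (by push_cast; linarith)
  · calc _ ≤ A ^ (c : ℝ) * (A ^ ((c : ℝ) + 1)) ^ 3 * (A ^ C₀) ^ 2 := by gcongr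
      _ = A ^ ((c : ℝ) + ((c : ℝ) + 1) * (3 : ℕ) + C₀ * (2 : ℕ)) := by
          rw [hpow, hpow, ← Real.rpow_add hA0, ← Real.rpow_add hA0]
      _ ≤ A ^ (C₀ ^ 2 * δ) := hmono (by
          push_cast
          have : 20 * C₀ ≤ δ * C₀ * C₀ := by gcongr; linarith
          nlinarith)
      _ = _ := by rw [Real.rpow_mul hA0.le]
  · calc 3 * (A ^ C₀) ^ 2 ≤ A ^ (c : ℝ) * (A ^ C₀) ^ 2 := by gcongr; linarith
      _ = A ^ ((c : ℝ) + C₀ * (2 : ℕ)) := by rw [hpow, ← Real.rpow_add hA0]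
      _ ≤ _ := hmono (by push_cast; linarith)
  -- Here `m` is at most the binary logarithm of `A₂`, hence of order `C₀² log A`. Its fourth power
  -- is `C₀⁸` times a power of `A`; half of the exponent of `A ^ C₀` absorbs `C₀⁸` and the other
  -- half the powers of `A`.
  · have hm1 : (m : ℝ) ≤ 2 * C₀ ^ 2 * A := by
      have h1 := Real.log_le_log (by positivity) hm
      rw [Real.log_pow, Real.log_rpow hA0] at h1
      have h2 : Real.log A ≤ A := (Real.log_le_sub_one_of_pos hA0).trans (by linarith)
      have h3 : (1 : ℝ) / 2 ≤ Real.log 2 := by linarith [Real.log_two_gt_d9]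
      have h4 : (m : ℝ) * (1 / 2) ≤ m * Real.log 2 := by gcongr
      have h5 : C₀ ^ 2 * Real.log A ≤ C₀ ^ 2 * A := by gcongr
      linarith
    have hm2 : (m : ℝ) + 1 ≤ 3 * C₀ ^ 2 * A := by
      have : 1 ≤ C₀ ^ 2 * A := one_le_mul_of_one_le_of_one_le (by nlinarith) hA1
      linarith
    have h9 := h8 C₀ (by linarith)
    have h10 : (2 : ℝ) ^ (C₀ / 2) ≤ A ^ (C₀ / 2) :=
      Real.rpow_le_rpow zero_le_two hA (by linarith)
    calc D * ((m : ℝ) + 1) ^ 4 * (K * A) ^ 2 ≤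
          A ^ (c : ℝ) * (3 * C₀ ^ 2 * A) ^ 4 * (A ^ ((c : ℝ) + 1)) ^ 2 := by gcongr
      _ = A ^ (c : ℝ) * (81 * C₀ ^ 8 * A ^ 4) * (A ^ ((c : ℝ) + 1)) ^ 2 := by ring
      _ ≤ A ^ (c : ℝ) * (A ^ (c : ℝ) * A ^ (C₀ / 2) * A ^ 4) * (A ^ ((c : ℝ) + 1)) ^ 2 := by
          gcongr
          exact h9.trans h10
      _ = A ^ ((c : ℝ) + ((c : ℝ) + C₀ / 2 + (4 : ℕ)) + ((c : ℝ) + 1) * (2 : ℕ)) := by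
          rw [hpow, Real.rpow_add hA0, Real.rpow_add hA0, Real.rpow_add hA0 ((c : ℝ) + C₀ / 2),
            Real.rpow_add hA0 (c : ℝ) (C₀ / 2), Real.rpow_natCast A 4]
      _ < _ := Real.rpow_lt_rpow_of_exponent_lt hA1' (by push_cast; linarith)

/-! ### Conclusion: rescaling and contradiction. -/

theorem mainTheorem8 (φ : E3 → ℝ) (hφ : IsLittlewoodPaleyBump φ) (q : ℝ) (hq : 2 < q) :
    ∃ C : ℝ, ∀ C₀ : ℝ, C ≤ C₀ → ∀ A : ℝ, 2 ≤ A →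
      ∀ (t₀ T : ℝ) (u : ℝ → E3 → E3), 0 < T →
        IsClassicalNavierStokes (t₀ - T) t₀ u →
        weightedNorm q (1 - 3 / q) (t₀ - T) t₀ u ≤ ENNReal.ofReal A →
        (3 < q ∨ (q ≤ 3 ∧ ∀ t ∈ Icc (t₀ - T) t₀, IsAxisymmetric (u t))) →
        ∀ (t₁ : ℝ) (x₁ : E3) (N₁ : ℝ), t₁ ∈ Icc (t₀ - T / 2) t₀ →
          hierarchyConst A C₀ 3 * T ^ (-(1 / 2) : ℝ) ≤ N₁ →
          (hierarchyConst A C₀ 1)⁻¹ * N₁ ≤ ‖lpProj φ N₁ (u t₁) x₁‖ →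
          ∃ (t₂ : ℝ) (x₂ : E3) (N₂ : ℝ),
            t₂ ∈ Icc (t₀ - T) t₁ ∧
            N₂ ∈ Icc ((hierarchyConst A C₀ 2)⁻¹ * N₁) (hierarchyConst A C₀ 2 * N₁) ∧
            (hierarchyConst A C₀ 3)⁻¹ * (N₁ ^ 2)⁻¹ ≤ t₁ - t₂ ∧
            t₁ - t₂ ≤ hierarchyConst A C₀ 3 * (N₁ ^ 2)⁻¹ ∧
            ‖x₂ - x₁‖ ≤ hierarchyConst A C₀ 4 * N₁⁻¹ ∧
            (hierarchyConst A C₀ 1)⁻¹ * N₂ ≤ ‖lpProj φ N₂ (u t₂) x₂‖ := by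
  obtain ⟨p, K, hp2, hp3, hK, hmorrey⟩ := exists_morreyBound hq
  obtain ⟨B, hB, hflow⟩ := exists_isMildFlow_rescaledFlow hφ
  obtain ⟨D, hD, hsmall⟩ := exists_norm_lpProj_one_lt hφ hB hp2 hp3
  obtain ⟨C, hC, hhier⟩ := exists_hierarchy K D ((p - 2) / 2) hK hD (by linarith)
  refine ⟨C, fun C₀ hC₀ A hA t₀ T u hT hu hn hax t₁ x₁ L ht₁ hL hbig => ?_⟩
  have hA0 : 0 < A := by linarith
  have hpos : ∀ j, 0 < hierarchyConst A C₀ j := fun j => Real.rpow_pos_of_pos hA0 _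
  have hA₁ : hierarchyConst A C₀ 1 = A ^ C₀ := by rw [hierarchyConst, pow_one]
  have h1 : 1 ≤ hierarchyConst A C₀ 1 := by
    rw [hA₁]; exact Real.one_le_rpow (by linarith) (by linarith)
  have h2 : 1 ≤ hierarchyConst A C₀ 2 :=
    Real.one_le_rpow (by linarith) (by positivity)
  obtain ⟨m, hm1, hm2⟩ := exists_nat_pow_near h2 one_lt_two
  obtain ⟨c1, c2, c3, c4, c5⟩ := hhier C₀ hC₀ A hA m hm1
  rw [← hA₁] at c1 c2 c3 c4 c5
  have hp1 := hpos 1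
  have hp3' := hpos 3
  have hL0 : 0 < L := lt_of_lt_of_le (mul_pos (hpos 3) (Real.rpow_pos_of_pos hT _)) hL
  have hM : 1 ≤ K * A := by nlinarith
  have h3 : 2 ≤ hierarchyConst A C₀ 3 := by
    have : 1 ≤ hierarchyConst A C₀ 1 ^ 2 := one_le_pow₀ h1
    exact le_trans (by linarith) c4
  have hLT : hierarchyConst A C₀ 3 ^ 2 ≤ L ^ 2 * T := by
    have e1 : (T ^ (-(1 / 2) : ℝ)) ^ 2 = T⁻¹ := by
      rw [← Real.rpow_natCast, ← Real.rpow_mul hT.le, ← Real.rpow_neg_one]; norm_num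
    have e2 : (hierarchyConst A C₀ 3 * T ^ (-(1 / 2) : ℝ)) ^ 2 ≤ L ^ 2 := by gcongr
    rw [mul_pow, e1, ← div_eq_mul_inv, div_le_iff₀ hT] at e2
    exact e2
  -- After rescaling, the past of the base point has length at least `N₁²T/2 ≥ A₃²/2`, and this is
  -- at least `A₃` because `A₃ ≥ 2`.
  have hLT2 : hierarchyConst A C₀ 3 ≤ L ^ 2 * (T / 2) := by nlinarith
  have hab : t₀ - T < t₀ := by linarith
  have hv := hflow p (K * A) (t₀ - T) t₀ u hp2.le (by linarith) hu
    (hmorrey _ _ A u hab hA0.le hu hn hax) t₁ x₁ L hL0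
  by_contra hcon
  push Not at hcon
  have hbase : t₁ + (L ^ 2)⁻¹ * 0 ∈ Icc (t₀ - T) t₀ := by
    rw [mul_zero, add_zero]; exact ⟨by linarith [ht₁.1], ht₁.2⟩
  have hlt := hsmall (K * A) _ _ _ hM (mul_nonneg (by positivity) (by linarith [ht₁.2])) hv
    (hierarchyConst A C₀ 1)⁻¹ (hierarchyConst A C₀ 2) (hierarchyConst A C₀ 3)
    (hierarchyConst A C₀ 4) m (by positivity) (inv_le_one_of_one_le₀ h1) hm1 hm2 (hpos 4)
    (by rw [inv_mul_eq_div, le_div_iff₀ hp1]; exact c1)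
    (by rw [inv_pow, inv_mul_eq_div, le_div_iff₀ (by positivity)]; exact c2)
    (by rw [inv_pow, inv_mul_eq_div, le_div_iff₀ (by positivity)]; exact c3)
    (by rw [inv_pow, inv_inv]; exact c4)
    (by
      have : L ^ 2 * (T / 2) ≤ L ^ 2 * (t₁ - (t₀ - T)) := by
        gcongr; linarith [ht₁.1]
      linarith)
    (by rw [← div_eq_mul_inv, div_lt_one hp1]; exact c5) ?_
  · rw [rescaledFlow_of_mem u x₁ hbase, hφ.lpProj_rescale one_pos hL0, one_mul, smul_zero, add_zero,
      mul_zero, add_zero, norm_smul, Real.norm_of_nonneg (by positivity), inv_mul_eq_div,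
      div_lt_iff₀ hL0] at hlt
    linarith
  -- A point of the rescaled window corresponds to an admissible `(t₂, x₂, N₂)`, so the negated
  -- conclusion supplies the smallness. The half of the interval in front of `t₀ - T/2` guarantees
  -- that the time stays in the slab.
  · intro t ht N hN x hx
    have hLL : 0 < (L ^ 2)⁻¹ := by positivity
    have hN0 : 0 < N := lt_of_lt_of_le (inv_pos.2 (hpos 2)) hN.1
    have ht0 : t < 0 := lt_of_le_of_lt ht.2 (neg_neg_of_pos (inv_pos.2 hp3'))
    have hmem : t₁ + (L ^ 2)⁻¹ * t ∈ Icc (t₀ - T) t₁ := by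
      have e1 : (L ^ 2)⁻¹ * t ≤ 0 := by nlinarith
      have e2 : -(T / 2) ≤ (L ^ 2)⁻¹ * t := by
        rw [inv_mul_eq_div, le_div_iff₀ (by positivity)]
        linarith [ht.1]
      exact ⟨by linarith [ht₁.1], by linarith⟩
    have hc := hcon (t₁ + (L ^ 2)⁻¹ * t) (x₁ + L⁻¹ • x) (N * L) hmem
      ⟨by gcongr; exact hN.1, by gcongr; exact hN.2⟩
      (by have := mul_le_mul_of_nonneg_left ht.2 hLL.le; linarith)
      (by have := mul_le_mul_of_nonneg_left ht.1 hLL.le; linarith)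
      (by
        rw [add_sub_cancel_left, norm_smul, Real.norm_of_nonneg (by positivity), mul_comm]
        gcongr)
    rw [rescaledFlow_of_mem u x₁ ⟨hmem.1, hmem.2.trans ht₁.2⟩, hφ.lpProj_rescale hN0 hL0, norm_smul,
      Real.norm_of_nonneg (by positivity), inv_mul_eq_div, div_le_iff₀ hL0]
    linarith
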